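/- Let $\gamma\in[0,1]$ and let $A:\mathbb R\to\mathbb R$ satisfy: (i) $A$ is $C^\infty$ and $|A(x)|\le Ce^{-\kappa x}$ for $x\ge 0$, for some $C$ and some $\kappa>0$; (ii) for every $a\in\mathbb R$ there is $\eta>0$ such that $A|_{(a,\infty)}$ extends to a bounded holomorphic function on $\{\operatorname{Re}z>a,\ |\operatorname{Im}z|<\eta\}$; (iii) $\int_{\mathbb R}A(s+r)A(r+s')\,dr=\gamma\,\delta(s-s')$ in the sense of distributions, i.e. for all $f,g\in C_c^\infty(\mathbb R)$ the functions $r\mapsto\int A(r+y)f(y)\,dy$ and $r\mapsto\int A(r+y)g(y)\,dy$ are in $L^2(\mathbb R)$ and the integral of their product is $\gamma\int fg$. (The case $\gamma=1$ is the orthogonality condition; $\gamma<1$ corresponds to the thinned function $\sqrt\gamma A$.) For $s\in\mathbb R$ let $A_s$, $K_s=A_s^2$ be the operators on $L^2(\mathbb R_+)$ with kernels $A(x+y+s)$ and $\int_0^\infty A(x+r+s)A(y+r+s)\,dr$. For a kernel $k$ on $\mathbb R_+$ put $$\operatorname{Det}(I-k)=\sum_{n\ge0}\frac{(-1)^n}{n!}\int_{\mathbb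 R_+^n}\det[k(x_i,x_j)]_{i,j=1}^n\,dx .$$ Write $|\delta\rangle$ for the Dirac mass at $0$ (with full weight on $\mathbb R_+$), $\langle 1|$ for integration over $\mathbb R_+$, and $\langle g|(I-k)^{-1}|\delta\rangle = g(0)+\int_0^\infty g(y)\,[(I-k)^{-1}k(\cdot,0)](y)\,dy$. Let $$q_0(s)=\langle\delta|A_s(I-K_s)^{-1}|\delta\rangle,\qquad b(s)=\langle 1|(I+A_s)^{-1}|\delta\rangle .$$ Then, for every $s\in\mathbb R$ and $\alpha\ge 0$: the operators $I-K_s$ and $I\pm A_s$ are invertible on $L^2(\mathbb R_+)$; the Fredholm series and integrals below converge absolutely; $q_0(r)$ and $(r-s)q_0(r)^2$ are integrable on $(s,\infty)$; $\operatorname{Det}(I+A_s)\ne0$; and the following hold. 1. $b=\dfrac{\operatorname{Det}(I-A_s)}{\operatorname{Det}(I+A_s)}$, $\quad b'=q_0b$, $\quad b(s)=\exp\big(-\int_s^\infty q_0(r)\,dr\big)$. 2. The orthogonal-like determinant, with kernel $K_s(x,y)+A(s+x)\big(1-\int_0^\infty A(s+r+y)\,dr\big)$, satisfies $$\operatorname{Det}\big(I-K_s-A_s|\delta\rangle\langle1|(I-A_s)\big)=\operatorname{Det}(I-K_s)\Big(1-\langle1|\tfrac{I-A_s}{I-K_s}A_s|\delta\rangle\Big)=\operatorname{Det}(I-K_s)\,b(s)$$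 $$=\operatorname{Det}(I-A_s)^2=\exp\Big(-\int_s^\infty[(r-s)q_0(r)^2+q_0(r)]\,dr\Big).$$ 3. The symplectic-like determinant, with kernel $K_s(x,y)-\frac12A(s+x)\int_0^\infty A(s+r+y)\,dr$, satisfies $$\operatorname{Det}\big(I-K_s+\tfrac12A_s|\delta\rangle\langle1|A_s\big)=\operatorname{Det}(I-K_s)\Big(1+\tfrac12\langle1|\tfrac{K_s}{I-K_s}|\delta\rangle\Big)=\tfrac14\operatorname{Det}(I-K_s)\Big(2+b(s)+\langle1|\tfrac{I}{I-A_s}|\delta\rangle\Big)$$ $$=\tfrac14\big(\operatorname{Det}(I+A_s)+\operatorname{Det}(I-A_s)\big)^2=\exp\Big(-\int_s^\infty(r-s)q_0(r)^2\,dr\Big)\cosh^2\Big(\tfrac12\int_s^\infty q_0(r)\,dr\Big).$$ 4. The orthogonal-thinned-like determinant, with kernel $K_s(x,y)+A(s+x)\big(\sqrt\alpha-\int_0^\infty A(s+r+y)\,dr\big)$, satisfies $$\operatorname{Det}\big(I-K_s-A_s|\delta\rangle\langle1|(\sqrt\alpha\,I-A_s)\big)=\operatorname{Det}(I-K_s)\Big(1-\langle1|\tfrac{\sqrt\alpha\,I-A_s}{I-K_s}A_s|\delta\rangle\Big)$$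 $$=\operatorname{Det}(I-K_s)\Big(\tfrac{\sqrt\alpha+1}2\,b(s)-\tfrac{\sqrt\alpha-1}2\langle1|\tfrac{I}{I-A_s}|\delta\rangle\Big)=\tfrac{\sqrt\alpha+1}2\operatorname{Det}(I-A_s)^2-\tfrac{\sqrt\alpha-1}2\operatorname{Det}(I+A_s)^2$$ $$=\exp\Big(-\int_s^\infty(r-s)q_0(r)^2\,dr\Big)\Big(\cosh\big(\textstyle\int_s^\infty q_0(r)\,dr\big)-\sqrt\alpha\,\sinh\big(\textstyle\int_s^\infty q_0(r)\,dr\big)\Big).$$ -/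

import Mathlib

open MeasureTheory Set
open scoped ContDiff

noncomputable section

namespace TauRep

/-- Lebesgue measure on the half-line `ℝ₊`. -/
abbrev halfLine : Measure ℝ := volume.restrict (Ioi 0)

/-- The real Hilbert space `L²(ℝ₊)`. -/
abbrev L2 : Type := Lp ℝ 2 halfLine

/-! ### The functions `A` -/

/-- The convolution-type operator `f ↦ (x ↦ ∫_ℝ A(x+y) f(y) dy)` on the whole line. -/
def lineTransform (A : ℝ → ℝ) (f : ℝ → ℝ) (x : ℝ) : ℝ := ∫ y, A (x + y) * f y

/-- The standing assumptions on the real function `A`. -/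
structure Admissible (γ : ℝ) (A : ℝ → ℝ) : Prop where
  /-- `A` is infinitely differentiable. -/
  smooth : ContDiff ℝ ∞ A
  /-- `A` vanishes exponentially fast at `+∞`. -/
  decay : ∃ C κ : ℝ, 0 < κ ∧ ∀ x : ℝ, 0 ≤ x → |A x| ≤ C * Real.exp (-κ * x)
  /-- Analyticity: on every right half-line, `A` is the restriction of a bounded holomorphic
  function on a (possibly thin) horizontal half-strip. -/
  analytic : ∀ a : ℝ, ∃ η : ℝ, 0 < η ∧ ∃ F : ℂ → ℂ,
    DifferentiableOn ℂ F {z | a < z.re ∧ |z.im| < η} ∧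
    (∃ M : ℝ, ∀ z : ℂ, a < z.re → |z.im| < η → ‖F z‖ ≤ M) ∧
    ∀ x : ℝ, a < x → F x = A x
  /-- `x ↦ ∫ A(x+y) f(y) dy` is square integrable for every test function `f`. -/
  memLp : ∀ f : ℝ → ℝ, ContDiff ℝ ∞ f → HasCompactSupport f → MemLp (lineTransform A f) 2 volume
  /-- `∫_ℝ A(s+r) A(r+s') dr = γ δ(s-s')` in the sense of distributions. -/
  orthogonal : ∀ f g : ℝ → ℝ, ContDiff ℝ ∞ f → HasCompactSupport f →
    ContDiff ℝ ∞ g → HasCompactSupport g →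
    ∫ r, lineTransform A f r * lineTransform A g r = γ * ∫ r, f r * g r

/-! ### Kernels on `ℝ₊` -/

/-- The kernel of `A_s`. -/
def kerA (A : ℝ → ℝ) (s : ℝ) : ℝ → ℝ → ℝ := fun x y => A (x + y + s)

/-- The kernel of `-A_s`. -/
def kerNegA (A : ℝ → ℝ) (s : ℝ) : ℝ → ℝ → ℝ := fun x y => -A (x + y + s)

/-- The kernel of `K_s = A_s²`. -/
def kerK (A : ℝ → ℝ) (s : ℝ) : ℝ → ℝ → ℝ :=
  fun x y => ∫ r in Ioi (0 : ℝ), A (x + r + s) * A (y + r + s)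

/-- The function `⟨1|A_s`, that is `y ↦ ∫_0^∞ A(s+r+y) dr`. -/
def oneA (A : ℝ → ℝ) (s y : ℝ) : ℝ := ∫ r in Ioi (0 : ℝ), A (s + r + y)

/-- The kernel of `K_s + A_s|δ⟩⟨1|(I - A_s)`. -/
def kerOrtho (A : ℝ → ℝ) (s : ℝ) : ℝ → ℝ → ℝ :=
  fun x y => kerK A s x y + A (s + x) * (1 - oneA A s y)

/-- The kernel of `K_s - ½ A_s|δ⟩⟨1|A_s`. -/
def kerSympl (A : ℝ → ℝ) (s : ℝ) : ℝ → ℝ → ℝ :=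
  fun x y => kerK A s x y - 1 / 2 * A (s + x) * oneA A s y

/-- The kernel of `K_s + A_s|δ⟩⟨1|(√α I - A_s)`. -/
def kerOrthoThinned (A : ℝ → ℝ) (α s : ℝ) : ℝ → ℝ → ℝ :=
  fun x y => kerK A s x y + A (s + x) * (Real.sqrt α - oneA A s y)

/-! ### Fredholm determinants -/

/-- `∫_{ℝ₊ⁿ} det[k(x_i,x_j)] dx` (equal to `1` for `n = 0`). -/
def fredholmMinor (k : ℝ → ℝ → ℝ) (n : ℕ) : ℝ :=
  ∫ x : Fin n → ℝ, (Matrix.of fun i j => k (x i) (x j)).det ∂(Measure.pi fun _ => halfLine)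

/-- `Det(I - k)` on `L²(ℝ₊)`, as the Fredholm series. -/
def fredholmDet (k : ℝ → ℝ → ℝ) : ℝ :=
  ∑' n : ℕ, (-1) ^ n / (n.factorial : ℝ) * fredholmMinor k n

/-- All integrals of the Fredholm series, and the series itself, converge absolutely. -/
def FredholmConverges (k : ℝ → ℝ → ℝ) : Prop :=
  (∀ n : ℕ, Integrable (fun x : Fin n → ℝ => (Matrix.of fun i j => k (x i) (x j)).det)
    (Measure.pi fun _ => halfLine)) ∧
  Summable fun n : ℕ => (-1) ^ n / (n.factorial : ℝ) * fredholmMinor k n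

/-! ### Resolvents -/

/-- `T` is the bounded operator on `L²(ℝ₊)` with kernel `k`. -/
def IsIntegralOperator (k : ℝ → ℝ → ℝ) (T : L2 →L[ℝ] L2) : Prop :=
  ∀ f : L2, ⇑(T f) =ᵐ[halfLine] fun x => ∫ y in Ioi (0 : ℝ), k x y * f y

open scoped Classical in
/-- The bounded operator on `L²(ℝ₊)` with kernel `k` (zero if there is none). -/
def integralOperator (k : ℝ → ℝ → ℝ) : L2 →L[ℝ] L2 :=
  if h : ∃ T : L2 →L[ℝ] L2, IsIntegralOperator k T then h.choose else 0

open scoped Classical in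
/-- The class of `f` in `L²(ℝ₊)` (zero if `f` is not square integrable). -/
def toL2 (f : ℝ → ℝ) : L2 := if h : MemLp f 2 halfLine then h.toLp f else 0

/-- `(I - k)⁻¹ f` on `L²(ℝ₊)`. -/
def resolvent (k : ℝ → ℝ → ℝ) (f : ℝ → ℝ) : ℝ → ℝ :=
  ⇑((Ring.inverse (1 - integralOperator k) : L2 →L[ℝ] L2) (toL2 f))

/-- `(I - k)⁻¹ f` makes sense: `k` is the kernel of a bounded operator on `L²(ℝ₊)`, `I - k` is
invertible there, and `f` is square integrable. -/
def ResolventApplies (k : ℝ → ℝ → ℝ) (f : ℝ → ℝ) : Prop :=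
  (∃ T : L2 →L[ℝ] L2, IsIntegralOperator k T) ∧ IsUnit (1 - integralOperator k) ∧
    MemLp f 2 halfLine

/-- The function `x ↦ k(x,0)`, that is `k|δ⟩`. -/
def col (k : ℝ → ℝ → ℝ) : ℝ → ℝ := fun x => k x 0

/-- `⟨g|f⟩` on `ℝ₊`, for functions. -/
def pair (g f : ℝ → ℝ) : ℝ := ∫ y in Ioi (0 : ℝ), g y * f y

/-- `⟨g|(I - k)⁻¹|δ⟩ = ∫_0^∞ g(y) (I - k)⁻¹(y,0) dy`, where
`(I - k)⁻¹(y,0) = δ(y) + [(I - k)⁻¹ k(·,0)](y)` and the Dirac mass at the end point `0` of the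
half-line has full weight. -/
def braResolventDelta (g : ℝ → ℝ) (k : ℝ → ℝ → ℝ) : ℝ :=
  g 0 + pair g (resolvent k (col k))

/-- `q₀(s) = ⟨δ|A_s (I - K_s)⁻¹|δ⟩`. -/
def q0 (A : ℝ → ℝ) (s : ℝ) : ℝ := braResolventDelta (fun y => A (s + y)) (kerK A s)

/-- `b(s) = ⟨1|(I + A_s)⁻¹|δ⟩`. -/
def b (A : ℝ → ℝ) (s : ℝ) : ℝ := braResolventDelta (fun _ => 1) (kerNegA A s)

/-- `⟨1|(I - A_s)⁻¹|δ⟩`. -/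
def bMinus (A : ℝ → ℝ) (s : ℝ) : ℝ := braResolventDelta (fun _ => 1) (kerA A s)

end TauRep

end

/-! The argument splits into an operator part, which makes the resolvents exist, and a determinant
part, which uses only their existence (`Solvable`).

Invertibility. Suppose A_s² f = f. Place f on (s, ∞) and apply the transform with kernel A(x+y) on
the whole line. By the orthogonality relation the squared norm of the result is at most γ‖f‖² ≤
‖f‖². Its part on the right half-line is A_s f, and ‖A_s f‖² = ⟨A_s² f, f⟩ = ‖f‖² already, so the
transform vanishes on the left half-line (`Admissible.inner_vec_eq_zero_of_neg`). Since f is an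
image of A_s it decays exponentially, so the transform continues holomorphically across 0 and the
identity theorem makes it vanish on the right as well (`Admissible.inner_vec_eq_zero`). Hence A_s f
= 0 and f = 0. As A_s² is compact, I - A_s² is invertible, and so are its commuting factors I ± A_s.

Determinants. Put e = (I - A_s²)⁻¹A_s|δ⟩, o = A_s e, p = ⟨δ|A_s e⟩ and q = q₀. Moving the end point
of the half-line changes a Fredholm determinant at the rate given by the determinant times the
resolvent kernel at the corner (`fredholmDet_shift_eq`, `fredholmNum_zero_eq`). This gives (log
Det(I - A_s))' = (p + q)/2, (log Det(I + A_s))' = (p - q)/2 and (log Det(I - K_s))' = p. Integration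
by parts on the half-line gives p' = -q² (`hasDerivAt_squareDensity`). All three determinants tend
to 1 at +∞, so these equations yield positivity, the factorization Det(I - K_s) = Det(I - A_s) Det(I
+ A_s), and the formula for Det(I - K_s) as an exponential of a double integral of q².

The function b. The kernels of A_s|δ⟩⟨1| - A_s and of A_s are the two products, in opposite orders,
of -A'_s and the step kernel of integration. So they have the same determinant
(`fredholmMinor_comm`, `fredholmDet_sub_delta_one`). The rank-one formula applied to the first one
gives Det(I + A_s) b = Det(I - A_s), whence b'/b = q.

The remaining determinants are rank-one perturbations of Det(I - K_s) and depend only on ⟨1|e⟩ and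
⟨1|o⟩, which are linear combinations of 1, b and the companion of b for -A. Replacing A by -A
changes the sign of q, so that companion is exp(+∫q), and hyperbolic identities finish the proof. -/

noncomputable section

namespace TauRep

/-! ### Determinants -/

/-- Expansion of a bordered determinant along its first row and first column. -/
theorem det_bordered {n : ℕ} (B : Matrix (Fin (n + 1)) (Fin (n + 1)) ℝ) :
    B.det = B 0 0 * (B.submatrix Fin.succ Fin.succ).det
      - ∑ j, B 0 j.succ *
        ((B.submatrix Fin.succ Fin.succ).updateCol j (fun i => B i.succ 0)).det := by
  rw [Matrix.det_succ_row_zero, Fin.sum_univ_succ, sub_eq_add_neg, ← Finset.sum_neg_distrib]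
  congr 1
  · simp [Fin.succAbove_zero]
  · refine Finset.sum_congr rfl fun j _ => ?_
    cases n with
    | zero => exact j.elim0
    | succ m =>
      -- The left minor is expanded along its first column and the modified determinant along column
      -- `j`; both columns carry the entries of the border, and the complementary minors coincide.
      rw [Matrix.det_succ_column_zero, Matrix.det_succ_column _ j, Finset.mul_sum, Finset.mul_sum,
        ← Finset.sum_neg_distrib]
      refine Finset.sum_congr rfl fun i _ => ?_
      have h1 : ((B.submatrix Fin.succ j.succ.succAbove).submatrix i.succAbove Fin.succ)
          = (((B.submatrix Fin.succ Fin.succ).updateCol j (fun i => B i.succ 0)).submatrix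
            i.succAbove j.succAbove) := by
        ext a c
        simp [Fin.succAbove_ne, Fin.succ_succAbove_succ]
      rw [h1]
      have h2 : ((-1 : ℝ) ^ ((j.succ : Fin (m + 2)) : ℕ)) = - (-1) ^ (j : ℕ) := by
        rw [Fin.val_succ, pow_succ]; ring
      rw [h2]
      simp [pow_add]
      ring

/-- The determinant of a rank-one perturbation. -/
theorem det_add_rankOne {n : ℕ} (M : Matrix (Fin n) (Fin n) ℝ) (u v : Fin n → ℝ) :
    (Matrix.of fun i j => M i j + u i * v j).det
      = M.det + ∑ j, v j * (M.updateCol j u).det := by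
  -- Subtracting `v j` times the border column from column `j` turns `B` into `B'`. Expanding both
  -- along the border gives the two sides of the formula.
  let B : Matrix (Fin (n + 1)) (Fin (n + 1)) ℝ :=
    Matrix.of (Fin.cons (Fin.cons 1 v) fun i => Fin.cons (-u i) (M i))
  let B' : Matrix (Fin (n + 1)) (Fin (n + 1)) ℝ :=
    Matrix.of (Fin.cons (Fin.cons 1 0) fun i => Fin.cons (-u i) fun j => M i j + u i * v j)
  have h : B.det = B'.det := by
    rw [← Matrix.det_transpose B, ← Matrix.det_transpose B']
    refine Matrix.det_eq_of_forall_row_eq_smul_add_const (Fin.cons 0 v) 0 (by simp) ?_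
    intro j i
    refine Fin.cases ?_ (fun i => ?_) i <;> refine Fin.cases ?_ (fun j => ?_) j <;> simp [B, B']
    ring
  rw [det_bordered B, det_bordered B'] at h
  have e1 : B.submatrix Fin.succ Fin.succ = M := by ext; simp [B]
  have e2 : B'.submatrix Fin.succ Fin.succ = Matrix.of fun i j => M i j + u i * v j := by
    ext; simp [B']
  have e3 : (fun i : Fin n => B i.succ 0) = (-1 : ℝ) • u := by ext; simp [B]
  rw [e1, e2, e3] at h
  simp only [Matrix.det_updateCol_smul] at h
  simp [B, B'] at h
  exact h.symm

/-- Hadamard's inequality. -/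
theorem abs_det_le {n : ℕ} (M : Matrix (Fin n) (Fin n) ℝ) :
    |M.det| ≤ ∏ i, ‖(WithLp.toLp 2 (M i) : EuclideanSpace ℝ (Fin n))‖ := by
  -- Hadamard's inequality is the bound of the Euclidean volume form by the product of the norms; in
  -- the standard orthonormal basis that form is the determinant.
  have : Fact (Module.finrank ℝ (EuclideanSpace ℝ (Fin n)) = n) := ⟨by simp⟩
  let bs := EuclideanSpace.basisFun (Fin n) ℝ
  have h := bs.toBasis.orientation.abs_volumeForm_apply_le
    fun i => (WithLp.toLp 2 (M i) : EuclideanSpace ℝ (Fin n))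
  rw [Orientation.volumeForm_robust _ bs rfl, Module.Basis.det_apply] at h
  have e : bs.toBasis.toMatrix (fun i => (WithLp.toLp 2 (M i) : EuclideanSpace ℝ (Fin n)))
      = M.transpose := by
    ext i j
    simp [Module.Basis.toMatrix_apply, bs]
  rwa [e, Matrix.det_transpose] at h

/-- Each row has Euclidean norm at most √n times its entry bound. The resulting growth n^(n/2) is
what the factorials of the Fredholm series have to beat. -/
theorem abs_det_le_of_row_bound {n : ℕ} (M : Matrix (Fin n) (Fin n) ℝ) (B : Fin n → ℝ)
    (h : ∀ i j, |M i j| ≤ B i) : |M.det| ≤ Real.sqrt n ^ n * ∏ i, B i := by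
  refine (abs_det_le M).trans ?_
  have : Real.sqrt n ^ n * ∏ i, B i = ∏ i, (Real.sqrt n * B i) := by
    rw [Finset.prod_mul_distrib]; simp
  rw [this]
  refine Finset.prod_le_prod (fun i _ => norm_nonneg _) fun i _ => ?_
  have hB : 0 ≤ B i := (abs_nonneg _).trans (h i i)
  rw [EuclideanSpace.norm_eq, ← Real.sqrt_sq hB, ← Real.sqrt_mul (by positivity)]
  refine Real.sqrt_le_sqrt ?_
  calc ∑ j, ‖M i j‖ ^ 2 ≤ ∑ _j : Fin n, B i ^ 2 :=
        Finset.sum_le_sum fun j _ => pow_le_pow_left₀ (norm_nonneg _) (h i j) 2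
    _ = n * B i ^ 2 := by simp

/-- Simultaneous permutations of the points and of the distinguished column. -/
theorem det_updateCol_cons_removeNth {n : ℕ} (k : ℝ → ℝ → ℝ) (u : ℝ → ℝ) (j : Fin (n + 1))
    (x : Fin (n + 1) → ℝ) :
    ((Matrix.of fun i i' => k (x i) (x i')).updateCol j fun i => u (x i)).det
      = ((Matrix.of fun i i' => k ((Fin.cons (x j) (j.removeNth x) : Fin (n + 1) → ℝ) i)
          ((Fin.cons (x j) (j.removeNth x) : Fin (n + 1) → ℝ) i')).updateCol 0
        fun i => u ((Fin.cons (x j) (j.removeNth x) : Fin (n + 1) → ℝ) i)).det := by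
  -- Moving the `j`-th point to the front is a cycle; applied to rows and columns at once it does
  -- not change the determinant.
  have hx : (Fin.cons (x j) (j.removeNth x) : Fin (n + 1) → ℝ) = x ∘ j.cycleRange.symm := by
    ext i
    refine Fin.cases ?_ (fun i => ?_) i
    · simp
    · simp [Fin.removeNth]
  rw [hx, ← Matrix.det_submatrix_equiv_self j.cycleRange.symm]
  congr 1
  ext a c
  have : j.cycleRange.symm c = j ↔ c = 0 := by
    rw [Equiv.symm_apply_eq, Fin.cycleRange_self]
  simp [Matrix.updateCol_apply, this]

theorem det_cons_removeNth {n : ℕ} (k : ℝ → ℝ → ℝ) (j : Fin (n + 1)) (x : Fin (n + 1) → ℝ) :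
    (Matrix.of fun i i' => k (x i) (x i')).det
      = (Matrix.of fun i i' => k ((Fin.cons (x j) (j.removeNth x) : Fin (n + 1) → ℝ) i)
          ((Fin.cons (x j) (j.removeNth x) : Fin (n + 1) → ℝ) i')).det := by
  have hx : (Fin.cons (x j) (j.removeNth x) : Fin (n + 1) → ℝ) = x ∘ j.cycleRange.symm := by
    ext i
    refine Fin.cases ?_ (fun i => ?_) i
    · simp
    · simp [Fin.removeNth]
  rw [hx, ← Matrix.det_submatrix_equiv_self j.cycleRange.symm]
  rfl

/-! ### The weights `√n ^ n` -/

/-- The bound nⁿ/n! ≤ eⁿ holds because the left side is one term of the exponential series. Taking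
roots leaves √n! to spare after division by n!; the factor eⁿ instead of e^(n/2) is harmless. -/
theorem sqrt_pow_self_le (n : ℕ) :
    Real.sqrt n ^ n ≤ Real.exp 1 ^ n * Real.sqrt n.factorial := by
  have h1 : (n : ℝ) ^ n / n.factorial ≤ Real.exp n :=
    Real.pow_div_factorial_le_exp n (by positivity) n
  have h2 : (n : ℝ) ^ n ≤ Real.exp 1 ^ n * n.factorial := by
    rw [div_le_iff₀ (by positivity)] at h1
    rwa [← Real.exp_nat_mul, mul_one]
  have h3 : (1 : ℝ) ≤ Real.exp 1 ^ n := one_le_pow₀ (Real.one_le_exp (by norm_num))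
  refine le_of_sq_le_sq ?_ (by positivity)
  rw [mul_pow, Real.sq_sqrt (by positivity), ← pow_mul, mul_comm n 2, pow_mul,
    Real.sq_sqrt (by positivity)]
  refine h2.trans (mul_le_mul_of_nonneg_right ?_ (by positivity))
  nlinarith

/-- Each term is the product of (2|y|)ⁿ/√n! and 2⁻ⁿ, hence at most the sum of their squares, which
are terms of an exponential and of a geometric series. -/
theorem summable_pow_div_sqrt_factorial (y : ℝ) :
    Summable fun n : ℕ => |y| ^ n / Real.sqrt n.factorial := by
  have h1 : Summable fun n : ℕ => (4 * |y| ^ 2) ^ n / (n.factorial : ℝ) + (1 / 4 : ℝ) ^ n :=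
    (Real.summable_pow_div_factorial _).add
      (summable_geometric_of_lt_one (by norm_num) (by norm_num))
  refine Summable.of_nonneg_of_le (fun n => by positivity) (fun n => ?_) h1
  have hf : (0 : ℝ) < Real.sqrt n.factorial := by positivity
  have e : (4 * |y| ^ 2) ^ n / (n.factorial : ℝ) = ((2 * |y|) ^ n / Real.sqrt n.factorial) ^ 2 := by
    rw [div_pow, Real.sq_sqrt (by positivity), ← pow_mul, mul_comm n 2, pow_mul]
    congr 2; ring
  have e2 : (1 / 4 : ℝ) ^ n = ((1 / 2) ^ n) ^ 2 := by
    rw [← pow_mul, mul_comm n 2, pow_mul]; norm_num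
  have e3 : |y| ^ n / Real.sqrt n.factorial
      = ((2 * |y|) ^ n / Real.sqrt n.factorial) * (1 / 2) ^ n := by
    rw [div_mul_eq_mul_div, ← mul_pow]; congr 2; ring
  rw [e, e2, e3]
  have h4 : 0 ≤ ((2 * |y|) ^ n / Real.sqrt n.factorial) * (1 / 2) ^ n := by positivity
  nlinarith [two_mul_le_add_sq ((2 * |y|) ^ n / Real.sqrt n.factorial) ((1 / 2) ^ n)]

theorem summable_hadamard (x : ℝ) :
    Summable fun n : ℕ => Real.sqrt n ^ n * |x| ^ n / n.factorial := by
  refine Summable.of_nonneg_of_le (fun n => by positivity) (fun n => ?_)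
    (summable_pow_div_sqrt_factorial (Real.exp 1 * |x|))
  have hf : (0 : ℝ) < Real.sqrt n.factorial := by positivity
  have e : (n.factorial : ℝ) = Real.sqrt n.factorial * Real.sqrt n.factorial :=
    (Real.mul_self_sqrt (by positivity)).symm
  rw [div_le_div_iff₀ (by positivity) hf, abs_of_nonneg (by positivity : 0 ≤ Real.exp 1 * |x|),
    mul_pow]
  nth_rewrite 2 [e]
  have := mul_le_mul_of_nonneg_right (sqrt_pow_self_le n)
    (by positivity : 0 ≤ |x| ^ n * Real.sqrt n.factorial)
  nlinarith

/-- Numerator coefficients are determinants with n+1 points divided only by n!. Enlarging the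
argument to 2(|x|+1) absorbs both the missing factor n+1 and the missing power. -/
theorem summable_hadamard_succ (x : ℝ) :
    Summable fun n : ℕ => Real.sqrt ((n + 1 : ℕ) : ℝ) ^ (n + 1) * |x| ^ n / n.factorial := by
  have h := (summable_nat_add_iff 1).2 (summable_hadamard (2 * (|x| + 1)))
  refine Summable.of_nonneg_of_le (fun n => by positivity) (fun n => ?_) h
  rw [abs_of_nonneg (by positivity : 0 ≤ 2 * (|x| + 1)), mul_div_assoc, mul_div_assoc]
  refine mul_le_mul_of_nonneg_left ?_ (by positivity)
  rw [div_le_div_iff₀ (by positivity) (by positivity), Nat.factorial_succ, mul_pow]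
  have h1 : ((n + 1 : ℕ) : ℝ) ≤ 2 ^ (n + 1) := by exact_mod_cast (Nat.lt_two_pow_self).le
  have h2 : |x| ^ n ≤ (|x| + 1) ^ (n + 1) :=
    (pow_le_pow_left₀ (abs_nonneg x) (by linarith) n).trans
      (pow_le_pow_right₀ (by linarith [abs_nonneg x]) (by omega))
  have h3 := mul_le_mul h1 h2 (by positivity) (by positivity)
  push_cast at h3 ⊢
  nlinarith [mul_le_mul_of_nonneg_right h3 (by positivity : (0 : ℝ) ≤ n.factorial)]

/-! ### Fredholm series of dominated kernels -/

/-- Lebesgue measure on `ℝ₊ⁿ`. -/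
abbrev halfSpace (n : ℕ) : Measure (Fin n → ℝ) := Measure.pi fun _ => halfLine

/-- The kernel `k` is measurable and bounded on `ℝ₊²` by an integrable function of its first
variable. -/
structure Dominated (k : ℝ → ℝ → ℝ) (w : ℝ → ℝ) : Prop where
  measurable : Measurable (Function.uncurry k)
  bound : ∀ x y, 0 ≤ x → 0 ≤ y → |k x y| ≤ w x
  integrable : Integrable w halfLine

/-- The function `u` is measurable and bounded on `ℝ₊` by `w`. -/
structure DominatedFun (u w : ℝ → ℝ) : Prop where
  measurable : Measurable u
  bound : ∀ x, 0 ≤ x → |u x| ≤ w x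

theorem ae_halfSpace_pos (n : ℕ) : ∀ᵐ x ∂halfSpace n, ∀ i, 0 < x i := by
  rw [ae_all_iff]
  intro i
  exact (Measure.tendsto_eval_ae_ae (μ := fun _ : Fin n => halfLine)).eventually
    (ae_restrict_mem measurableSet_Ioi)

theorem ae_halfLine_pos : ∀ᵐ x ∂halfLine, 0 < x := ae_restrict_mem measurableSet_Ioi

theorem measurable_det {α : Type*} [MeasurableSpace α] {n : ℕ}
    {M : α → Matrix (Fin n) (Fin n) ℝ} (h : ∀ i j, Measurable fun a => M a i j) :
    Measurable fun a => (M a).det := by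
  simp only [Matrix.det_apply]
  exact Finset.measurable_sum _ fun σ _ =>
    (Finset.measurable_prod _ fun i _ => h _ _).const_smul _

theorem measurable_cons_apply {n : ℕ} (i : Fin (n + 1)) :
    Measurable fun p : ℝ × (Fin n → ℝ) => (Fin.cons p.1 p.2 : Fin (n + 1) → ℝ) i := by
  refine Fin.cases ?_ (fun i => ?_) i
  · simpa using measurable_fst
  · simp only [Fin.cons_succ]
    exact (measurable_pi_apply i).comp measurable_snd

/-- The matrix `k(x_i,x_j)`, with `u(x_i)` in column `j₀`. -/
def colMatrix (k : ℝ → ℝ → ℝ) (u : ℝ → ℝ) {n : ℕ} (j : Fin n) (x : Fin n → ℝ) :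
    Matrix (Fin n) (Fin n) ℝ :=
  (Matrix.of fun i i' => k (x i) (x i')).updateCol j fun i => u (x i)

/-- The `n`-th coefficient of the Fredholm numerator of `k` and `u`. -/
def numeratorCoeff (k : ℝ → ℝ → ℝ) (u : ℝ → ℝ) (n : ℕ) (z : ℝ) : ℝ :=
  ∫ x, (colMatrix k u 0 (Fin.cons z x : Fin (n + 1) → ℝ)).det ∂halfSpace n

/-- The Fredholm numerator of `k` and `u`. -/
def fredholmNum (k : ℝ → ℝ → ℝ) (u : ℝ → ℝ) (z : ℝ) : ℝ :=
  ∑' n : ℕ, (-1) ^ n / (n.factorial : ℝ) * numeratorCoeff k u n z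

section

variable {k : ℝ → ℝ → ℝ} {u w : ℝ → ℝ} {n : ℕ}

theorem Dominated.nonneg (hk : Dominated k w) {x : ℝ} (hx : 0 ≤ x) : 0 ≤ w x :=
  (abs_nonneg _).trans (hk.bound x x hx hx)

theorem Dominated.integral_nonneg (hk : Dominated k w) : 0 ≤ ∫ x, w x ∂halfLine :=
  integral_nonneg_of_ae (ae_halfLine_pos.mono fun _ hx => hk.nonneg hx.le)

theorem Dominated.measurable_comp {α : Type*} [MeasurableSpace α] (hk : Dominated k w)
    {f g : α → ℝ} (hf : Measurable f) (hg : Measurable g) : Measurable fun a => k (f a) (g a) :=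
  hk.measurable.comp (hf.prodMk hg)

theorem colMatrix_apply (j : Fin n) (x : Fin n → ℝ) (i i' : Fin n) :
    colMatrix k u j x i i' = if i' = j then u (x i) else k (x i) (x i') := by
  simp [colMatrix, Matrix.updateCol_apply]

theorem abs_colMatrix_le (hk : Dominated k w) (hu : DominatedFun u w) (j : Fin n)
    {x : Fin n → ℝ} (hx : ∀ i, 0 ≤ x i) (i i' : Fin n) : |colMatrix k u j x i i'| ≤ w (x i) := by
  rw [colMatrix_apply]
  split_ifs
  · exact hu.bound _ (hx i)
  · exact hk.bound _ _ (hx i) (hx i')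

theorem measurable_det_colMatrix {α : Type*} [MeasurableSpace α] (hk : Dominated k w)
    (hu : DominatedFun u w) (j : Fin n) {x : α → Fin n → ℝ} (hx : ∀ i, Measurable fun a => x a i) :
    Measurable fun a => (colMatrix k u j (x a)).det := by
  refine measurable_det fun i i' => ?_
  simp only [colMatrix_apply]
  split_ifs
  · exact hu.measurable.comp (hx i)
  · exact hk.measurable_comp (hx i) (hx i')

theorem integrable_prod_weight (hk : Dominated k w) (n : ℕ) :
    Integrable (fun x : Fin n → ℝ => ∏ i, w (x i)) (halfSpace n) :=
  Integrable.fintype_prod fun _ => hk.integrable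

theorem integral_prod_weight (n : ℕ) :
    ∫ x : Fin n → ℝ, ∏ i, w (x i) ∂halfSpace n = (∫ x, w x ∂halfLine) ^ n := by
  rw [integral_fintype_prod_eq_prod (μ := fun _ : Fin n => halfLine) (fun _ => w)]
  simp

/-- Integrals of functions dominated by a multiple of the product weight. -/
theorem integrable_and_abs_integral_le (hk : Dominated k w) {f : (Fin n → ℝ) → ℝ}
    (hf : Measurable f) (c : ℝ) (h : ∀ x, (∀ i, 0 ≤ x i) → |f x| ≤ c * ∏ i, w (x i)) :
    Integrable f (halfSpace n) ∧ |∫ x, f x ∂halfSpace n| ≤ c * (∫ x, w x ∂halfLine) ^ n := by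
  have hae : ∀ᵐ x ∂halfSpace n, ‖f x‖ ≤ c * ∏ i, w (x i) :=
    (ae_halfSpace_pos n).mono fun x hx => h x fun i => (hx i).le
  have hg := (integrable_prod_weight hk n).const_mul c
  refine ⟨hg.mono' hf.aestronglyMeasurable hae, ?_⟩
  have := norm_integral_le_of_norm_le hg hae
  rwa [integral_const_mul, integral_prod_weight] at this

theorem abs_det_kernel_le (hk : Dominated k w) {x : Fin n → ℝ} (hx : ∀ i, 0 ≤ x i) :
    |(Matrix.of fun i j => k (x i) (x j)).det| ≤ Real.sqrt n ^ n * ∏ i, w (x i) :=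
  abs_det_le_of_row_bound _ _ fun i j => hk.bound _ _ (hx i) (hx j)

theorem measurable_det_kernel (hk : Dominated k w) (n : ℕ) :
    Measurable fun x : Fin n → ℝ => (Matrix.of fun i j => k (x i) (x j)).det :=
  measurable_det fun i j => hk.measurable_comp (measurable_pi_apply i) (measurable_pi_apply j)

theorem integrable_det_kernel (hk : Dominated k w) (n : ℕ) :
    Integrable (fun x : Fin n → ℝ => (Matrix.of fun i j => k (x i) (x j)).det) (halfSpace n) :=
  (integrable_and_abs_integral_le hk (measurable_det_kernel hk n) _
    fun _ hx => abs_det_kernel_le hk hx).1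

theorem abs_fredholmMinor_le (hk : Dominated k w) (n : ℕ) :
    |fredholmMinor k n| ≤ Real.sqrt n ^ n * (∫ x, w x ∂halfLine) ^ n :=
  (integrable_and_abs_integral_le hk (measurable_det_kernel hk n) _
    fun _ hx => abs_det_kernel_le hk hx).2

theorem abs_coeff (n : ℕ) (a : ℝ) :
    |(-1) ^ n / (n.factorial : ℝ) * a| = |a| / n.factorial := by
  rw [abs_mul, abs_div, abs_pow, abs_neg, abs_one, one_pow, Nat.abs_cast]; ring

theorem Dominated.fredholmConverges (hk : Dominated k w) : FredholmConverges k := by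
  refine ⟨integrable_det_kernel hk, ?_⟩
  refine Summable.of_norm_bounded (summable_hadamard (∫ x, w x ∂halfLine)) fun n => ?_
  rw [Real.norm_eq_abs, abs_coeff, abs_of_nonneg hk.integral_nonneg]
  exact div_le_div_of_nonneg_right (abs_fredholmMinor_le hk n) (by positivity)

theorem abs_det_colMatrix_le (hk : Dominated k w) (hu : DominatedFun u w) (j : Fin n)
    {x : Fin n → ℝ} (hx : ∀ i, 0 ≤ x i) :
    |(colMatrix k u j x).det| ≤ Real.sqrt n ^ n * ∏ i, w (x i) :=
  abs_det_le_of_row_bound _ _ (abs_colMatrix_le hk hu j hx)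

theorem abs_det_colMatrix_cons_le (hk : Dominated k w) (hu : DominatedFun u w) {z : ℝ}
    (hz : 0 ≤ z) {x : Fin n → ℝ} (hx : ∀ i, 0 ≤ x i) :
    |(colMatrix k u 0 (Fin.cons z x : Fin (n + 1) → ℝ)).det|
      ≤ Real.sqrt ((n + 1 : ℕ) : ℝ) ^ (n + 1) * w z * ∏ i, w (x i) := by
  have := abs_det_colMatrix_le hk hu (0 : Fin (n + 1)) (x := Fin.cons z x)
    (Fin.cases (by simpa using hz) (by simpa using hx))
  simpa [Fin.prod_univ_succ, mul_assoc] using this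

theorem measurable_det_colMatrix_cons (hk : Dominated k w) (hu : DominatedFun u w) (n : ℕ) :
    Measurable fun p : ℝ × (Fin n → ℝ) =>
      (colMatrix k u 0 (Fin.cons p.1 p.2 : Fin (n + 1) → ℝ)).det :=
  measurable_det_colMatrix hk hu 0 measurable_cons_apply

theorem abs_numeratorCoeff_le (hk : Dominated k w) (hu : DominatedFun u w) (n : ℕ) {z : ℝ}
    (hz : 0 ≤ z) : |numeratorCoeff k u n z|
      ≤ Real.sqrt ((n + 1 : ℕ) : ℝ) ^ (n + 1) * w z * (∫ x, w x ∂halfLine) ^ n :=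
  (integrable_and_abs_integral_le hk
    ((measurable_det_colMatrix_cons hk hu n).comp measurable_prodMk_left) _
    fun _ hx => abs_det_colMatrix_cons_le hk hu hz hx).2

theorem measurable_numeratorCoeff (hk : Dominated k w) (hu : DominatedFun u w) (n : ℕ) :
    Measurable (numeratorCoeff k u n) :=
  ((measurable_det_colMatrix_cons hk hu n).stronglyMeasurable.integral_prod_right
    (ν := halfSpace n)).measurable

/-- A constant bounding the Fredholm numerator in terms of the weight. -/
def numeratorBound (w : ℝ → ℝ) : ℝ :=
  ∑' n : ℕ, Real.sqrt ((n + 1 : ℕ) : ℝ) ^ (n + 1) * |∫ x, w x ∂halfLine| ^ n / n.factorial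

theorem abs_numerator_term_le (hk : Dominated k w) (hu : DominatedFun u w) (n : ℕ) {z : ℝ}
    (hz : 0 ≤ z) : |(-1) ^ n / (n.factorial : ℝ) * numeratorCoeff k u n z|
      ≤ w z * (Real.sqrt ((n + 1 : ℕ) : ℝ) ^ (n + 1) * |∫ x, w x ∂halfLine| ^ n
        / n.factorial) := by
  rw [abs_coeff, abs_of_nonneg hk.integral_nonneg, ← mul_div_assoc]
  refine div_le_div_of_nonneg_right ((abs_numeratorCoeff_le hk hu n hz).trans_eq ?_)
    (by positivity)
  ring

theorem summable_numerator (hk : Dominated k w) (hu : DominatedFun u w) {z : ℝ} (hz : 0 ≤ z) :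
    Summable fun n : ℕ => (-1) ^ n / (n.factorial : ℝ) * numeratorCoeff k u n z :=
  Summable.of_norm_bounded ((summable_hadamard_succ _).mul_left (w z))
    fun n => abs_numerator_term_le hk hu n hz

theorem abs_fredholmNum_le (hk : Dominated k w) (hu : DominatedFun u w) {z : ℝ} (hz : 0 ≤ z) :
    |fredholmNum k u z| ≤ numeratorBound w * w z := by
  have := tsum_of_norm_bounded ((summable_hadamard_succ (∫ x, w x ∂halfLine)).mul_left
    (w z)).hasSum (f := fun n : ℕ => (-1) ^ n / (n.factorial : ℝ) * numeratorCoeff k u n z)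
    fun n => abs_numerator_term_le hk hu n hz
  rw [tsum_mul_left, mul_comm] at this
  exact this

theorem measurable_fredholmNum (hk : Dominated k w) (hu : DominatedFun u w) :
    Measurable (fredholmNum k u) := 
  Measurable.tsum fun n => (measurable_numeratorCoeff hk hu n).const_mul _

/-- Termwise integration is allowed because the n-th term is bounded by a summable constant times
the integrable function `B * w z`. -/
theorem hasSum_integral_numerator (hk : Dominated k w) (hu : DominatedFun u w) {φ : ℝ → ℝ}
    {B : ℝ} (hφ : Measurable φ) (hB : ∀ z, 0 ≤ z → |φ z| ≤ B) :
    HasSum (fun n : ℕ => (-1) ^ n / (n.factorial : ℝ) *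
        ∫ z, φ z * numeratorCoeff k u n z ∂halfLine)
      (∫ z, φ z * fredholmNum k u z ∂halfLine) := by
  have hB0 : 0 ≤ B := (abs_nonneg _).trans (hB 0 le_rfl)
  let F : ℕ → ℝ → ℝ := fun n z => φ z * ((-1) ^ n / (n.factorial : ℝ) * numeratorCoeff k u n z)
  have hF : ∀ n, ∀ᵐ z ∂halfLine, ‖F n z‖ ≤ (Real.sqrt ((n + 1 : ℕ) : ℝ) ^ (n + 1)
      * |∫ x, w x ∂halfLine| ^ n / n.factorial) * (B * w z) := fun n =>
    ae_halfLine_pos.mono fun z hz => by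
      rw [Real.norm_eq_abs, abs_mul]
      refine (mul_le_mul (hB z hz.le) (abs_numerator_term_le hk hu n hz.le) (abs_nonneg _)
        hB0).trans_eq ?_
      ring
  have hFi : ∀ n, Integrable (F n) halfLine := fun n =>
    ((hk.integrable.const_mul B).const_mul _).mono'
      (hφ.mul ((measurable_numeratorCoeff hk hu n).const_mul _)).aestronglyMeasurable (hF n)
  have h := hasSum_integral_of_summable_integral_norm hFi ?_
  · have e1 : (fun n : ℕ => (-1) ^ n / (n.factorial : ℝ) *
        ∫ z, φ z * numeratorCoeff k u n z ∂halfLine) = fun n => ∫ z, F n z ∂halfLine := by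
      ext n
      rw [← integral_const_mul]
      congr 1; ext z; simp only [F]; ring
    have e2 : (fun z => φ z * fredholmNum k u z) = fun z => ∑' n, F n z := by
      ext z; simp only [F, tsum_mul_left]; rfl
    rw [e1, e2]
    exact h
  · refine Summable.of_nonneg_of_le (fun n => integral_nonneg fun z => norm_nonneg _) (fun n => ?_)
      ((summable_hadamard_succ (∫ x, w x ∂halfLine)).mul_right (∫ z, B * w z ∂halfLine))
    rw [← integral_const_mul]
    exact integral_mono_ae (hFi n).norm ((hk.integrable.const_mul B).const_mul _) (hF n)

/-- Separating one of the variables. -/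
theorem integral_removeNth {F : ℝ → (Fin n → ℝ) → ℝ} (j : Fin (n + 1))
    (hF : Integrable (fun x : Fin (n + 1) → ℝ => F (x j) (j.removeNth x)) (halfSpace (n + 1))) :
    ∫ x : Fin (n + 1) → ℝ, F (x j) (j.removeNth x) ∂halfSpace (n + 1)
      = ∫ z, ∫ x, F z x ∂halfSpace n ∂halfLine := by
  have hmp := measurePreserving_piFinSuccAbove (fun _ : Fin (n + 1) => halfLine) j
  have h1 := hmp.integral_comp' (g := Function.uncurry F)
  have h2 : Integrable (Function.uncurry F) (halfLine.prod (halfSpace n)) :=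
    (hmp.integrable_comp_emb (MeasurableEquiv.measurableEmbedding _)).1 hF
  exact h1.trans (integral_prod _ h2)

/-- The value does not depend on `j`: relabelling the variables moves the distinguished column to
the front. Sums over the distinguished column thus collapse to a factor n+1. -/
theorem integral_mul_det_colMatrix (hk : Dominated k w) (hu : DominatedFun u w) {φ : ℝ → ℝ}
    {B : ℝ} (hφ : Measurable φ) (hB : ∀ z, 0 ≤ z → |φ z| ≤ B) (j : Fin (n + 1)) :
    Integrable (fun x : Fin (n + 1) → ℝ => φ (x j) * (colMatrix k u j x).det) (halfSpace (n + 1)) ∧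
    ∫ x : Fin (n + 1) → ℝ, φ (x j) * (colMatrix k u j x).det ∂halfSpace (n + 1)
      = ∫ z, φ z * numeratorCoeff k u n z ∂halfLine := by
  have hi : Integrable (fun x : Fin (n + 1) → ℝ => φ (x j) * (colMatrix k u j x).det)
      (halfSpace (n + 1)) := by
    refine (integrable_and_abs_integral_le hk
      ((hφ.comp (measurable_pi_apply j)).mul
        (measurable_det_colMatrix hk hu j measurable_pi_apply))
      (B * Real.sqrt ((n + 1 : ℕ) : ℝ) ^ (n + 1)) fun x hx => ?_).1
    change |φ (x j) * (colMatrix k u j x).det| ≤ _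
    rw [abs_mul, mul_assoc]
    exact mul_le_mul (hB _ (hx j)) (abs_det_colMatrix_le hk hu j hx) (abs_nonneg _)
      ((abs_nonneg _).trans (hB _ (hx j)))
  have e : (fun x : Fin (n + 1) → ℝ => φ (x j) * (colMatrix k u j x).det)
      = fun x => (fun z (y : Fin n → ℝ) => φ z *
        (colMatrix k u 0 (Fin.cons z y : Fin (n + 1) → ℝ)).det) (x j) (j.removeNth x) := by
    ext x
    simp only [colMatrix]
    rw [det_updateCol_cons_removeNth]
  refine ⟨hi, ?_⟩
  rw [e] at hi ⊢
  refine (integral_removeNth (F := fun z (y : Fin n → ℝ) => φ z *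
    (colMatrix k u 0 (Fin.cons z y : Fin (n + 1) → ℝ)).det) j hi).trans ?_
  simp only [integral_const_mul, numeratorCoeff]

/-! ### Fredholm's recursion and the rank-one formula. -/

theorem numeratorCoeff_zero (z : ℝ) : numeratorCoeff k u 0 z = u z := by
  simp [numeratorCoeff, colMatrix, measureReal_def]

/-- Expansion along the row and column of the point `z`: the corner contributes the minor, and the
other n+1 terms have equal integrals. -/
theorem numeratorCoeff_succ (hk : Dominated k w) (hu : DominatedFun u w) (n : ℕ) {z : ℝ}
    (hz : 0 ≤ z) : numeratorCoeff k u (n + 1) z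
      = u z * fredholmMinor k (n + 1) - (n + 1) * ∫ y, k z y * numeratorCoeff k u n y ∂halfLine := by
  have hφ : Measurable (k z) := hk.measurable_comp measurable_const measurable_id
  have e : ∀ x : Fin (n + 1) → ℝ, (colMatrix k u 0 (Fin.cons z x : Fin (n + 2) → ℝ)).det
      = u z * (Matrix.of fun i j => k (x i) (x j)).det
        - ∑ j, k z (x j) * (colMatrix k u j x).det := by
    intro x
    rw [det_bordered]
    rfl
  have hi := fun j => integral_mul_det_colMatrix (n := n) hk hu hφ (fun y hy => hk.bound z y hz hy) j
  rw [numeratorCoeff]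
  simp only [e]
  rw [integral_sub ((integrable_det_kernel hk _).const_mul _)
    (integrable_finsetSum _ fun j _ => (hi j).1), integral_const_mul,
    integral_finsetSum _ fun j _ => (hi j).1]
  simp only [fun j => (hi j).2]
  simp [fredholmMinor]

theorem fredholmMinor_zero : fredholmMinor k 0 = 1 := by
  simp [fredholmMinor, measureReal_def]

theorem hasSum_fredholmDet (hk : Dominated k w) :
    HasSum (fun n : ℕ => (-1) ^ n / (n.factorial : ℝ) * fredholmMinor k n) (fredholmDet k) :=
  hk.fredholmConverges.2.hasSum

theorem coeff_succ (n : ℕ) :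
    (-1 : ℝ) ^ (n + 1) / ((n + 1).factorial : ℝ) * (n + 1) = - ((-1) ^ n / (n.factorial : ℝ)) := by
  rw [Nat.factorial_succ]
  push_cast
  field_simp
  ring

/-- Fredholm's equation for the numerator. -/
theorem fredholmNum_eq (hk : Dominated k w) (hu : DominatedFun u w) {z : ℝ} (hz : 0 ≤ z) :
    fredholmNum k u z = u z * fredholmDet k + ∫ y, k z y * fredholmNum k u y ∂halfLine := by
  have hφ : Measurable (k z) := hk.measurable_comp measurable_const measurable_id
  have h1 := hasSum_integral_numerator hk hu hφ (fun y hy => hk.bound z y hz hy)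
  have h2 := ((hasSum_nat_add_iff' 1).2 (hasSum_fredholmDet hk)).mul_left (u z)
  have h3 := (hasSum_nat_add_iff' 1).2 (summable_numerator hk hu hz).hasSum
  have e : (fun n : ℕ => (-1) ^ (n + 1) / ((n + 1).factorial : ℝ) * numeratorCoeff k u (n + 1) z)
      = fun n : ℕ => u z * ((-1) ^ (n + 1) / ((n + 1).factorial : ℝ) * fredholmMinor k (n + 1))
        + (-1) ^ n / (n.factorial : ℝ) * ∫ y, k z y * numeratorCoeff k u n y ∂halfLine := by
    ext n
    rw [numeratorCoeff_succ hk hu n hz, mul_sub, ← mul_assoc _ ((n : ℝ) + 1), coeff_succ]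
    ring
  rw [e] at h3
  -- Term n+1 of the numerator matches term n+1 of the determinant and term n of the integral. The
  -- removed zeroth terms are `u z` on either side and cancel.
  have h4 := h3.unique (h2.add h1)
  simp [numeratorCoeff_zero, fredholmMinor_zero] at h4
  rw [fredholmNum]
  linarith

/-- The determinant of a rank-one update is affine in `v`, with one term per column. The n+1 columns
integrate to the same value, and that factor shifts the factorial so that the numerator series
appears. -/
theorem fredholmDet_add_rankOne (hk : Dominated k w) (hu : DominatedFun u w) {v : ℝ → ℝ} {B : ℝ}
    (hv : Measurable v) (hB : ∀ z, 0 ≤ z → |v z| ≤ B) :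
    fredholmDet (fun x y => k x y + u x * v y)
      = fredholmDet k - ∫ y, v y * fredholmNum k u y ∂halfLine := by
  have hm : ∀ n : ℕ, fredholmMinor (fun x y => k x y + u x * v y) (n + 1)
      = fredholmMinor k (n + 1) + (n + 1) * ∫ y, v y * numeratorCoeff k u n y ∂halfLine := by
    intro n
    have hi := fun j => integral_mul_det_colMatrix (n := n) hk hu hv hB j
    have e : ∀ x : Fin (n + 1) → ℝ,
        (Matrix.of fun i j => k (x i) (x j) + u (x i) * v (x j)).det
          = (Matrix.of fun i j => k (x i) (x j)).det + ∑ j, v (x j) * (colMatrix k u j x).det :=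
      fun x => det_add_rankOne (Matrix.of fun i j => k (x i) (x j)) (fun i => u (x i))
        fun j => v (x j)
    rw [fredholmMinor]
    simp only [e]
    rw [integral_add (integrable_det_kernel hk _) (integrable_finsetSum _ fun j _ => (hi j).1),
      integral_finsetSum _ fun j _ => (hi j).1]
    simp only [fun j => (hi j).2]
    simp [fredholmMinor]
  have h1 := hasSum_integral_numerator hk hu hv hB
  have h2 := (hasSum_nat_add_iff' 1).2 (hasSum_fredholmDet hk)
  have h3 : HasSum (fun n : ℕ => (-1) ^ n / (n.factorial : ℝ) *
      fredholmMinor (fun x y => k x y + u x * v y) n)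
      (fredholmDet k - ∫ y, v y * fredholmNum k u y ∂halfLine) := by
    rw [← hasSum_nat_add_iff' 1]
    convert h2.sub h1 using 1
    · ext n
      rw [hm, mul_add, ← mul_assoc, coeff_succ]
      ring
    · simp [fredholmMinor_zero]
      ring
  exact h3.tsum_eq

end

/-! ### Fredholm determinants of products in the two orders -/

theorem fredholmMinor_congr {k k' : ℝ → ℝ → ℝ} (h : ∀ x y, 0 < x → 0 < y → k x y = k' x y)
    (n : ℕ) : fredholmMinor k n = fredholmMinor k' n := by
  refine integral_congr_ae ((ae_halfSpace_pos n).mono fun x hx => ?_)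
  have : (Matrix.of fun i j => k (x i) (x j)) = Matrix.of fun i j => k' (x i) (x j) := by
    ext i j; exact h _ _ (hx i) (hx j)
  simp only [this]

theorem fredholmDet_congr {k k' : ℝ → ℝ → ℝ} (h : ∀ x y, 0 < x → 0 < y → k x y = k' x y) :
    fredholmDet k = fredholmDet k' := by
  simp only [fredholmDet, fredholmMinor_congr h]

/-- Andréief's identity in unsymmetrized form. -/
theorem det_integral {n : ℕ} (p q : Fin n → ℝ → ℝ)
    (h : ∀ i j, Integrable (fun t => p i t * q j t) halfLine) :
    (Matrix.of fun i j => ∫ t, p i t * q j t ∂halfLine).det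
      = ∫ t : Fin n → ℝ, (∏ i, p i (t i)) * (Matrix.of fun i j => q j (t i)).det ∂halfSpace n := by
  have h1 : ∀ σ : Equiv.Perm (Fin n), Integrable (fun t : Fin n → ℝ =>
      ∏ i, p i (t i) * q (σ i) (t i)) (halfSpace n) := fun σ =>
    Integrable.fintype_prod (f := fun i t => p i t * q (σ i) t) fun i => h i (σ i)
  have h2 : ∀ t : Fin n → ℝ, (∏ i, p i (t i)) * (Matrix.of fun i j => q j (t i)).det
      = ∑ σ : Equiv.Perm (Fin n), ((Equiv.Perm.sign σ : ℤ) : ℝ) *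
        ∏ i, p i (t i) * q (σ i) (t i) := by
    intro t
    rw [← Matrix.det_transpose, Matrix.det_apply', Finset.mul_sum]
    refine Finset.sum_congr rfl fun σ _ => ?_
    rw [Finset.prod_mul_distrib]
    simp only [Matrix.transpose_apply, Matrix.of_apply]
    ring
  simp only [h2]
  rw [integral_finsetSum _ fun σ _ => (h1 σ).const_mul _, ← Matrix.det_transpose,
    Matrix.det_apply']
  refine Finset.sum_congr rfl fun σ _ => ?_
  rw [integral_const_mul,
    integral_fintype_prod_eq_prod (μ := fun _ : Fin n => halfLine) fun i t => p i t * q (σ i) t]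
  simp

/-- Both minors are the double integral of ∏ P(x_i, w_i) · det Q(w_i, x_j), taken in the two orders,
so Fubini's theorem suffices. Only `P` has to decay; `Q` need only be bounded, which admits the step
function used below. -/
theorem fredholmMinor_comm {P Q : ℝ → ℝ → ℝ} {f g : ℝ → ℝ} {B : ℝ}
    (hP : Measurable (Function.uncurry P)) (hQ : Measurable (Function.uncurry Q))
    (hf : Integrable f halfLine) (hg : Integrable g halfLine)
    (hPb : ∀ x w, 0 ≤ x → 0 ≤ w → |P x w| ≤ f x * g w)
    (hQb : ∀ w x, 0 ≤ w → 0 ≤ x → |Q w x| ≤ B) (n : ℕ) :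
    fredholmMinor (fun x y => ∫ w, P x w * Q w y ∂halfLine) n
      = fredholmMinor (fun w w' => ∫ x, Q w x * P x w' ∂halfLine) n := by
  have hB0 : 0 ≤ B := (abs_nonneg _).trans (hQb 0 0 le_rfl le_rfl)
  have hi1 : ∀ x y, 0 ≤ x → 0 ≤ y → Integrable (fun w => P x w * Q w y) halfLine := by
    intro x y hx hy
    refine ((hg.const_mul (f x)).mul_const B).mono'
      ((hP.comp measurable_prodMk_left).mul (hQ.comp measurable_prodMk_right)).aestronglyMeasurable
      (ae_halfLine_pos.mono fun w hw => ?_)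
    change |P x w * Q w y| ≤ _
    rw [abs_mul]
    exact mul_le_mul (hPb x w hx hw.le) (hQb w y hw.le hy) (abs_nonneg _)
      ((abs_nonneg _).trans (hPb x w hx hw.le))
  have hi2 : ∀ w w', 0 ≤ w → 0 ≤ w' → Integrable (fun x => P x w' * Q w x) halfLine := by
    intro w w' hw hw'
    refine ((hf.mul_const (g w')).mul_const B).mono'
      ((hP.comp measurable_prodMk_right).mul (hQ.comp measurable_prodMk_left)).aestronglyMeasurable
      (ae_halfLine_pos.mono fun x hx => ?_)
    change |P x w' * Q w x| ≤ _
    rw [abs_mul]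
    exact mul_le_mul (hPb x w' hx.le hw') (hQb w x hw hx.le) (abs_nonneg _)
      ((abs_nonneg _).trans (hPb x w' hx.le hw'))
  let F : (Fin n → ℝ) → (Fin n → ℝ) → ℝ := fun x w =>
    (∏ i, P (x i) (w i)) * (Matrix.of fun i j => Q (w i) (x j)).det
  have e1 : fredholmMinor (fun x y => ∫ w, P x w * Q w y ∂halfLine) n
      = ∫ x, ∫ w, F x w ∂halfSpace n ∂halfSpace n := by
    refine integral_congr_ae ((ae_halfSpace_pos n).mono fun x hx => ?_)
    exact det_integral (fun i w => P (x i) w) (fun j w => Q w (x j))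
      fun i j => hi1 _ _ (hx i).le (hx j).le
  have e2 : fredholmMinor (fun w w' => ∫ x, Q w x * P x w' ∂halfLine) n
      = ∫ w, ∫ x, F x w ∂halfSpace n ∂halfSpace n := by
    refine integral_congr_ae ((ae_halfSpace_pos n).mono fun w hw => ?_)
    have h := det_integral (fun i x => P x (w i)) (fun j x => Q (w j) x)
      fun i j => hi2 _ _ (hw j).le (hw i).le
    have e3 : (Matrix.of fun i j => ∫ x, Q (w i) x * P x (w j) ∂halfLine)
        = (Matrix.of fun i j => ∫ x, P x (w i) * Q (w j) x ∂halfLine).transpose := by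
      ext i j; simp [mul_comm]
    simp only
    rw [e3, Matrix.det_transpose, h]
    refine integral_congr_ae (Filter.Eventually.of_forall fun x => ?_)
    simp only [F]
    rw [← Matrix.det_transpose]
    rfl
  rw [e1, e2]
  refine integral_integral_swap ?_
  have hfg : Integrable (fun p : (Fin n → ℝ) × (Fin n → ℝ) =>
      ((∏ i, f (p.1 i)) * ∏ i, g (p.2 i)) * (Real.sqrt n ^ n * ∏ _i : Fin n, B))
      ((halfSpace n).prod (halfSpace n)) :=
    (Integrable.mul_prod (Integrable.fintype_prod fun _ => hf)
      (Integrable.fintype_prod fun _ => hg)).mul_const _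
  refine hfg.mono' ?_ ?_
  · refine Measurable.aestronglyMeasurable (Measurable.mul ?_ (measurable_det fun i j => ?_))
    · exact Finset.measurable_prod _ fun i _ => (hP.comp (by fun_prop : Measurable
        fun p : (Fin n → ℝ) × (Fin n → ℝ) => (p.1 i, p.2 i)) :)
    · exact (hQ.comp (by fun_prop : Measurable
        fun p : (Fin n → ℝ) × (Fin n → ℝ) => (p.2 i, p.1 j)) :)
  · have a1 := Measure.quasiMeasurePreserving_fst (μ := halfSpace n) (ν := halfSpace n)
      |>.ae (ae_halfSpace_pos n)
    have a2 := Measure.quasiMeasurePreserving_snd (μ := halfSpace n) (ν := halfSpace n)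
      |>.ae (ae_halfSpace_pos n)
    filter_upwards [a1, a2] with p h1 h2
    change |(∏ i, P (p.1 i) (p.2 i)) * (Matrix.of fun i j => Q (p.2 i) (p.1 j)).det| ≤ _
    rw [abs_mul, Finset.abs_prod, ← Finset.prod_mul_distrib]
    exact mul_le_mul (Finset.prod_le_prod (fun _ _ => abs_nonneg _)
        fun i _ => hPb _ _ (h1 i).le (h2 i).le)
      (abs_det_le_of_row_bound _ _ fun i j => hQb _ _ (h2 i).le (h1 j).le) (abs_nonneg _)
      (Finset.prod_nonneg fun i _ => (abs_nonneg _).trans (hPb _ _ (h1 i).le (h2 i).le))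

/-! ### Exponentially decaying functions -/

/-- Exponential decay at `+∞`, with bounds on every right half-line. -/
def ExpDecay (f : ℝ → ℝ) : Prop :=
  ∃ κ : ℝ, 0 < κ ∧ ∀ a : ℝ, ∃ C : ℝ, 0 ≤ C ∧ ∀ x, a ≤ x → |f x| ≤ C * Real.exp (-κ * x)

theorem integrable_exp_halfLine {κ : ℝ} (hκ : 0 < κ) :
    Integrable (fun x => Real.exp (-κ * x)) halfLine :=
  exp_neg_integrableOn_Ioi 0 hκ

/-- The decay bound of `f` on `[s,∞)` in the two-variable form. -/
theorem ExpDecay.bound_add {f : ℝ → ℝ} (hf : ExpDecay f) (s : ℝ) :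
    ∃ κ C : ℝ, 0 < κ ∧ 0 ≤ C ∧ ∀ x y, 0 ≤ x → 0 ≤ y →
      |f (x + y + s)| ≤ C * Real.exp (-κ * x) * Real.exp (-κ * y) := by
  obtain ⟨κ, hκ, h⟩ := hf
  obtain ⟨C, hC, h⟩ := h s
  refine ⟨κ, C * Real.exp (-κ * s), hκ, by positivity, fun x y hx hy => ?_⟩
  refine (h (x + y + s) (by linarith)).trans_eq ?_
  rw [mul_assoc, mul_assoc, ← Real.exp_add, ← Real.exp_add]
  ring_nf

theorem ExpDecay.tendsto_zero {f : ℝ → ℝ} (hf : ExpDecay f) :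
    Filter.Tendsto f Filter.atTop (nhds 0) := by
  obtain ⟨κ, hκ, h⟩ := hf
  obtain ⟨C, hC, h⟩ := h 0
  have h1 : Filter.Tendsto (fun x => C * Real.exp (-κ * x)) Filter.atTop (nhds (C * 0)) :=
    (Real.tendsto_exp_atBot.comp
      (Filter.tendsto_id.const_mul_atTop_of_neg (neg_neg_of_pos hκ))).const_mul C
  rw [mul_zero] at h1
  exact squeeze_zero_norm' ((Filter.eventually_ge_atTop 0).mono fun x hx => h x hx) h1

theorem ExpDecay.integrableOn {f : ℝ → ℝ} (hf : ExpDecay f) (hm : Measurable f) (s : ℝ) :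
    IntegrableOn f (Ioi s) := by
  obtain ⟨κ, hκ, h⟩ := hf
  obtain ⟨C, hC, h⟩ := h s
  refine ((exp_neg_integrableOn_Ioi s hκ).const_mul C).mono' hm.aestronglyMeasurable ?_
  exact (ae_restrict_mem measurableSet_Ioi).mono fun x hx => h x (le_of_lt hx)

theorem integrableOn_Ioi_comp_add {f : ℝ → ℝ} {a c : ℝ} :
    IntegrableOn (fun x => f (x + c)) (Ioi a) ↔ IntegrableOn f (Ioi (a + c)) := by
  have h := (measurePreserving_add_right volume c).integrableOn_comp_preimage
    (f := f) (s := Ioi (a + c)) (measurableEmbedding_addRight c)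
  rw [← h]
  simp [Function.comp_def]

theorem integral_Ioi_comp_add (f : ℝ → ℝ) (a c : ℝ) :
    ∫ x in Ioi a, f (x + c) = ∫ x in Ioi (a + c), f x := by
  have h := (measurePreserving_add_right volume c).setIntegral_preimage_emb
    (measurableEmbedding_addRight c) f (Ioi (a + c))
  rw [← h]
  simp

/-- `Det(I + a_s - a_s|δ⟩⟨1|) = Det(I - a_s)`. -/
theorem fredholmDet_sub_delta_one {a a' : ℝ → ℝ} (ha : ∀ x, HasDerivAt a (a' x) x)
    (hc : Continuous a') (h : ExpDecay a) (h' : ExpDecay a') (s : ℝ) :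
    fredholmDet (fun x y => a (x + s) - a (x + y + s)) = fredholmDet (kerA a s) := by
  -- In one order -a' is integrated over (0, y), which leaves the difference of boundary values; in
  -- the other it is integrated over (w, ∞), which leaves only `a`.
  let P : ℝ → ℝ → ℝ := fun x w => -a' (x + w + s)
  let Q : ℝ → ℝ → ℝ := fun w y => if w < y then 1 else 0
  obtain ⟨κ, C, hκ, hC, hb⟩ := h'.bound_add s
  have hcomm := fredholmMinor_comm (P := P) (Q := Q) (B := 1)
    (hc.measurable.comp (by fun_prop)).neg
    (Measurable.ite (measurableSet_lt measurable_fst measurable_snd) measurable_const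
      measurable_const)
    ((integrable_exp_halfLine hκ).const_mul C) (integrable_exp_halfLine hκ)
    (fun x w hx hw => by simpa [P] using hb x w hx hw)
    (fun w x _ _ => by simp only [Q]; split_ifs <;> simp)
  have hd : ∀ x z, HasDerivAt (fun w => a (x + w + s)) (a' (x + z + s)) z := fun x z => by
    simpa [Function.comp_def] using
      (ha (x + z + s)).comp z (((hasDerivAt_id z).const_add x).add_const s)
  have e1 : ∀ x y, 0 < x → 0 < y →
      ∫ w, P x w * Q w y ∂halfLine = a (x + s) - a (x + y + s) := by
    intro x y _ hy
    have : (fun w => P x w * Q w y) = (Iio y).indicator fun w => -a' (x + w + s) := by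
      ext w; by_cases hw : w < y <;> simp [P, Q, hw]
    rw [this, integral_indicator measurableSet_Iio, Measure.restrict_restrict measurableSet_Iio,
      inter_comm, Ioi_inter_Iio, integral_neg, ← integral_Ioc_eq_integral_Ioo,
      ← intervalIntegral.integral_of_le hy.le,
      intervalIntegral.integral_eq_sub_of_hasDerivAt (fun z _ => hd x z)
        (Continuous.intervalIntegrable (by fun_prop) _ _)]
    simp
  have e2 : ∀ w w', 0 < w → 0 < w' → ∫ x, Q w x * P x w' ∂halfLine = kerA a s w w' := by
    intro w w' hw _
    have : (fun x => Q w x * P x w') = (Ioi w).indicator fun x => -a' (x + w' + s) := by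
      ext x; by_cases hx : w < x <;> simp [P, Q, hx]
    rw [this, integral_indicator measurableSet_Ioi, Measure.restrict_restrict measurableSet_Ioi,
      Ioi_inter_Ioi, sup_of_le_left hw.le, integral_neg]
    have e3 : ∫ x in Ioi w, a' (x + w' + s) = ∫ x in Ioi (w + (w' + s)), a' x := by
      rw [← integral_Ioi_comp_add]; simp [add_assoc]
    rw [e3, integral_Ioi_of_hasDerivAt_of_tendsto' (fun x _ => ha x)
      (h'.integrableOn hc.measurable _) h.tendsto_zero]
    simp [kerA, add_assoc]
  simp only [fredholmDet]
  congr 1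
  ext n
  rw [← fredholmMinor_congr e1, ← fredholmMinor_congr e2, hcomm]

/-! ### Translating the half-line -/

theorem halfSpace_eq (n : ℕ) :
    halfSpace n = (volume : Measure (Fin n → ℝ)).restrict (univ.pi fun _ => Ioi 0) := by
  rw [volume_pi, Measure.restrict_pi_pi]

/-- Points with two equal coordinates lie on finitely many hyperplanes. Hence almost every point has
a unique smallest coordinate. -/
theorem ae_halfSpace_injective (n : ℕ) : ∀ᵐ x ∂halfSpace n, Function.Injective x := by
  rw [halfSpace_eq]
  refine ae_restrict_of_ae ?_
  have h : ∀ i j : Fin n, i ≠ j → ∀ᵐ x : Fin n → ℝ, x i ≠ x j := by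
    intro i j hij
    let S : Submodule ℝ (Fin n → ℝ) :=
      LinearMap.ker (LinearMap.proj (R := ℝ) (φ := fun _ : Fin n => ℝ) i - LinearMap.proj j)
    have hS : S ≠ ⊤ := by
      intro h
      have h1 : (Pi.single i 1 : Fin n → ℝ) ∈ S := h ▸ Submodule.mem_top
      simp [S, hij.symm] at h1
    have := Measure.addHaar_submodule volume S hS
    rw [ae_iff]
    convert this using 2
    ext x
    simp [S, sub_eq_zero]
  have h' : ∀ᵐ x : Fin n → ℝ, ∀ i j : Fin n, i ≠ j → x i ≠ x j := by
    simp only [ae_all_iff]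
    exact h
  refine h'.mono fun x hx i j hij => ?_
  by_contra hne
  exact hx i j hne hij

theorem integral_halfSpace_indicator {n : ℕ} (g : (Fin n → ℝ) → ℝ) {z : ℝ} (hz : 0 < z) :
    ∫ x, (if ∀ i, z < x i then g x else 0) ∂halfSpace n = ∫ x, g (fun i => x i + z) ∂halfSpace n := by
  have e : (fun x : Fin n → ℝ => if ∀ i, z < x i then g x else 0)
      = (univ.pi fun _ => Ioi z).indicator g := by
    ext x
    have hx : x ∈ (univ.pi fun _ => Ioi z) ↔ ∀ i, z < x i := by simp
    by_cases h : ∀ i, z < x i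
    · rw [if_pos h, indicator_of_mem (hx.2 h)]
    · rw [if_neg h, indicator_of_notMem (mt hx.1 h)]
  have hm : ∀ a : ℝ, MeasurableSet (univ.pi fun _ : Fin n => Ioi a) := fun a =>
    MeasurableSet.univ_pi fun _ => measurableSet_Ioi
  rw [e, integral_indicator (hm z), halfSpace_eq, Measure.restrict_restrict (hm z), ← pi_inter_distrib]
  have e2 : (fun _ : Fin n => Ioi z ∩ Ioi (0 : ℝ)) = fun _ => Ioi z := by
    rw [Ioi_inter_Ioi, sup_of_le_left hz.le]
  rw [e2]
  have h := (measurePreserving_add_right (volume : Measure (Fin n → ℝ))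
    (fun _ => z)).setIntegral_preimage_emb (measurableEmbedding_addRight _) g
    (univ.pi fun _ => Ioi z)
  rw [← h]
  congr 2
  ext x
  simp

/-- Integration of a symmetric function, ordered by the position of the smallest variable. -/
theorem integral_symmetric_eq {n : ℕ} {f : (Fin (n + 1) → ℝ) → ℝ}
    (hf : Integrable f (halfSpace (n + 1)))
    (hs : ∀ j x, f x = f (Fin.cons (x j) (j.removeNth x))) :
    ∫ x, f x ∂halfSpace (n + 1)
      = (n + 1) * ∫ z, ∫ x, f (Fin.cons z fun i => x i + z) ∂halfSpace n ∂halfLine := by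
  -- `F` keeps the integrand only where the separated variable is the strict minimum. Summed over
  -- the choice of that variable, these pieces recover `f` almost everywhere.
  let F : ℝ → (Fin n → ℝ) → ℝ := fun z x => if ∀ i, z < x i then f (Fin.cons z x) else 0
  have hS : ∀ j : Fin (n + 1), MeasurableSet {x : Fin (n + 1) → ℝ | ∀ i, x j < x (j.succAbove i)} :=
    fun j => by
      simp only [ofPred_forall]
      exact MeasurableSet.iInter fun i =>
        measurableSet_lt (measurable_pi_apply _) (measurable_pi_apply _)
  have hF : ∀ j : Fin (n + 1), (fun x : Fin (n + 1) → ℝ => F (x j) (j.removeNth x))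
      = {x : Fin (n + 1) → ℝ | ∀ i, x j < x (j.succAbove i)}.indicator f := by
    intro j
    ext x
    by_cases h : ∀ i, x j < x (j.succAbove i)
    · exact (if_pos h).trans ((hs j x).symm.trans (indicator_of_mem (mem_ofPred_eq ▸ h) f).symm)
    · exact (if_neg h).trans (indicator_of_notMem (mem_ofPred_eq ▸ h) f).symm
  have hi : ∀ j : Fin (n + 1), Integrable (fun x : Fin (n + 1) → ℝ => F (x j) (j.removeNth x))
      (halfSpace (n + 1)) := fun j => by
    rw [hF]; exact hf.indicator (hS j)
  have h1 : ∫ x, f x ∂halfSpace (n + 1)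
      = ∫ x, ∑ j, F (x j) (j.removeNth x) ∂halfSpace (n + 1) := by
    refine integral_congr_ae ((ae_halfSpace_injective (n + 1)).mono fun x hx => ?_)
    obtain ⟨j, hj⟩ := Finite.exists_min x
    have hlt : ∀ i, i ≠ j → x j < x i := fun i hij => lt_of_le_of_ne (hj i) fun h => hij (hx h.symm)
    have hv : ∀ j', F (x j') (j'.removeNth x)
        = {x : Fin (n + 1) → ℝ | ∀ i, x j' < x (j'.succAbove i)}.indicator f x :=
      fun j' => congrFun (hF j') x
    simp only [hv]
    rw [Finset.sum_eq_single j]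
    · rw [indicator_of_mem]
      exact fun i => hlt _ (Fin.succAbove_ne j i)
    · intro j' _ hj'
      rw [indicator_of_notMem]
      intro h
      obtain ⟨i, hi⟩ := Fin.exists_succAbove_eq hj'.symm
      have := h i
      rw [hi] at this
      exact absurd this (not_lt.2 (hj j'))
    · simp
  rw [h1, integral_finsetSum _ fun j _ => hi j]
  simp only [fun j => integral_removeNth (F := F) j (hi j)]
  have h2 : ∫ z, ∫ x, F z x ∂halfSpace n ∂halfLine
      = ∫ z, ∫ x, f (Fin.cons z fun i => x i + z) ∂halfSpace n ∂halfLine :=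
    integral_congr_ae (ae_halfLine_pos.mono fun z hz =>
      integral_halfSpace_indicator (fun x => f (Fin.cons z x)) hz)
  simp [h2]

/-- The translated kernel `k(x + t, y + t)`. -/
def shiftKer (k : ℝ → ℝ → ℝ) (t : ℝ) : ℝ → ℝ → ℝ := fun x y => k (x + t) (y + t)

/-- A measurable kernel that decays exponentially on all quadrants `[a,∞)²`. -/
structure DecayKer (k : ℝ → ℝ → ℝ) (κ : ℝ) : Prop where
  measurable : Measurable (Function.uncurry k)
  pos : 0 < κ
  bound : ∀ a : ℝ, ∃ C : ℝ, 0 ≤ C ∧ ∀ x y, a ≤ x → a ≤ y → |k x y| ≤ C * Real.exp (-κ * x)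

section

variable {k : ℝ → ℝ → ℝ} {κ : ℝ}

/-- One constant serves all t ≥ a, and the factor exp(-κt) is kept in the weight: it is what makes
the boundary density integrable in t. -/
theorem DecayKer.dominated (hk : DecayKer k κ) (a : ℝ) :
    ∃ C : ℝ, 0 ≤ C ∧ ∀ t, a ≤ t →
      Dominated (shiftKer k t) (fun x => Real.exp (-κ * t) * (C * Real.exp (-κ * x))) := by
  obtain ⟨C, hC, h⟩ := hk.bound a
  refine ⟨C, hC, fun t ht => ⟨?_, fun x y hx hy => ?_, ?_⟩⟩
  · exact (hk.measurable.comp (by fun_prop : Measurable fun p : ℝ × ℝ => (p.1 + t, p.2 + t)) :)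
  · refine (h (x + t) (y + t) (by linarith) (by linarith)).trans_eq ?_
    rw [mul_add, Real.exp_add]; ring
  · exact ((integrable_exp_halfLine hk.pos).const_mul C).const_mul _

theorem col_dominatedFun {k : ℝ → ℝ → ℝ} {w : ℝ → ℝ} (hk : Dominated k w) :
    DominatedFun (col k) w :=
  ⟨hk.measurable.comp measurable_prodMk_right, fun x hx => hk.bound x 0 hx le_rfl⟩

/-- The `n`-th coefficient of the boundary density, in the coordinates of the fixed kernel. -/
theorem numeratorCoeff_shift (t : ℝ) (n : ℕ) :
    numeratorCoeff (shiftKer k t) (col (shiftKer k t)) n 0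
      = ∫ x : Fin n → ℝ, (Matrix.of fun i j => k ((Fin.cons 0 x : Fin (n + 1) → ℝ) i + t)
          ((Fin.cons 0 x : Fin (n + 1) → ℝ) j + t)).det ∂halfSpace n := by
  rw [numeratorCoeff]
  congr 1
  ext x
  congr 1
  ext i j
  rw [colMatrix_apply]
  split_ifs with h
  · subst h; simp [col, shiftKer]
  · simp [shiftKer]

/-- Taking the smallest point as the new end point of the half-line and translating the others by it
puts that point at the boundary 0. -/
theorem fredholmMinor_shift_succ (hk : DecayKer k κ) (t : ℝ) (n : ℕ) :
    fredholmMinor (shiftKer k t) (n + 1)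
      = (n + 1) * ∫ τ in Ioi t, numeratorCoeff (shiftKer k τ) (col (shiftKer k τ)) n 0 := by
  obtain ⟨C, hC, h⟩ := hk.dominated t
  rw [fredholmMinor, integral_symmetric_eq (integrable_det_kernel (h t le_rfl) _)
    fun j x => det_cons_removeNth (shiftKer k t) j x]
  have e := integral_Ioi_comp_add
    (fun τ => numeratorCoeff (shiftKer k τ) (col (shiftKer k τ)) n 0) 0 t
  rw [zero_add] at e
  rw [← e]
  congr 2
  ext z
  rw [numeratorCoeff_shift]
  congr 1
  ext x
  congr 1
  ext i j
  refine Fin.cases ?_ (fun i => ?_) i <;> refine Fin.cases ?_ (fun j => ?_) j <;>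
    simp [shiftKer, add_assoc]

theorem measurable_numeratorCoeff_shift (hk : DecayKer k κ) (n : ℕ) :
    Measurable fun τ => numeratorCoeff (shiftKer k τ) (col (shiftKer k τ)) n 0 := by
  simp only [numeratorCoeff_shift]
  refine StronglyMeasurable.measurable (StronglyMeasurable.integral_prod_right
    (f := fun (τ : ℝ) (x : Fin n → ℝ) => (Matrix.of fun i j =>
      k ((Fin.cons 0 x : Fin (n + 1) → ℝ) i + τ)
        ((Fin.cons 0 x : Fin (n + 1) → ℝ) j + τ)).det) (ν := halfSpace n) ?_)
  refine Measurable.stronglyMeasurable (measurable_det fun i j => ?_)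
  have hc : ∀ i : Fin (n + 1), Measurable fun p : ℝ × (Fin n → ℝ) =>
      (Fin.cons 0 p.2 : Fin (n + 1) → ℝ) i + p.1 := fun i =>
    ((measurable_cons_apply i).comp (measurable_const.prodMk measurable_snd)).add measurable_fst
  exact (hk.measurable.comp ((hc i).prodMk (hc j)) :)

/-- The boundary density of the Fredholm determinant. -/
def boundaryDensity (k : ℝ → ℝ → ℝ) (t : ℝ) : ℝ := fredholmNum (shiftKer k t) (col (shiftKer k t)) 0

/-- Summing the formula for the minors exhibits the determinant as an integral over the position of
the end point. No differentiability of the kernel is involved. -/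
theorem fredholmDet_shift_eq (hk : DecayKer k κ) (t : ℝ) :
    IntegrableOn (boundaryDensity k) (Ioi t) ∧
    fredholmDet (shiftKer k t) = 1 - ∫ τ in Ioi t, boundaryDensity k τ := by
  obtain ⟨C, hC, h⟩ := hk.dominated t
  -- The mass of the weight decreases with the shift, so its value at `t` bounds it for every later
  -- shift.
  let W : ℝ := |∫ x, Real.exp (-κ * t) * (C * Real.exp (-κ * x)) ∂halfLine|
  let H : ℕ → ℝ := fun n => Real.sqrt ((n + 1 : ℕ) : ℝ) ^ (n + 1) * W ^ n / n.factorial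
  have hH : Summable H := summable_hadamard_succ _
  let G : ℕ → ℝ → ℝ := fun n τ => (-1) ^ n / (n.factorial : ℝ) *
    numeratorCoeff (shiftKer k τ) (col (shiftKer k τ)) n 0
  have hGm : ∀ n, Measurable (G n) := fun n =>
    (measurable_numeratorCoeff_shift hk n).const_mul _
  have hG : ∀ n τ, t < τ → |G n τ| ≤ H n * (C * Real.exp (-κ * τ)) := by
    intro n τ hτ
    have h1 := h τ hτ.le
    refine (abs_numerator_term_le h1 (col_dominatedFun h1) n le_rfl).trans ?_
    rw [mul_comm (H n)]
    refine mul_le_mul (by simp [mul_comm]) ?_ (by positivity) (by positivity)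
    refine div_le_div_of_nonneg_right (mul_le_mul_of_nonneg_left ?_ (by positivity))
      (by positivity)
    refine pow_le_pow_left₀ (abs_nonneg _) ?_ n
    simp only [W, integral_const_mul, abs_mul, Real.abs_exp]
    refine mul_le_mul_of_nonneg_right (Real.exp_le_exp.2 ?_) (by positivity)
    nlinarith [hk.pos]
  have hei : IntegrableOn (fun τ => C * Real.exp (-κ * τ)) (Ioi t) :=
    (exp_neg_integrableOn_Ioi t hk.pos).const_mul C
  have hae : ∀ n, ∀ᵐ τ ∂volume.restrict (Ioi t), ‖G n τ‖ ≤ H n * (C * Real.exp (-κ * τ)) :=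
    fun n => (ae_restrict_mem measurableSet_Ioi).mono fun τ hτ => hG n τ hτ
  have hGi : ∀ n, IntegrableOn (G n) (Ioi t) := fun n =>
    (hei.const_mul (H n)).mono' (hGm n).aestronglyMeasurable (hae n)
  have hsum : HasSum (fun n => ∫ τ in Ioi t, G n τ) (∫ τ in Ioi t, boundaryDensity k τ) := by
    refine hasSum_integral_of_summable_integral_norm hGi ?_
    refine Summable.of_nonneg_of_le (fun n => integral_nonneg fun z => norm_nonneg _) (fun n => ?_)
      (hH.mul_right (∫ τ in Ioi t, C * Real.exp (-κ * τ)))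
    rw [← integral_const_mul]
    exact integral_mono_ae (hGi n).norm (hei.const_mul _) (hae n)
  refine ⟨?_, ?_⟩
  · refine (hei.const_mul (∑' n, H n)).mono'
      (Measurable.tsum hGm).aestronglyMeasurable ?_
    refine (ae_restrict_mem measurableSet_Ioi).mono fun τ hτ => ?_
    rw [← tsum_mul_right]
    exact tsum_of_norm_bounded (hH.mul_right _).hasSum fun n => hG n τ hτ
  · have h2 : HasSum (fun n : ℕ => (-1) ^ n / (n.factorial : ℝ) * fredholmMinor (shiftKer k t) n)
        (1 - ∫ τ in Ioi t, boundaryDensity k τ) := by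
      rw [← hasSum_nat_add_iff' 1]
      convert hsum.neg using 1
      · ext n
        rw [fredholmMinor_shift_succ hk, ← mul_assoc, coeff_succ]
        simp only [G]
        rw [integral_const_mul]
        ring
      · simp [fredholmMinor_zero]
    exact h2.tsum_eq

/-! ### The determinant as the solution of a linear first-order equation. -/

theorem eq_mul_exp_of_hasDerivAt {D r : ℝ → ℝ} (hr : Continuous r)
    (h : ∀ t, HasDerivAt D (r t * D t) t) (a t : ℝ) :
    D t = D a * Real.exp (∫ x in a..t, r x) := by
  have hp : ∀ t, HasDerivAt (fun t => ∫ x in a..t, r x) (r t) t := fun t =>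
    (hr.integral_hasStrictDerivAt a t).hasDerivAt
  have hq : ∀ t, HasDerivAt (fun t => D t * Real.exp (-∫ x in a..t, r x)) 0 t := fun t => by
    refine ((h t).mul (hp t).neg.exp).congr_deriv ?_
    ring
  have hc := is_const_of_deriv_eq_zero (fun t => (hq t).differentiableAt) (fun t => (hq t).deriv) t a
  simp only [intervalIntegral.integral_same, neg_zero, Real.exp_zero, mul_one] at hc
  rw [← hc, mul_assoc, ← Real.exp_add]
  simp

/-- A solution is a fixed multiple of an exponential, so it keeps one sign, and the limit 1 decides
which. All nonvanishing of determinants comes from here. -/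
theorem pos_of_hasDerivAt_of_tendsto {D r : ℝ → ℝ} (hr : Continuous r)
    (h : ∀ t, HasDerivAt D (r t * D t) t) (h1 : Filter.Tendsto D Filter.atTop (nhds 1)) (t : ℝ) :
    0 < D t := by
  by_contra hn
  have : ∀ x, D x ≤ 0 := fun x => by
    rw [eq_mul_exp_of_hasDerivAt hr h t x]
    exact mul_nonpos_of_nonpos_of_nonneg (not_lt.1 hn) (Real.exp_pos _).le
  have := le_of_tendsto' h1 this
  linarith

/-- The Fredholm determinant of the translated kernel solves a linear differential equation. -/
theorem hasDerivAt_fredholmDet_shift (hk : DecayKer k κ) {r : ℝ → ℝ} (hr : Continuous r)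
    (h : ∀ t, boundaryDensity k t = fredholmDet (shiftKer k t) * r t) :
    (∀ t, HasDerivAt (fun t => fredholmDet (shiftKer k t)) (r t * fredholmDet (shiftKer k t)) t) ∧
    Filter.Tendsto (fun t => fredholmDet (shiftKer k t)) Filter.atTop (nhds 1) := by
  have hi := fun t => (fredholmDet_shift_eq hk t).1
  have hint : ∀ a b, IntervalIntegrable (boundaryDensity k) volume a b := fun a b => by
    rw [intervalIntegrable_iff]
    exact (hi (min a b)).mono_set Ioc_subset_Ioi_self
  have hD : (fun t => fredholmDet (shiftKer k t))
      = fun t => (1 - ∫ τ in Ioi 0, boundaryDensity k τ) + ∫ τ in (0)..t, boundaryDensity k τ := by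
    ext t
    rw [(fredholmDet_shift_eq hk t).2, ← intervalIntegral.integral_interval_add_Ioi (hi 0) (hi t)]
    ring
  -- A bootstrap: the primitive of an integrable density is continuous, so the density, being the
  -- determinant times `r`, is continuous, and then the primitive is differentiable.
  have hDc : Continuous fun t => fredholmDet (shiftKer k t) := by
    rw [hD]
    exact continuous_const.add (intervalIntegral.continuous_primitive hint 0)
  have hM : Continuous (boundaryDensity k) := by
    rw [show boundaryDensity k = fun t => fredholmDet (shiftKer k t) * r t from funext h]
    exact hDc.mul hr
  constructor
  · intro t
    rw [mul_comm, ← h t, hD]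
    exact ((hM.integral_hasStrictDerivAt 0 t).hasDerivAt).const_add _
  · rw [hD]
    have := (intervalIntegral_tendsto_integral_Ioi 0 (hi 0) Filter.tendsto_id).const_add
      (1 - ∫ τ in Ioi 0, boundaryDensity k τ)
    simpa using this

end

/-! ### Regularity of `A` -/

/-- On every right half-line, `f` has a bounded holomorphic extension to a half-strip. -/
def HolomorphicExtension (f : ℝ → ℝ) : Prop :=
  ∀ a : ℝ, ∃ η : ℝ, 0 < η ∧ ∃ F : ℂ → ℂ,
    DifferentiableOn ℂ F {z | a < z.re ∧ |z.im| < η} ∧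
    (∃ M : ℝ, ∀ z : ℂ, a < z.re → |z.im| < η → ‖F z‖ ≤ M) ∧ ∀ x : ℝ, a < x → F x = f x

theorem isOpen_halfStrip (a η : ℝ) : IsOpen {z : ℂ | a < z.re ∧ |z.im| < η} :=
  (isOpen_lt continuous_const Complex.continuous_re).inter
    (isOpen_lt Complex.continuous_im.abs continuous_const)

/-- Cauchy's estimate on a smaller half-strip. -/
theorem norm_deriv_le_halfStrip {a η M : ℝ} (hη : 0 < η) {F : ℂ → ℂ}
    (hF : DifferentiableOn ℂ F {z | a < z.re ∧ |z.im| < η})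
    (hM : ∀ z : ℂ, a < z.re → |z.im| < η → ‖F z‖ ≤ M) {z : ℂ} (hz : a + 1 < z.re)
    (hz' : |z.im| < η / 2) : ‖deriv F z‖ ≤ M / (min 1 (η / 2) / 2) := by
  -- A closed disc of this radius costs at most 1/2 in the real part and η/4 in the imaginary part,
  -- so it stays inside the larger half-strip.
  have hR : 0 < min 1 (η / 2) / 2 := by positivity
  have hmem : ∀ w ∈ Metric.closedBall z (min 1 (η / 2) / 2), a < w.re ∧ |w.im| < η := by
    intro w hw
    rw [mem_closedBall_iff_norm] at hw
    have h1 := (Complex.abs_re_le_norm (w - z)).trans hw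
    have h2 := (Complex.abs_im_le_norm (w - z)).trans hw
    rw [Complex.sub_re, abs_le] at h1
    rw [Complex.sub_im, abs_le] at h2
    rw [abs_lt] at hz' ⊢
    have := min_le_left 1 (η / 2)
    have := min_le_right 1 (η / 2)
    refine ⟨by linarith, by linarith, by linarith⟩
  refine Complex.norm_deriv_le_of_forall_mem_sphere_norm_le hR ?_ fun w hw => ?_
  · exact (hF.mono fun w hw => hmem w hw).diffContOnCl_ball subset_rfl
  · have := hmem w (Metric.sphere_subset_closedBall hw)
    exact hM w this.1 this.2

/-- Cauchy's estimate with the margin between `a - 1` and `a`. Its purpose is to bound derivatives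
up to +∞, which smoothness alone does not do. -/
theorem HolomorphicExtension.deriv {f : ℝ → ℝ} (h : HolomorphicExtension f)
    (hd : Differentiable ℝ f) : HolomorphicExtension (deriv f) := by
  intro a
  obtain ⟨η, hη, F, hF, ⟨M, hM⟩, hFf⟩ := h (a - 1)
  refine ⟨η / 2, by positivity, _root_.deriv F, ?_, ⟨M / (min 1 (η / 2) / 2), ?_⟩, ?_⟩
  · refine (hF.deriv (isOpen_halfStrip _ _)).mono ?_
    rintro z ⟨h1, h2⟩
    exact ⟨by linarith, by linarith⟩
  · intro z hz hz'
    exact norm_deriv_le_halfStrip hη hF hM (by linarith) hz'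
  · intro x hx
    have hmem : (x : ℂ) ∈ {z : ℂ | a - 1 < z.re ∧ |z.im| < η} :=
      ⟨by simp; linarith, by simpa using hη⟩
    have h1 : HasDerivAt F (_root_.deriv F x) x :=
      (hF.differentiableAt ((isOpen_halfStrip _ _).mem_nhds hmem)).hasDerivAt
    have h2 : HasDerivAt (fun y : ℝ => F y) (_root_.deriv F x) x := h1.comp_ofReal
    have h3 : HasDerivAt (fun y : ℝ => (f y : ℂ)) (_root_.deriv f x : ℝ) x :=
      (hd x).hasDerivAt.ofReal_comp
    refine h2.unique (h3.congr_of_eventuallyEq ?_)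
    filter_upwards [lt_mem_nhds (show a - 1 < x by linarith)] with y hy using hFf y hy

theorem HolomorphicExtension.bounded {f : ℝ → ℝ} (h : HolomorphicExtension f) (a : ℝ) :
    ∃ M, ∀ x, a ≤ x → |f x| ≤ M := by
  obtain ⟨η, hη, F, -, ⟨M, hM⟩, hFf⟩ := h (a - 1)
  refine ⟨M, fun x hx => ?_⟩
  have := hM x (by simp; linarith) (by simpa using hη)
  rw [hFf x (by linarith)] at this
  simpa using this

/-- A derivative decays exponentially if the function does and the second derivative is bounded. -/
theorem ExpDecay.of_second_deriv_bounded {f f' f'' : ℝ → ℝ} (h : ExpDecay f)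
    (hf : ∀ x, HasDerivAt f (f' x) x) (hf' : ∀ x, HasDerivAt f' (f'' x) x)
    (hb : ∀ a, ∃ M, ∀ x, a ≤ x → |f'' x| ≤ M) : ExpDecay f' := by
  obtain ⟨κ, hκ, h⟩ := h
  refine ⟨κ / 2, by positivity, fun a => ?_⟩
  obtain ⟨C, hC, h⟩ := h a
  obtain ⟨M, hM⟩ := hb a
  have hM0 : 0 ≤ M := (abs_nonneg _).trans (hM a le_rfl)
  refine ⟨2 * C + M, by positivity, fun x hx => ?_⟩
  -- The step balances the two errors: the difference quotient of f over a length ε has size ε²/ε,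
  -- and f' varies by at most Mε over it.
  set ε := Real.exp (-(κ / 2) * x) with hε
  have hε0 : 0 < ε := Real.exp_pos _
  have hεε : Real.exp (-κ * x) = ε * ε := by rw [hε, ← Real.exp_add]; ring_nf
  obtain ⟨ξ, hξ, e⟩ := exists_hasDerivAt_eq_slope f f' (by linarith : x < x + ε)
    (fun y _ => (hf y).continuousAt.continuousWithinAt) fun y _ => hf y
  obtain ⟨ζ, hζ, e'⟩ := exists_hasDerivAt_eq_slope f' f'' hξ.1
    (fun y _ => (hf' y).continuousAt.continuousWithinAt) fun y _ => hf' y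
  have h1 := h x hx
  have h2 := h (x + ε) (by linarith)
  have h3 : Real.exp (-κ * (x + ε)) ≤ ε * ε := by
    rw [← hεε]; exact Real.exp_le_exp.2 (by nlinarith)
  rw [hεε] at h1
  have h2' := h2.trans (mul_le_mul_of_nonneg_left h3 hC)
  have h4 := hM ζ (by linarith [hζ.1])
  have hx1 : x < ξ := hξ.1
  have hx2 : ξ < x + ε := hξ.2
  rw [eq_div_iff (by linarith)] at e e'
  have h5 : |f' ξ| * ε ≤ 2 * C * (ε * ε) := by
    have : |f' ξ| * ε = |f (x + ε) - f x| := by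
      rw [← e, abs_mul]; congr 1; rw [abs_of_pos]; ring; linarith
    rw [this]
    exact (abs_sub _ _).trans (by linarith)
  have h6 : |f' ξ| ≤ 2 * C * ε := by
    have : |f' ξ| * ε ≤ 2 * C * ε * ε := by linarith
    exact le_of_mul_le_mul_right this hε0
  have h7 : |f' ξ - f' x| ≤ M * ε := by
    rw [← e', abs_mul]
    refine mul_le_mul h4 ?_ (abs_nonneg _) hM0
    rw [abs_of_pos (by linarith)]; linarith
  have h8 : |f' x| ≤ |f' ξ| + |f' ξ - f' x| := by
    have := abs_sub (f' ξ) (f' ξ - f' x)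
    simpa using this
  linarith

/-- `a` is twice continuously differentiable, with derivatives `a'` and `a''`, and all three
functions decay exponentially. -/
structure Regular (a a' a'' : ℝ → ℝ) : Prop where
  hasDerivAt : ∀ x, HasDerivAt a (a' x) x
  hasDerivAt' : ∀ x, HasDerivAt a' (a'' x) x
  continuous'' : Continuous a''
  decay : ExpDecay a
  decay' : ExpDecay a'
  decay'' : ExpDecay a''

theorem Regular.continuous {a a' a'' : ℝ → ℝ} (h : Regular a a' a'') : Continuous a :=
  continuous_iff_continuousAt.2 fun x => (h.hasDerivAt x).continuousAt

theorem Regular.continuous' {a a' a'' : ℝ → ℝ} (h : Regular a a' a'') : Continuous a' :=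
  continuous_iff_continuousAt.2 fun x => (h.hasDerivAt' x).continuousAt

theorem ExpDecay.neg {f : ℝ → ℝ} (h : ExpDecay f) : ExpDecay fun x => -f x := by
  simpa only [ExpDecay, abs_neg] using h

theorem Regular.neg {a a' a'' : ℝ → ℝ} (h : Regular a a' a'') :
    Regular (fun x => -a x) (fun x => -a' x) fun x => -a'' x :=
  ⟨fun x => (h.hasDerivAt x).neg, fun x => (h.hasDerivAt' x).neg, h.continuous''.neg,
    h.decay.neg, h.decay'.neg, h.decay''.neg⟩

theorem Admissible.expDecay {γ : ℝ} {A : ℝ → ℝ} (hA : Admissible γ A) : ExpDecay A := by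
  obtain ⟨C, κ, hκ, h⟩ := hA.decay
  refine ⟨κ, hκ, fun a => ?_⟩
  obtain ⟨B, hB⟩ := isCompact_Icc.exists_bound_of_continuousOn
    (s := Icc a 0) hA.smooth.continuous.continuousOn
  refine ⟨|C| + |B|, by positivity, fun x hx => ?_⟩
  rcases le_total 0 x with h0 | h0
  · refine (h x h0).trans (mul_le_mul_of_nonneg_right ?_ (Real.exp_pos _).le)
    linarith [le_abs_self C, abs_nonneg B]
  · have h1 : 1 ≤ Real.exp (-κ * x) := Real.one_le_exp (by nlinarith)
    have h2 : |A x| ≤ |B| := (hB x ⟨hx, h0⟩).trans (le_abs_self B)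
    nlinarith [abs_nonneg C, abs_nonneg B]

/-- Decay passes from A to A' and then to A'' once A'' and A''' are bounded on right half-lines;
this is why the holomorphic extension is differentiated three times. -/
theorem Admissible.regular {γ : ℝ} {A : ℝ → ℝ} (hA : Admissible γ A) :
    Regular A (deriv A) (deriv (deriv A)) := by
  have h0 : HolomorphicExtension A := hA.analytic
  have c1 : ContDiff ℝ ∞ (deriv A) := (contDiff_infty_iff_deriv.1 hA.smooth).2
  have c2 : ContDiff ℝ ∞ (deriv (deriv A)) := (contDiff_infty_iff_deriv.1 c1).2
  have d0 : Differentiable ℝ A := hA.smooth.differentiable (by simp)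
  have d1 : Differentiable ℝ (deriv A) := c1.differentiable (by simp)
  have d2 : Differentiable ℝ (deriv (deriv A)) := c2.differentiable (by simp)
  have h1 := h0.deriv d0
  have h2 := h1.deriv d1
  have h3 := h2.deriv d2
  have e1 : ExpDecay (deriv A) := hA.expDecay.of_second_deriv_bounded
    (fun x => (d0 x).hasDerivAt) (fun x => (d1 x).hasDerivAt) h2.bounded
  exact ⟨fun x => (d0 x).hasDerivAt, fun x => (d1 x).hasDerivAt, c2.continuous, hA.expDecay, e1,
    e1.of_second_deriv_bounded (fun x => (d1 x).hasDerivAt) (fun x => (d2 x).hasDerivAt) h3.bounded⟩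

/-! ### Vectors and operators on `L²(ℝ₊)` -/

theorem coeFn_toL2 {f : ℝ → ℝ} (h : MemLp f 2 halfLine) : toL2 f =ᵐ[halfLine] f := by
  rw [toL2, dif_pos h]
  exact h.coeFn_toLp

theorem inner_eq_integral {f g : L2} {f' g' : ℝ → ℝ} (hf : f =ᵐ[halfLine] f')
    (hg : g =ᵐ[halfLine] g') : inner ℝ f g = ∫ y, f' y * g' y ∂halfLine := by
  rw [L2.inner_def]
  refine integral_congr_ae ?_
  filter_upwards [hf, hg] with y h1 h2
  simp [h1, h2, mul_comm]

theorem integrable_mul_L2 {f g : L2} {f' g' : ℝ → ℝ} (hf : f =ᵐ[halfLine] f')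
    (hg : g =ᵐ[halfLine] g') : Integrable (fun y => f' y * g' y) halfLine := by
  refine (L2.integrable_inner (𝕜 := ℝ) f g).congr ?_
  filter_upwards [hf, hg] with y h1 h2
  simp [h1, h2, mul_comm]

theorem memLp_exp {κ : ℝ} (hκ : 0 < κ) : MemLp (fun x => Real.exp (-κ * x)) 2 halfLine := by
  rw [memLp_two_iff_integrable_sq (by fun_prop)]
  convert integrable_exp_halfLine (κ := 2 * κ) (by positivity) using 2 with x
  rw [sq, ← Real.exp_add]; ring_nf

/-- The norm of `x ↦ e^{-κx}` on the half-line. -/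
def expNorm (κ : ℝ) : ℝ := ‖toL2 fun x => Real.exp (-κ * x)‖

theorem expNorm_nonneg (κ : ℝ) : 0 ≤ expNorm κ := norm_nonneg _

theorem memLp_of_exp_bound {κ C : ℝ} (hκ : 0 < κ) {f : ℝ → ℝ} (hf : AEStronglyMeasurable f halfLine)
    (h : ∀ᵐ x ∂halfLine, |f x| ≤ C * Real.exp (-κ * x)) : MemLp f 2 halfLine := by
  refine (memLp_exp hκ).of_le_mul (c := C) hf (h.mono fun x hx => ?_)
  simpa [abs_of_pos (Real.exp_pos _)] using hx

theorem norm_le_of_exp_bound {κ C : ℝ} (hκ : 0 < κ) (f : L2)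
    (h : ∀ᵐ x ∂halfLine, |f x| ≤ C * Real.exp (-κ * x)) : ‖f‖ ≤ C * expNorm κ := by
  refine Lp.norm_le_mul_norm_of_ae_le_mul ?_
  filter_upwards [h, coeFn_toL2 (memLp_exp hκ)] with x h1 h2
  rw [h2]
  simpa [abs_of_pos (Real.exp_pos _)] using h1

/-- `T f` is represented by `x ↦ ⟪φ x, f⟫`. -/
def Represents (T : L2 →L[ℝ] L2) (φ : ℝ → L2) : Prop :=
  ∀ f, T f =ᵐ[halfLine] fun x => inner ℝ (φ x) f

theorem Represents.sub {T S : L2 →L[ℝ] L2} {φ ψ : ℝ → L2} (hT : Represents T φ)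
    (hS : Represents S ψ) : Represents (T - S) fun x => φ x - ψ x := fun f => by
  refine (Lp.coeFn_sub (T f) (S f)).trans ?_
  filter_upwards [hT f, hS f] with x h1 h2
  rw [Pi.sub_apply, h1, h2, inner_sub_left]

theorem Represents.smul {T : L2 →L[ℝ] L2} {φ : ℝ → L2} (hT : Represents T φ) (c : ℝ) :
    Represents (c • T) fun x => c • φ x := fun f => by
  refine (Lp.coeFn_smul c (T f)).trans ?_
  filter_upwards [hT f] with x h1
  rw [Pi.smul_apply, h1, real_inner_smul_left, smul_eq_mul]

theorem Represents.norm_apply_le {T : L2 →L[ℝ] L2} {φ : ℝ → L2} (hT : Represents T φ) {κ C : ℝ}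
    (hκ : 0 < κ) (h : ∀ x, 0 ≤ x → ‖φ x‖ ≤ C * Real.exp (-κ * x)) (f : L2) :
    ‖T f‖ ≤ C * expNorm κ * ‖f‖ := by
  have := norm_le_of_exp_bound (C := C * ‖f‖) hκ (T f) ?_
  · linarith
  · filter_upwards [hT f, ae_halfLine_pos] with x h1 hx
    rw [h1]
    refine (abs_real_inner_le_norm _ _).trans ?_
    nlinarith [h x hx.le, norm_nonneg f]

/-- Cauchy–Schwarz at each point x. This converts estimates of the representing vectors into
operator norm estimates, in particular for derivatives in s. -/
theorem Represents.norm_le {T : L2 →L[ℝ] L2} {φ : ℝ → L2} (hT : Represents T φ) {κ C : ℝ}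
    (hκ : 0 < κ) (h : ∀ x, 0 ≤ x → ‖φ x‖ ≤ C * Real.exp (-κ * x)) : ‖T‖ ≤ C * expNorm κ := by
  have hC : 0 ≤ C := by simpa using (norm_nonneg _).trans (h 0 le_rfl)
  exact T.opNorm_le_bound (mul_nonneg hC (expNorm_nonneg κ)) (hT.norm_apply_le hκ h)

theorem exists_represents {φ : ℝ → L2} (hφ : Continuous φ) {κ C : ℝ} (hκ : 0 < κ)
    (h : ∀ x, 0 ≤ x → ‖φ x‖ ≤ C * Real.exp (-κ * x)) : ∃ T, Represents T φ := by
  have hm : ∀ f : L2, MemLp (fun x => inner ℝ (φ x) f) 2 halfLine := fun f => by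
    refine memLp_of_exp_bound (C := C * ‖f‖) hκ
      (by fun_prop : Continuous fun x => inner ℝ (φ x) f).aestronglyMeasurable ?_
    filter_upwards [ae_halfLine_pos] with x hx
    refine (abs_real_inner_le_norm _ _).trans ?_
    nlinarith [h x hx.le, norm_nonneg f]
  let L : L2 →ₗ[ℝ] L2 :=
    { toFun := fun f => (hm f).toLp
      map_add' := fun f g => by
        rw [← MemLp.toLp_add]
        exact MemLp.toLp_congr _ _ (Filter.Eventually.of_forall fun x => inner_add_right _ _ _)
      map_smul' := fun c f => by
        rw [RingHom.id_apply, ← MemLp.toLp_const_smul]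
        exact MemLp.toLp_congr _ _
          (Filter.Eventually.of_forall fun x => real_inner_smul_right _ _ _) }
  refine ⟨L.mkContinuous (C * expNorm κ) fun f => ?_, fun f => (hm f).coeFn_toLp⟩
  have := norm_le_of_exp_bound (C := C * ‖f‖) hκ (L f) ?_
  · linarith
  · filter_upwards [(hm f).coeFn_toLp, ae_halfLine_pos] with x h1 hx
    rw [show (L f) x = inner ℝ (φ x) f from h1]
    refine (abs_real_inner_le_norm _ _).trans ?_
    nlinarith [h x hx.le, norm_nonneg f]

theorem integralOperator_eq {k : ℝ → ℝ → ℝ} {T : L2 →L[ℝ] L2} (h : IsIntegralOperator k T) :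
    integralOperator k = T := by
  have h' : ∃ T : L2 →L[ℝ] L2, IsIntegralOperator k T := ⟨T, h⟩
  rw [integralOperator, dif_pos h']
  ext1 f
  exact Lp.ext ((h'.choose_spec f).trans (h f).symm)

/-! ### The translates of a decaying function -/

/-- The function `y ↦ a(y + t)` as an element of `L²(ℝ₊)`. -/
def vec (a : ℝ → ℝ) (t : ℝ) : L2 := toL2 fun y => a (y + t)

theorem ExpDecay.bound_shift {a : ℝ → ℝ} (h : ExpDecay a) :
    ∃ κ, 0 < κ ∧ ∀ s, ∃ C, 0 ≤ C ∧ ∀ t, s ≤ t → ∀ x, 0 ≤ x →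
      |a (x + t)| ≤ C * Real.exp (-κ * t) * Real.exp (-κ * x) := by
  obtain ⟨κ, hκ, h⟩ := h
  refine ⟨κ, hκ, fun s => ?_⟩
  obtain ⟨C, hC, h⟩ := h s
  refine ⟨C, hC, fun t ht x hx => (h (x + t) (by linarith)).trans_eq ?_⟩
  rw [mul_add, Real.exp_add]; ring

theorem ExpDecay.memLp {a : ℝ → ℝ} (h : ExpDecay a) (hm : Measurable a) (t : ℝ) :
    MemLp (fun y => a (y + t)) 2 halfLine := by
  obtain ⟨κ, hκ, h⟩ := h.bound_shift
  obtain ⟨C, -, h⟩ := h t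
  exact memLp_of_exp_bound (C := C * Real.exp (-κ * t)) hκ
    (hm.comp (by fun_prop : Measurable fun y : ℝ => y + t)).aestronglyMeasurable
    (ae_halfLine_pos.mono fun x hx => h t le_rfl x hx.le)

theorem ExpDecay.coeFn_vec {a : ℝ → ℝ} (h : ExpDecay a) (hm : Measurable a) (t : ℝ) :
    vec a t =ᵐ[halfLine] fun y => a (y + t) := coeFn_toL2 (h.memLp hm t)

theorem ExpDecay.norm_vec_le {a : ℝ → ℝ} (h : ExpDecay a) (hm : Measurable a) :
    ∃ κ, 0 < κ ∧ ∀ s, ∃ C, 0 ≤ C ∧ ∀ t, s ≤ t → ‖vec a t‖ ≤ C * Real.exp (-κ * t) := by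
  obtain ⟨κ, hκ, hb⟩ := h.bound_shift
  refine ⟨κ, hκ, fun s => ?_⟩
  obtain ⟨C, hC, hb⟩ := hb s
  refine ⟨C * expNorm κ, mul_nonneg hC (expNorm_nonneg κ), fun t ht => ?_⟩
  have := norm_le_of_exp_bound (C := C * Real.exp (-κ * t)) hκ (vec a t) ?_
  · linarith
  · filter_upwards [h.coeFn_vec hm t, ae_halfLine_pos] with x h1 hx
    rw [h1]
    exact hb t ht x hx.le

theorem abs_sub_le_of_hasDerivAt {f f' : ℝ → ℝ} (hf : ∀ x, HasDerivAt f (f' x) x) {x h M : ℝ}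
    (hM : ∀ y, |y - x| ≤ |h| → |f' y| ≤ M) : |f (x + h) - f x| ≤ M * |h| := by
  have := Convex.norm_image_sub_le_of_norm_hasDerivWithin_le (𝕜 := ℝ)
    (s := Metric.closedBall x |h|) (x := x) (y := x + h) (C := M)
    (fun y _ => (hf y).hasDerivWithinAt)
    (fun y hy => hM y (by simpa [Real.dist_eq] using hy)) (convex_closedBall _ _)
    (by simp) (by simp)
  simpa using this

theorem vec_lipschitz {a a' : ℝ → ℝ} (ha : ∀ x, HasDerivAt a (a' x) x) (hd : ExpDecay a)
    (hd' : ExpDecay a') (s : ℝ) :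
    ∃ C, ∀ h, |h| ≤ 1 → ‖vec a (s + h) - vec a s‖ ≤ C * |h| := by
  have hm : Measurable a :=
    (continuous_iff_continuousAt.2 fun x => (ha x).continuousAt).measurable
  obtain ⟨κ, hκ, hb⟩ := hd'.bound_shift
  obtain ⟨C, hC, hb⟩ := hb (s - 1)
  refine ⟨C * Real.exp (-κ * (s - 1)) * expNorm κ, fun h hh => ?_⟩
  have := norm_le_of_exp_bound (C := C * Real.exp (-κ * (s - 1)) * |h|) hκ
    (vec a (s + h) - vec a s) ?_
  · linarith
  filter_upwards [hd.coeFn_vec hm (s + h), hd.coeFn_vec hm s, Lp.coeFn_sub (vec a (s + h)) (vec a s),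
    ae_halfLine_pos] with x h1 h2 h3 hx
  rw [h3, Pi.sub_apply, h1, h2, ← add_assoc]
  refine (abs_sub_le_of_hasDerivAt ha
    (M := C * Real.exp (-κ * (s - 1)) * Real.exp (-κ * x)) fun y hy => ?_).trans_eq (by ring)
  have hy' := (abs_le.1 (hy.trans hh)).1
  have := hb (y - x) (by linarith) x hx.le
  rw [add_sub_cancel] at this
  refine this.trans (mul_le_mul_of_nonneg_right (mul_le_mul_of_nonneg_left
    (Real.exp_le_exp.2 (by nlinarith)) hC) (Real.exp_pos _).le)

/-- The decay of the remainder in t matters as much as the power h²: the operator is represented by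
the vectors at s + x, and its remainder must be square integrable in x. -/
theorem vec_taylor {a a' a'' : ℝ → ℝ} (hr : Regular a a' a'') :
    ∃ κ, 0 < κ ∧ ∀ s, ∃ C, 0 ≤ C ∧ ∀ t, s ≤ t → ∀ h, |h| ≤ 1 →
      ‖vec a (t + h) - vec a t - h • vec a' t‖ ≤ C * Real.exp (-κ * t) * h ^ 2 := by
  obtain ⟨κ, hκ, hb⟩ := hr.decay''.bound_shift
  refine ⟨κ, hκ, fun s => ?_⟩
  obtain ⟨C, hC, hb⟩ := hb (s - 1)
  -- Here C bounds a'' on [s-1, ∞), exp κ pays for an increment of length at most 1, and the last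
  -- factor is the norm of exp(-κx).
  refine ⟨C * Real.exp κ * expNorm κ, by have := expNorm_nonneg κ; positivity, fun t ht h hh => ?_⟩
  set E := C * Real.exp κ * Real.exp (-κ * t) with hE
  have := norm_le_of_exp_bound (C := E * h ^ 2) hκ
    (vec a (t + h) - vec a t - h • vec a' t) ?_
  · rw [hE] at this; linarith
  filter_upwards [hr.decay.coeFn_vec hr.continuous.measurable (t + h),
    hr.decay.coeFn_vec hr.continuous.measurable t,
    hr.decay'.coeFn_vec hr.continuous'.measurable t,
    Lp.coeFn_sub (vec a (t + h) - vec a t) (h • vec a' t),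
    Lp.coeFn_sub (vec a (t + h)) (vec a t), Lp.coeFn_smul h (vec a' t),
    ae_halfLine_pos] with x h1 h2 h3 h4 h5 h6 hx
  rw [h4, Pi.sub_apply, h5, Pi.sub_apply, h6, Pi.smul_apply, h1, h2, h3, ← add_assoc]
  have key : ∀ y, |y - (x + t)| ≤ |h| → |a'' y| ≤ E * Real.exp (-κ * x) := fun y hy => by
    have hy' := (abs_le.1 (hy.trans hh)).1
    have := hb (y - x) (by linarith) x hx.le
    rw [add_sub_cancel] at this
    refine this.trans (mul_le_mul_of_nonneg_right ?_ (Real.exp_pos _).le)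
    rw [hE, mul_assoc, ← Real.exp_add]
    exact mul_le_mul_of_nonneg_left (Real.exp_le_exp.2 (by nlinarith)) hC
  -- Removing the linear part reduces the second-order estimate to the mean value inequality, used
  -- for a' and then for this difference.
  have hg : ∀ y, HasDerivAt (fun y => a y - y * a' (x + t)) (a' y - a' (x + t)) y := fun y =>
    ((hr.hasDerivAt y).sub ((hasDerivAt_id y).mul_const (a' (x + t)))).congr_deriv (by simp)
  have h7 := abs_sub_le_of_hasDerivAt hg (x := x + t) (h := h)
    (M := E * Real.exp (-κ * x) * |h|) fun y hy => by
      have := abs_sub_le_of_hasDerivAt hr.hasDerivAt' (x := x + t) (h := y - (x + t))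
        fun z hz => key z (hz.trans hy)
      rw [add_sub_cancel] at this
      have hp : 0 ≤ E * Real.exp (-κ * x) := (abs_nonneg _).trans (key (x + t) (by simp))
      exact this.trans (mul_le_mul_of_nonneg_left hy hp)
  have e : a (x + t + h) - a (x + t) - h • a' (x + t)
      = a (x + t + h) - (x + t + h) * a' (x + t) - (a (x + t) - (x + t) * a' (x + t)) := by
    rw [smul_eq_mul]; ring
  rw [e]
  refine h7.trans_eq ?_
  rw [← sq_abs h]; ring

theorem hasDerivAt_of_quadratic_bound {E : Type*} [NormedAddCommGroup E] [NormedSpace ℝ E]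
    {F : ℝ → E} {F' : E} {s C : ℝ}
    (h : ∀ h, |h| ≤ 1 → ‖F (s + h) - F s - h • F'‖ ≤ C * h ^ 2) : HasDerivAt F F' s := by
  rw [hasDerivAt_iff_isLittleO_nhds_zero]
  have h1 : (fun h : ℝ => F (s + h) - F s - h • F') =O[nhds 0] fun h => h ^ 2 := by
    refine Asymptotics.IsBigO.of_bound C ?_
    filter_upwards [Metric.closedBall_mem_nhds (0 : ℝ) one_pos] with x hx
    rw [norm_pow, Real.norm_eq_abs, sq_abs]
    exact h x (by simpa using hx)
  exact h1.trans_isLittleO (Asymptotics.isLittleO_pow_id one_lt_two)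

theorem continuous_vec {a a' : ℝ → ℝ} (ha : ∀ x, HasDerivAt a (a' x) x) (hd : ExpDecay a)
    (hd' : ExpDecay a') : Continuous (vec a) := by
  refine continuous_iff_continuousAt.2 fun s => ?_
  obtain ⟨C, hC⟩ := vec_lipschitz ha hd hd' s
  rw [ContinuousAt, tendsto_iff_norm_sub_tendsto_zero]
  have h1 : Filter.Tendsto (fun t => C * |t - s|) (nhds s) (nhds 0) := by
    have : Continuous fun t => C * |t - s| := by fun_prop
    simpa using this.tendsto s
  refine squeeze_zero' (Filter.Eventually.of_forall fun t => norm_nonneg _) ?_ h1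
  filter_upwards [Metric.closedBall_mem_nhds s one_pos] with t ht
  simpa using hC (t - s) (by simpa [Real.dist_eq] using ht)

theorem hasDerivAt_vec {a a' a'' : ℝ → ℝ} (hr : Regular a a' a'') (s : ℝ) :
    HasDerivAt (vec a) (vec a' s) s := by
  obtain ⟨κ, -, h⟩ := vec_taylor hr
  obtain ⟨C, -, h⟩ := h s
  exact hasDerivAt_of_quadratic_bound (C := C * Real.exp (-κ * s)) fun x hx => h s le_rfl x hx

/-! ### The operators with kernels `a(x + y + s)` -/

/-- The operator with kernel `a(x + y + s)`. -/
def op (a : ℝ → ℝ) (s : ℝ) : L2 →L[ℝ] L2 := integralOperator (kerA a s)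

theorem isIntegralOperator_of_represents {a : ℝ → ℝ} (hd : ExpDecay a) (hm : Measurable a) {s : ℝ}
    {T : L2 →L[ℝ] L2} (hT : Represents T fun x => vec a (s + x)) :
    IsIntegralOperator (kerA a s) T := fun f => by
  refine (hT f).trans (Filter.Eventually.of_forall fun x => ?_)
  change inner ℝ (vec a (s + x)) f = _
  rw [inner_eq_integral (hd.coeFn_vec hm (s + x)) (Filter.EventuallyEq.refl _ f)]
  refine integral_congr_ae (Filter.Eventually.of_forall fun y => ?_)
  simp only [kerA]
  ring_nf

theorem exists_represents_vec {a a' : ℝ → ℝ} (ha : ∀ x, HasDerivAt a (a' x) x) (hd : ExpDecay a)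
    (hd' : ExpDecay a') (s : ℝ) : ∃ T, Represents T fun x => vec a (s + x) := by
  have hm : Measurable a :=
    (continuous_iff_continuousAt.2 fun x => (ha x).continuousAt).measurable
  obtain ⟨κ, hκ, hb⟩ := hd.norm_vec_le hm
  obtain ⟨C, hC, hb⟩ := hb s
  refine exists_represents ((continuous_vec ha hd hd').comp (by fun_prop)) (C := C * Real.exp (-κ * s))
    hκ fun x hx => (hb (s + x) (by linarith)).trans_eq ?_
  rw [mul_add, Real.exp_add]; ring

theorem isIntegralOperator_op {a a' : ℝ → ℝ} (ha : ∀ x, HasDerivAt a (a' x) x) (hd : ExpDecay a)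
    (hd' : ExpDecay a') (s : ℝ) : IsIntegralOperator (kerA a s) (op a s) := by
  obtain ⟨T, hT⟩ := exists_represents_vec ha hd hd' s
  have hm : Measurable a :=
    (continuous_iff_continuousAt.2 fun x => (ha x).continuousAt).measurable
  have h := isIntegralOperator_of_represents hd hm hT
  rw [op, integralOperator_eq h]
  exact h

theorem represents_op {a a' : ℝ → ℝ} (ha : ∀ x, HasDerivAt a (a' x) x) (hd : ExpDecay a)
    (hd' : ExpDecay a') (s : ℝ) : Represents (op a s) fun x => vec a (s + x) := by
  obtain ⟨T, hT⟩ := exists_represents_vec ha hd hd' s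
  have hm : Measurable a :=
    (continuous_iff_continuousAt.2 fun x => (ha x).continuousAt).measurable
  rw [op, integralOperator_eq (isIntegralOperator_of_represents hd hm hT)]
  exact hT

theorem Regular.represents_op {a a' a'' : ℝ → ℝ} (hr : Regular a a' a'') (s : ℝ) :
    Represents (op a s) fun x => vec a (s + x) :=
  TauRep.represents_op hr.hasDerivAt hr.decay hr.decay' s

theorem Regular.represents_op' {a a' a'' : ℝ → ℝ} (hr : Regular a a' a'') (s : ℝ) :
    Represents (op a' s) fun x => vec a' (s + x) :=
  TauRep.represents_op hr.hasDerivAt' hr.decay' hr.decay'' s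

/-- The Taylor remainder of the operator is represented by the Taylor remainders of the vectors, so
differentiability holds in operator norm. -/
theorem hasDerivAt_op {a a' a'' : ℝ → ℝ} (hr : Regular a a' a'') (s : ℝ) :
    HasDerivAt (op a) (op a' s) s := by
  obtain ⟨κ, hκ, h⟩ := vec_taylor hr
  obtain ⟨C, hC, h⟩ := h s
  refine hasDerivAt_of_quadratic_bound (C := C * Real.exp (-κ * s) * expNorm κ) fun t ht => ?_
  have := (((hr.represents_op (s + t)).sub (hr.represents_op s)).sub
    ((hr.represents_op' s).smul t)).norm_le (C := C * Real.exp (-κ * s) * t ^ 2) hκ fun x hx => by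
      have := h (s + x) (by linarith) t ht
      rw [add_right_comm] at this
      refine this.trans_eq ?_
      rw [mul_add, Real.exp_add]; ring
  linarith

theorem norm_op_le {a a' a'' : ℝ → ℝ} (hr : Regular a a' a'') :
    ∃ κ, 0 < κ ∧ ∀ s, ∃ C, 0 ≤ C ∧ ∀ t, s ≤ t → ‖op a t‖ ≤ C * Real.exp (-κ * t) := by
  obtain ⟨κ, hκ, h⟩ := hr.decay.norm_vec_le hr.continuous.measurable
  refine ⟨κ, hκ, fun s => ?_⟩
  obtain ⟨C, hC, h⟩ := h s
  refine ⟨C * expNorm κ, mul_nonneg hC (expNorm_nonneg κ), fun t ht => ?_⟩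
  have := (hr.represents_op t).norm_le (C := C * Real.exp (-κ * t)) hκ fun x hx => by
    refine (h (t + x) (by linarith)).trans_eq ?_
    rw [mul_add, Real.exp_add]; ring
  linarith

/-! ### Symmetry, squares and compactness -/

theorem integrable_kernel_mul {k : ℝ → ℝ → ℝ} (hk : Measurable (Function.uncurry k)) {κ C : ℝ}
    (hκ : 0 < κ)
    (h : ∀ x y, 0 ≤ x → 0 ≤ y → |k x y| ≤ C * Real.exp (-κ * x) * Real.exp (-κ * y)) (f g : L2) :
    Integrable (fun p : ℝ × ℝ => k p.1 p.2 * f p.2 * g p.1) (halfLine.prod halfLine) := by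
  have h1 : ∀ f : L2, Integrable (fun x => Real.exp (-κ * x) * ‖f x‖) halfLine := fun f =>
    (memLp_exp hκ).integrable_mul (Lp.memLp f).norm
  have h2 := ((h1 g).mul_prod (h1 f)).const_mul C
  refine h2.mono' ?_ ?_
  · exact (hk.aestronglyMeasurable.mul
      ((Lp.aestronglyMeasurable f).comp_snd)).mul ((Lp.aestronglyMeasurable g).comp_fst)
  · have a1 := Measure.quasiMeasurePreserving_fst (μ := halfLine) (ν := halfLine)
      |>.ae ae_halfLine_pos
    have a2 := Measure.quasiMeasurePreserving_snd (μ := halfLine) (ν := halfLine)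
      |>.ae ae_halfLine_pos
    filter_upwards [a1, a2] with p hp1 hp2
    rw [norm_mul, norm_mul]
    have := h p.1 p.2 hp1.le hp2.le
    calc ‖k p.1 p.2‖ * ‖f p.2‖ * ‖g p.1‖
        ≤ (C * Real.exp (-κ * p.1) * Real.exp (-κ * p.2)) * ‖f p.2‖ * ‖g p.1‖ := by
          gcongr; exact this
      _ = _ := by ring

theorem inner_op_left (s : ℝ) {b : ℝ → ℝ} (hb : Continuous b) (hbd : ExpDecay b) (hT : IsIntegralOperator (kerA b s) (op b s)) (f g : L2) :
    inner ℝ (op b s f) g = inner ℝ f (op b s g) := by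
  obtain ⟨κ, C, hκ, -, h⟩ := hbd.bound_add s
  have hi := integrable_kernel_mul (k := kerA b s)
    (by unfold kerA; exact (hb.measurable.comp (by fun_prop : Measurable
      fun p : ℝ × ℝ => p.1 + p.2 + s) :)) hκ h f g
  rw [inner_eq_integral (hT f) (Filter.EventuallyEq.refl _ g),
    inner_eq_integral (Filter.EventuallyEq.refl _ f) (hT g)]
  have e1 : ∀ x, (∫ y in Ioi 0, kerA b s x y * f y) * g x
      = ∫ y, kerA b s x y * f y * g x ∂halfLine := fun x => (integral_mul_const _ _).symm
  have e2 : ∀ y, f y * (∫ x in Ioi 0, kerA b s y x * g x)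
      = ∫ x, kerA b s x y * f y * g x ∂halfLine := fun y => by
    rw [← integral_const_mul]
    congr 1
    ext x
    simp only [kerA]
    ring_nf
  simp only [e1, e2]
  exact integral_integral_swap hi

section

variable {a a' a'' : ℝ → ℝ}

theorem Regular.isIntegralOperator (hr : Regular a a' a'') (s : ℝ) :
    IsIntegralOperator (kerA a s) (op a s) :=
  isIntegralOperator_op hr.hasDerivAt hr.decay hr.decay' s

theorem Regular.isIntegralOperator' (hr : Regular a a' a'') (s : ℝ) :
    IsIntegralOperator (kerA a' s) (op a' s) :=
  isIntegralOperator_op hr.hasDerivAt' hr.decay' hr.decay'' s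

theorem Regular.inner_op (hr : Regular a a' a'') (s : ℝ) (f g : L2) :
    inner ℝ (op a s f) g = inner ℝ f (op a s g) :=
  inner_op_left s hr.continuous hr.decay (hr.isIntegralOperator s) f g

theorem Regular.inner_op' (hr : Regular a a' a'') (s : ℝ) (f g : L2) :
    inner ℝ (op a' s f) g = inner ℝ f (op a' s g) :=
  inner_op_left s hr.continuous' hr.decay' (hr.isIntegralOperator' s) f g

/-- `A_s` maps `y ↦ a(y + s + t)` to `K_s(·,t)`. -/
theorem Regular.op_vec (hr : Regular a a' a'') (s t : ℝ) :
    op a s (vec a (s + t)) =ᵐ[halfLine] fun y => kerK a s t y := by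
  refine (hr.represents_op s _).trans (Filter.Eventually.of_forall fun y => ?_)
  have hm := hr.continuous.measurable
  change inner ℝ (vec a (s + y)) (vec a (s + t)) = kerK a s t y
  rw [inner_eq_integral (hr.decay.coeFn_vec hm _) (hr.decay.coeFn_vec hm _)]
  refine integral_congr_ae (Filter.Eventually.of_forall fun r => ?_)
  simp only
  ring_nf

theorem kerK_comm (a : ℝ → ℝ) (s x y : ℝ) : kerK a s x y = kerK a s y x := by
  simp only [kerK, mul_comm]

/-- `K_s = A_s²` as operators. -/
theorem Regular.isIntegralOperator_kerK (hr : Regular a a' a'') (s : ℝ) :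
    IsIntegralOperator (kerK a s) (op a s * op a s) := fun f => by
  refine (hr.represents_op s (op a s f)).trans (Filter.Eventually.of_forall fun x => ?_)
  change inner ℝ (vec a (s + x)) (op a s f) = _
  rw [← hr.inner_op, inner_eq_integral (hr.op_vec s x) (Filter.EventuallyEq.refl _ f)]

theorem Regular.integralOperator_kerK (hr : Regular a a' a'') (s : ℝ) :
    integralOperator (kerK a s) = op a s * op a s :=
  integralOperator_eq (hr.isIntegralOperator_kerK s)

theorem Regular.integralOperator_kerNegA (hr : Regular a a' a'') (s : ℝ) :
    IsIntegralOperator (kerNegA a s) (-op a s) := fun f => by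
  refine (Lp.coeFn_neg (op a s f)).trans ?_
  filter_upwards [hr.isIntegralOperator s f] with x hx
  rw [Pi.neg_apply, hx, ← integral_neg]
  simp [kerNegA, kerA]

theorem isCompactOperator_smulRight (v : L2) :
    IsCompactOperator ((innerSL ℝ v).smulRight v : L2 →L[ℝ] L2) := by
  have h : IsCompactOperator (innerSL ℝ v : L2 →L[ℝ] ℝ) :=
    isCompactOperator_of_locallyCompactSpace_dom _
  have e : ⇑((innerSL ℝ v).smulRight v : L2 →L[ℝ] L2)
      = ⇑((ContinuousLinearMap.id ℝ ℝ).smulRight v) ∘ ⇑(innerSL ℝ v : L2 →L[ℝ] ℝ) := by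
    funext f; simp
  rw [e]
  exact h.clm_comp _

/-- A closed subspace contains the integrals of continuous functions with values in it. -/
theorem integral_mem_of_isClosed {E : Type*} [NormedAddCommGroup E] [NormedSpace ℝ E]
    [CompleteSpace E] {S : Submodule ℝ E} (hS : IsClosed (S : Set E)) {μ : Measure ℝ} {F : ℝ → E}
    (hF : Continuous F) (hi : Integrable F μ) (h : ∀ x, F x ∈ S) : ∫ x, F x ∂μ ∈ S := by
  have : CompleteSpace S := hS.completeSpace_coe
  let G : ℝ → S := fun x => ⟨F x, h x⟩
  have hG : Continuous G := hF.subtype_mk _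
  have hGi : Integrable G μ := hi.norm.mono' hG.aestronglyMeasurable
    (Filter.Eventually.of_forall fun x => le_rfl)
  rw [show ∫ x, F x ∂μ = ((∫ x, G x ∂μ : S) : E) from S.subtypeL.integral_comp_comm hGi]
  exact (∫ x, G x ∂μ : S).2

/-- `A_s²` is compact, being the Bochner integral of operators of rank one. -/
theorem Regular.isCompactOperator (hr : Regular a a' a'') (s : ℝ) :
    IsCompactOperator (op a s * op a s) := by
  let R : ℝ → L2 →L[ℝ] L2 := fun x => (innerSL ℝ (vec a (s + x))).smulRight (vec a (s + x))
  have hv : Continuous fun x => vec a (s + x) :=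
    (continuous_vec hr.hasDerivAt hr.decay hr.decay').comp (by fun_prop)
  have hR : Continuous R := by fun_prop
  have hRi : Integrable R halfLine := by
    obtain ⟨κ, hκ, hb⟩ := hr.decay.norm_vec_le hr.continuous.measurable
    obtain ⟨C, hC, hb⟩ := hb s
    refine ((integrable_exp_halfLine (κ := 2 * κ) (by positivity)).const_mul
      ((C * Real.exp (-κ * s)) ^ 2)).mono' hR.aestronglyMeasurable
      (ae_halfLine_pos.mono fun x hx => ?_)
    have h1 := hb (s + x) (by linarith)
    simp only [R]
    rw [ContinuousLinearMap.norm_smulRight_apply, innerSL_apply_norm, ← sq]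
    refine (pow_le_pow_left₀ (norm_nonneg _) h1 2).trans_eq ?_
    rw [mul_add, Real.exp_add, ← mul_assoc, mul_pow, sq (Real.exp (-κ * x)), ← Real.exp_add]
    ring_nf
  -- Tested against f and g, the integral is ∫⟨v_x, f⟩⟨v_x, g⟩dx, with v_x the vector at s + x; this
  -- is the inner product of A_s g and A_s f.
  have e2 : ∫ x, R x ∂halfLine = op a s * op a s := by
    refine ContinuousLinearMap.ext fun f => ext_inner_left ℝ fun g => ?_
    rw [ContinuousLinearMap.integral_apply hRi,
      ← integral_inner (hRi.apply_continuousLinearMap f), mul_apply_eq_comp,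
      ← hr.inner_op, inner_eq_integral (hr.represents_op s g) (hr.represents_op s f)]
    refine integral_congr_ae (Filter.Eventually.of_forall fun x => ?_)
    simp [R, real_inner_smul_right, real_inner_comm, mul_comm]
  rw [← e2]
  exact integral_mem_of_isClosed (S := compactOperator (RingHom.id ℝ) L2 L2)
    isClosed_setOfPred_isCompactOperator hR hRi fun x => isCompactOperator_smulRight _

end

/-! ### The `L²` bound coming from the orthogonality relation -/

theorem inner_toLp {μ : Measure ℝ} {f g : ℝ → ℝ} (hf : MemLp f 2 μ) (hg : MemLp g 2 μ) :
    inner ℝ (hf.toLp f) (hg.toLp g) = ∫ y, f y * g y ∂μ := by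
  rw [L2.inner_def]
  refine integral_congr_ae ?_
  filter_upwards [hf.coeFn_toLp, hg.coeFn_toLp] with y h1 h2
  simp [h1, h2, mul_comm]

theorem norm_toLp_sq {μ : Measure ℝ} {f : ℝ → ℝ} (hf : MemLp f 2 μ) :
    ‖hf.toLp f‖ ^ 2 = ∫ y, f y * f y ∂μ := by
  rw [← inner_toLp hf hf, real_inner_self_eq_norm_sq]

theorem ExpDecay.sq {f : ℝ → ℝ} (h : ExpDecay f) : ExpDecay fun x => f x ^ 2 := by
  obtain ⟨κ, hκ, h⟩ := h
  refine ⟨2 * κ, by positivity, fun a => ?_⟩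
  obtain ⟨C, hC, h⟩ := h a
  refine ⟨C ^ 2, by positivity, fun x hx => ?_⟩
  rw [abs_pow]
  refine (pow_le_pow_left₀ (abs_nonneg _) (h x hx) 2).trans_eq ?_
  rw [mul_pow, ← Real.exp_nat_mul]
  push_cast
  ring_nf

theorem ExpDecay.memLp_indicator {f : ℝ → ℝ} (h : ExpDecay f) (hm : Measurable f) (x c : ℝ) :
    MemLp ((Ioi c).indicator fun y => f (x + y)) 2 volume := by
  have hm' : Measurable fun y => f (x + y) := hm.comp (by fun_prop)
  rw [memLp_indicator_iff_restrict measurableSet_Ioi,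
    memLp_two_iff_integrable_sq hm'.aestronglyMeasurable]
  have := (integrableOn_Ioi_comp_add (a := c) (c := x)).2 (h.sq.integrableOn (hm.pow_const 2) _)
  simp only [add_comm x]
  exact this

/-- Multiplying a smooth approximation by a smooth step that is 1 on (s, ∞) does not increase its
distance to F, which vanishes elsewhere. The left bound on the supports is needed because A is
controlled only on right half-lines. -/
theorem exists_smooth_approx {F : ℝ → ℝ} (hF : MemLp F 2 volume) {s : ℝ}
    (hs : ∀ y, y ≤ s → F y = 0) {ε : ℝ} (hε : 0 < ε) :
    ∃ ψ : ℝ → ℝ, ContDiff ℝ ∞ ψ ∧ HasCompactSupport ψ ∧ (∀ y, y ≤ s - 1 → ψ y = 0) ∧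
      eLpNorm (ψ - F) 2 volume ≤ ENNReal.ofReal ε := by
  obtain ⟨φ, h1, h2, h3⟩ := hF.exist_eLpNorm_sub_le (by norm_num) (by norm_num) hε
  let χ : ℝ → ℝ := fun y => Real.smoothTransition (y - s + 1)
  have hχ : ContDiff ℝ ∞ χ := Real.smoothTransition.contDiff.comp (by fun_prop)
  refine ⟨χ * φ, hχ.mul h2, h1.mul_left, fun y hy => ?_, (eLpNorm_mono fun y => ?_).trans h3⟩
  · simp [χ, Real.smoothTransition.zero_of_nonpos (show y - s + 1 ≤ 0 by linarith)]
  · have hF' : F y = χ y * F y := by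
      rcases le_or_gt y s with h | h
      · simp [hs y h]
      · simp [χ, Real.smoothTransition.one_of_one_le (show 1 ≤ y - s + 1 by linarith)]
    have e : (χ * φ - F) y = χ y * -((F - φ) y) := by
      rw [Pi.sub_apply, Pi.sub_apply, Pi.mul_apply]
      nth_rewrite 1 [hF']
      ring
    rw [e, norm_mul, norm_neg]
    refine mul_le_of_le_one_left (norm_nonneg _) ?_
    rw [Real.norm_eq_abs, abs_of_nonneg (Real.smoothTransition.nonneg _)]
    exact Real.smoothTransition.le_one _

theorem eLpNorm_two_eq {f : ℝ → ℝ} (hf : MemLp f 2 volume) :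
    eLpNorm f 2 volume = ENNReal.ofReal ‖hf.toLp f‖ := by
  rw [Lp.norm_toLp, ENNReal.ofReal_toReal hf.eLpNorm_ne_top]

section

variable {γ : ℝ} {A : ℝ → ℝ}

/-- The orthogonality relation extends, as an inequality, to square integrable functions that
vanish on a left half-line. -/
theorem Admissible.memLp_lineTransform (hA : Admissible γ A) (hγ : 0 ≤ γ) {F : ℝ → ℝ}
    (hF : MemLp F 2 volume) {s : ℝ} (hs : ∀ y, y ≤ s → F y = 0)
    (hm : AEStronglyMeasurable (lineTransform A F) volume) :
    ∃ h : MemLp (lineTransform A F) 2 volume, ‖h.toLp‖ ^ 2 ≤ γ * ‖hF.toLp F‖ ^ 2 := by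
  choose ψ h1 h2 h3 h4 using fun n : ℕ =>
    exists_smooth_approx hF hs (ε := 1 / ((n : ℝ) + 1)) (by positivity)
  have hψ : ∀ n, MemLp (ψ n) 2 volume := fun n => (h1 n).continuous.memLp_of_hasCompactSupport (h2 n)
  have hlim : Filter.Tendsto (fun n => (hψ n).toLp (ψ n)) Filter.atTop (nhds (hF.toLp F)) := by
    rw [tendsto_iff_norm_sub_tendsto_zero]
    refine squeeze_zero (fun n => norm_nonneg _) (fun n => ?_)
      (tendsto_one_div_add_atTop_nhds_zero_nat (𝕜 := ℝ))
    rw [← MemLp.toLp_sub, Lp.norm_toLp]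
    exact ENNReal.toReal_le_of_le_ofReal (by positivity) (h4 n)
  have hT : ∀ n, MemLp (lineTransform A (ψ n)) 2 volume := fun n => hA.memLp _ (h1 n) (h2 n)
  have hTn : ∀ n, ‖(hT n).toLp‖ = Real.sqrt (γ * ‖(hψ n).toLp (ψ n)‖ ^ 2) := fun n => by
    rw [norm_toLp_sq, ← hA.orthogonal _ _ (h1 n) (h2 n) (h1 n) (h2 n), ← norm_toLp_sq (hT n),
      Real.sqrt_sq (norm_nonneg _)]
  -- All supports lie to the right of s - 1, where A(x + ·) is square integrable, so convergence in
  -- L² gives convergence of the transforms at every point.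
  have hpt : ∀ x, Filter.Tendsto (fun n => lineTransform A (ψ n) x) Filter.atTop
      (nhds (lineTransform A F x)) := fun x => by
    have hw := hA.expDecay.memLp_indicator hA.smooth.continuous.measurable x (s - 1)
    have e : ∀ {φ : ℝ → ℝ} (hφ : MemLp φ 2 volume), (∀ y, y ≤ s - 1 → φ y = 0) →
        lineTransform A φ x = inner ℝ (hw.toLp _) (hφ.toLp φ) := fun {φ} hφ h0 => by
      rw [inner_toLp, lineTransform]
      congr 1
      ext y
      rcases le_or_gt y (s - 1) with h | h
      · simp [h0 y h]
      · rw [indicator_of_mem (mem_Ioi.2 h)]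
    rw [e hF fun y hy => hs y (by linarith)]
    simp only [e (hψ _) (h3 _)]
    exact tendsto_const_nhds.inner hlim
  -- Fatou's lemma; it gives only an inequality, which is all that is needed.
  have hle := Lp.eLpNorm_lim_le_liminf_eLpNorm (p := 2) (μ := volume)
    (fun n => (hT n).aestronglyMeasurable) (lineTransform A F) (Filter.Eventually.of_forall hpt)
  have hlim2 : Filter.Tendsto (fun n => eLpNorm (lineTransform A (ψ n)) 2 volume) Filter.atTop
      (nhds (ENNReal.ofReal (Real.sqrt (γ * ‖hF.toLp F‖ ^ 2)))) := by
    simp only [fun n => eLpNorm_two_eq (hT n), hTn]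
    refine ENNReal.tendsto_ofReal ?_
    exact (Real.continuous_sqrt.tendsto _).comp ((hlim.norm.pow 2).const_mul γ)
  rw [hlim2.liminf_eq] at hle
  have hmem : MemLp (lineTransform A F) 2 volume := ⟨hm, hle.trans_lt ENNReal.ofReal_lt_top⟩
  refine ⟨hmem, ?_⟩
  rw [eLpNorm_two_eq hmem, ENNReal.ofReal_le_ofReal_iff (Real.sqrt_nonneg _)] at hle
  exact (pow_le_pow_left₀ (norm_nonneg _) hle 2).trans_eq (Real.sq_sqrt (by positivity))

/-- The bound on `L²(ℝ₊)`: extending `A_s f` to the whole line costs no norm. -/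
theorem Admissible.integral_sq_le (hA : Admissible γ A) (hγ : 0 ≤ γ) (s : ℝ) (f : L2) :
    Integrable (fun x => inner ℝ (vec A (s + x)) f ^ 2) ∧
    ∫ x, inner ℝ (vec A (s + x)) f ^ 2 ≤ γ * ‖f‖ ^ 2 := by
  have hr := hA.regular
  let F0 : ℝ → ℝ := (Ioi 0).indicator f
  have hF0 : MemLp F0 2 volume := (memLp_indicator_iff_restrict measurableSet_Ioi).2 (Lp.memLp f)
  have hmp : MeasurePreserving (fun y : ℝ => y - s) volume volume :=
    measurePreserving_sub_right volume s
  have hF : MemLp (F0 ∘ fun y => y - s) 2 volume := hF0.comp_measurePreserving hmp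
  have hFn : ‖hF.toLp‖ ^ 2 = ‖f‖ ^ 2 := by
    rw [norm_toLp_sq, ← real_inner_self_eq_norm_sq f,
      inner_eq_integral (Filter.EventuallyEq.refl _ f) (Filter.EventuallyEq.refl _ f)]
    refine (hmp.integral_comp (measurableEmbedding_subRight s) (fun y => F0 y * F0 y)).trans ?_
    rw [← integral_indicator measurableSet_Ioi]
    congr 1
    ext y
    by_cases hy : y ∈ Ioi (0 : ℝ) <;> simp [F0, hy]
  have hG : lineTransform A (F0 ∘ fun y => y - s) = fun x => inner ℝ (vec A (s + x)) f := by
    ext x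
    rw [inner_eq_integral (hr.decay.coeFn_vec hr.continuous.measurable _)
      (Filter.EventuallyEq.refl _ f), lineTransform,
      ← integral_indicator measurableSet_Ioi,
      ← hmp.integral_comp (measurableEmbedding_subRight s)
        ((Ioi (0 : ℝ)).indicator fun y => A (y + (s + x)) * f y)]
    congr 1
    ext y
    by_cases hy : y - s ∈ Ioi (0 : ℝ)
    · simp only [F0, Function.comp, indicator_of_mem hy]
      congr 2
      ring
    · simp only [F0, Function.comp, indicator_of_notMem hy, mul_zero]
  have hcont : Continuous fun x => inner ℝ (vec A (s + x)) f := by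
    have := (continuous_vec hr.hasDerivAt hr.decay hr.decay').comp (by fun_prop :
      Continuous fun x : ℝ => s + x)
    exact this.inner continuous_const
  obtain ⟨h1, h2⟩ := hA.memLp_lineTransform hγ hF (s := s)
    (fun y hy => indicator_of_notMem (by simpa using hy) _)
    (by rw [hG]; exact hcont.aestronglyMeasurable)
  rw [hFn, norm_toLp_sq] at h2
  rw [hG] at h1
  simp only [hG, ← sq] at h2
  exact ⟨(memLp_two_iff_integrable_sq h1.1).1 h1, h2⟩

/-- The extension of `A_s f` to the line vanishes on the left half-line if `A_s² f = f`. -/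
theorem Admissible.inner_vec_eq_zero_of_neg (hA : Admissible γ A) (hγ : γ ∈ Icc (0 : ℝ) 1) (s : ℝ)
    {f : L2} (hf : op A s (op A s f) = f) {x : ℝ} (hx : x < 0) :
    inner ℝ (vec A (s + x)) f = 0 := by
  have hr := hA.regular
  obtain ⟨hi, hle⟩ := hA.integral_sq_le hγ.1 s f
  have h1 : ∫ x in Ioi 0, inner ℝ (vec A (s + x)) f ^ 2 = ‖f‖ ^ 2 := by
    have : inner ℝ (op A s f) (op A s f) = ‖f‖ ^ 2 := by
      rw [hr.inner_op, hf, real_inner_self_eq_norm_sq]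
    rw [← this, inner_eq_integral (hr.represents_op s f) (hr.represents_op s f)]
    simp only [sq]
  have h2 := integral_add_compl (measurableSet_Ioi (a := (0 : ℝ))) hi
  rw [h1, compl_Ioi] at h2
  -- The right half-line already carries ‖f‖², at least the total allowed, so nothing is left for
  -- the left half-line.
  have h3 : ∫ x in Iic 0, inner ℝ (vec A (s + x)) f ^ 2 = 0 := by
    refine le_antisymm ?_ (integral_nonneg fun x => sq_nonneg _)
    nlinarith [hγ.2, sq_nonneg ‖f‖]
  rw [integral_eq_zero_iff_of_nonneg (fun x => sq_nonneg _) hi.integrableOn] at h3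
  have hcont : Continuous fun x => inner ℝ (vec A (s + x)) f := by
    have := (continuous_vec hr.hasDerivAt hr.decay hr.decay').comp (by fun_prop :
      Continuous fun x : ℝ => s + x)
    exact this.inner continuous_const
  have h4 := Measure.eqOn_open_of_ae_eq (ae_restrict_of_ae_restrict_of_subset Iio_subset_Iic_self h3)
    isOpen_Iio (hcont.pow 2).continuousOn continuousOn_const hx
  simpa using h4

/-- The integral of A(x+y+s) against a decaying function extends holomorphically in x to a
half-strip around (-1, ∞). It vanishes on (-1, 0), hence everywhere by the identity theorem. -/
theorem Admissible.inner_vec_eq_zero (hA : Admissible γ A) (s : ℝ) {f : L2} {f' : ℝ → ℝ}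
    (hff' : f =ᵐ[halfLine] f') (hc : Continuous f') {C κ : ℝ} (hκ : 0 < κ)
    (hb : ∀ y, 0 < y → |f' y| ≤ C * Real.exp (-κ * y))
    (h0 : ∀ x, x < 0 → inner ℝ (vec A (s + x)) f = 0) {x : ℝ} (hx : 0 < x) :
    inner ℝ (vec A (s + x)) f = 0 := by
  have hr := hA.regular
  -- The arguments z + y + s have real part above s - 1; one further unit is the margin for Cauchy's
  -- estimate. The width of the strip is halved for the same reason.
  obtain ⟨η, hη, F, hF, ⟨M, hM⟩, hFA⟩ := hA.analytic (s - 2)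
  have hM0 : 0 ≤ M := (norm_nonneg _).trans (hM s (by simp) (by simpa using hη))
  let U : Set ℂ := {z | (-1 : ℝ) < z.re ∧ |z.im| < η / 2}
  have hU : IsOpen U := isOpen_halfStrip _ _
  let S : Set ℂ := {z | s - 2 < z.re ∧ |z.im| < η}
  have hS : IsOpen S := isOpen_halfStrip _ _
  have hmem : ∀ z ∈ U, ∀ y : ℝ, 0 < y → s - 1 < (z + y + s).re ∧ |(z + y + s).im| < η / 2 := by
    rintro z ⟨h1, h2⟩ y hy
    constructor
    · simp; linarith
    · simpa using h2
  have hmemS : ∀ z ∈ U, ∀ y : ℝ, 0 < y → z + y + s ∈ S := fun z hz y hy =>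
    ⟨by linarith [(hmem z hz y hy).1], by linarith [(hmem z hz y hy).2]⟩
  let H : ℂ → ℂ := fun z => ∫ y, F (z + y + s) * (f' y : ℂ) ∂halfLine
  have hmeas : ∀ G : ℂ → ℂ, ContinuousOn G S → ∀ z ∈ U,
      AEStronglyMeasurable (fun y : ℝ => G (z + y + s) * (f' y : ℂ)) halfLine := by
    intro G hG z hz
    refine ContinuousOn.aestronglyMeasurable (ContinuousOn.mul ?_ (by fun_prop)) measurableSet_Ioi
    exact hG.comp (by fun_prop) fun y hy => hmemS z hz y hy
  have hbound : ∀ (G : ℂ → ℂ) (B : ℝ), 0 ≤ B → (∀ z ∈ U, ∀ y : ℝ, 0 < y → ‖G (z + y + s)‖ ≤ B) →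
      ∀ y : ℝ, 0 < y → ∀ z ∈ U, ‖G (z + y + s) * (f' y : ℂ)‖ ≤ B * (C * Real.exp (-κ * y)) := by
    intro G B hB hG y hy z hz
    rw [norm_mul, Complex.norm_real]
    exact mul_le_mul (hG z hz y hy) (hb y hy) (norm_nonneg _) hB
  have hei : ∀ B : ℝ, Integrable (fun y => B * (C * Real.exp (-κ * y))) halfLine := fun B =>
    ((integrable_exp_halfLine hκ).const_mul C).const_mul B
  set M' := M / (min 1 (η / 2) / 2) with hM'
  have hM'0 : 0 ≤ M' := by positivity
  have hFb := hbound F M hM0 fun z hz y hy => hM _ (hmemS z hz y hy).1 (hmemS z hz y hy).2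
  have hF'b := hbound (deriv F) M' hM'0 fun z hz y hy =>
    norm_deriv_le_halfStrip hη hF hM (by linarith [(hmem z hz y hy).1]) (hmem z hz y hy).2
  -- Differentiation under the integral sign: F and F' are bounded on the strip, and the decay of f'
  -- makes both majorants integrable.
  have hH : DifferentiableOn ℂ H U := by
    intro z hz
    have := hasDerivAt_integral_of_dominated_loc_of_deriv_le (μ := halfLine)
      (F := fun z (y : ℝ) => F (z + y + s) * (f' y : ℂ))
      (F' := fun z (y : ℝ) => deriv F (z + y + s) * (f' y : ℂ)) (hU.mem_nhds hz)
      (Filter.eventually_of_mem (hU.mem_nhds hz) fun w hw => hmeas F hF.continuousOn w hw)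
      ((hei M).mono' (hmeas F hF.continuousOn z hz)
        (ae_halfLine_pos.mono fun y hy => hFb y hy z hz))
      (hmeas (deriv F) (hF.deriv hS).continuousOn z hz)
      (ae_halfLine_pos.mono fun y hy => hF'b y hy) (hei M')
      (ae_halfLine_pos.mono fun y hy w hw => by
        have h1 := (hF.differentiableAt (hS.mem_nhds (hmemS w hw y hy))).hasDerivAt
        have h2 : HasDerivAt (fun w : ℂ => w + y + s) 1 w :=
          ((hasDerivAt_id w).add_const _).add_const _
        simpa using (h1.comp w h2).mul_const (f' y : ℂ))
    exact this.2.differentiableAt.differentiableWithinAt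
  have hHreal : ∀ x : ℝ, -1 < x → H x = (inner ℝ (vec A (s + x)) f : ℝ) := by
    intro x hx
    rw [inner_eq_integral (hr.decay.coeFn_vec hr.continuous.measurable _) hff',
      ← integral_complex_ofReal]
    refine integral_congr_ae (ae_halfLine_pos.mono fun y hy => ?_)
    have := hFA (x + y + s) (by linarith)
    push_cast at this ⊢
    rw [this]
    congr 2
    ring_nf
  have hUc : IsPreconnected U := by
    refine Convex.isPreconnected ?_
    have e : U = Complex.re ⁻¹' Ioi (-1) ∩ Complex.im ⁻¹' Ioo (-(η / 2)) (η / 2) := by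
      ext z; simp [U, abs_lt]
    rw [e]
    exact ((convex_Ioi _).linear_preimage Complex.reLm).inter
      ((convex_Ioo _ _).linear_preimage Complex.imLm)
  have hz0 : ((-1 / 2 : ℝ) : ℂ) ∈ U := ⟨by norm_num, by simpa using hη⟩
  have hfreq : ∃ᶠ z in nhdsWithin ((-1 / 2 : ℝ) : ℂ) {((-1 / 2 : ℝ) : ℂ)}ᶜ, H z = 0 := by
    have ht : Filter.Tendsto (fun t : ℝ => (t : ℂ)) (nhdsWithin (-1 / 2) {(-1 / 2 : ℝ)}ᶜ)
        (nhdsWithin ((-1 / 2 : ℝ) : ℂ) {((-1 / 2 : ℝ) : ℂ)}ᶜ) := by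
      refine tendsto_nhdsWithin_iff.2 ⟨(Complex.continuous_ofReal.tendsto _).mono_left
        nhdsWithin_le_nhds, ?_⟩
      filter_upwards [self_mem_nhdsWithin] with t ht
      exact fun h => ht (Complex.ofReal_injective h)
    refine ht.frequently (Filter.Eventually.frequently ?_)
    have : Ioo (-1 : ℝ) 0 ∈ nhds (-1 / 2 : ℝ) := Ioo_mem_nhds (by norm_num) (by norm_num)
    filter_upwards [mem_nhdsWithin_of_mem_nhds this] with t ht
    rw [hHreal t ht.1, h0 t ht.2, Complex.ofReal_zero]
  have hz := (hH.analyticOnNhd hU).eqOn_zero_of_preconnected_of_frequently_eq_zero hUc hz0 hfreq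
    (show (x : ℂ) ∈ U from ⟨by simp; linarith, by simpa using hη⟩)
  rw [hHreal x (by linarith)] at hz
  simpa using hz

/-- The equation f = A_s(A_s f) itself supplies a continuous, exponentially decaying representative
of f, as the continuation argument requires. -/
theorem Admissible.eq_zero_of_op_op_eq (hA : Admissible γ A) (hγ : γ ∈ Icc (0 : ℝ) 1) (s : ℝ)
    {f : L2} (hf : op A s (op A s f) = f) : f = 0 := by
  have hr := hA.regular
  obtain ⟨κ, hκ, hb⟩ := hr.decay.norm_vec_le hr.continuous.measurable
  obtain ⟨C, hC, hb⟩ := hb s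
  have hcont : Continuous fun x => inner ℝ (vec A (s + x)) (op A s f) := by
    have := (continuous_vec hr.hasDerivAt hr.decay hr.decay').comp (by fun_prop :
      Continuous fun x : ℝ => s + x)
    exact this.inner continuous_const
  have hrep : f =ᵐ[halfLine] fun x => inner ℝ (vec A (s + x)) (op A s f) := by
    have := hr.represents_op s (op A s f)
    rwa [hf] at this
  have hdec : ∀ y, 0 < y → |inner ℝ (vec A (s + y)) (op A s f)|
      ≤ C * Real.exp (-κ * s) * ‖op A s f‖ * Real.exp (-κ * y) := fun y hy => by
    refine (abs_real_inner_le_norm _ _).trans ?_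
    have := hb (s + y) (by linarith)
    rw [mul_add, Real.exp_add] at this
    nlinarith [norm_nonneg (op A s f)]
  have hz : op A s f = 0 := by
    refine Lp.ext ((hr.represents_op s f).trans ?_)
    filter_upwards [ae_halfLine_pos, Lp.coeFn_zero ℝ 2 halfLine] with x hx hx0
    rw [hx0]
    exact hA.inner_vec_eq_zero s hrep hcont hκ hdec
      (fun x hx => hA.inner_vec_eq_zero_of_neg hγ s hf hx) hx
  rw [← hf, hz, map_zero]

/-- `I - A_s²` is invertible. -/
theorem Admissible.isUnit_one_sub_sq (hA : Admissible γ A) (hγ : γ ∈ Icc (0 : ℝ) 1) (s : ℝ) :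
    IsUnit (1 - op A s * op A s) := by
  -- Fredholm alternative at the spectral value 1.
  rcases (hA.regular.isCompactOperator s).hasEigenvalue_or_mem_resolventSet one_ne_zero with h | h
  · obtain ⟨f, hf⟩ := h.exists_hasEigenvector
    have h1 : op A s (op A s f) = f := by simpa using hf.apply_eq_smul
    exact absurd (hA.eq_zero_of_op_op_eq hγ s h1) hf.2
  · simpa using spectrum.mem_resolventSet_iff.1 h

theorem Admissible.isUnit_one_sub_and_one_add (hA : Admissible γ A) (hγ : γ ∈ Icc (0 : ℝ) 1)
    (s : ℝ) : IsUnit (1 - op A s) ∧ IsUnit (1 + op A s) := by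
  have hc : Commute (1 - op A s) (1 + op A s) :=
    ((Commute.one_left _).sub_left ((Commute.one_right _).add_right (Commute.refl _)))
  rw [← hc.isUnit_mul_iff]
  convert hA.isUnit_one_sub_sq hγ s using 1
  noncomm_ring

end

/-! ### The resolvent of `A_s²` and its derivative in `s` -/

/-- `(I - A_s²)⁻¹`. -/
def resolventSq (a : ℝ → ℝ) (s : ℝ) : L2 →L[ℝ] L2 := Ring.inverse (1 - op a s * op a s)

/-- `(I - A_s²)⁻¹ A_s|δ⟩`. -/
def evenVec (a : ℝ → ℝ) (s : ℝ) : L2 := resolventSq a s (vec a s)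

/-- `A_s (I - A_s²)⁻¹ A_s|δ⟩`. -/
def oddVec (a : ℝ → ℝ) (s : ℝ) : L2 := op a s (evenVec a s)

/-- `⟨δ|A_s (I - A_s²)⁻¹ A_s|δ⟩`. -/
def squareDensity (a : ℝ → ℝ) (s : ℝ) : ℝ := inner ℝ (vec a s) (evenVec a s)

/-- `⟨δ|A_s (I - A_s²)⁻¹|δ⟩`. -/
def potential (a : ℝ → ℝ) (s : ℝ) : ℝ := a s + inner ℝ (vec a s) (oddVec a s)

section

variable {a a' a'' : ℝ → ℝ}

theorem evenVec_eq {s : ℝ} (hu : IsUnit (1 - op a s * op a s)) :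
    evenVec a s = vec a s + op a s (oddVec a s) := by
  have h := congrArg (fun T : L2 →L[ℝ] L2 => T (vec a s)) (Ring.mul_inverse_cancel _ hu)
  simp only [mul_apply_eq_comp, sub_apply, one_apply_eq_self] at h
  exact sub_eq_iff_eq_add.1 h

theorem inner_resolventSq (hr : Regular a a' a'') {s : ℝ} (hu : IsUnit (1 - op a s * op a s))
    (f g : L2) : inner ℝ (resolventSq a s f) g = inner ℝ f (resolventSq a s g) := by
  have h1 : ∀ f, resolventSq a s f - op a s (op a s (resolventSq a s f)) = f := fun f => by
    have h := congrArg (fun T : L2 →L[ℝ] L2 => T f) (Ring.mul_inverse_cancel _ hu)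
    simp only [mul_apply_eq_comp, sub_apply, one_apply_eq_self] at h
    exact h
  conv_lhs => rw [← h1 g]
  conv_rhs => rw [← h1 f]
  simp only [inner_sub_left, inner_sub_right, hr.inner_op]

theorem hasDerivAt_resolventSq (hr : Regular a a' a'') {s : ℝ}
    (hu : IsUnit (1 - op a s * op a s)) :
    HasDerivAt (resolventSq a)
      (resolventSq a s * (op a' s * op a s + op a s * op a' s) * resolventSq a s) s := by
  obtain ⟨u, hu'⟩ := hu
  have h1 : HasDerivAt (fun s => 1 - op a s * op a s)
      (-(op a' s * op a s + op a s * op a' s)) s :=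
    ((hasDerivAt_op hr s).mul (hasDerivAt_op hr s)).const_sub 1
  have h2 := hasFDerivAt_ringInverse (𝕜 := ℝ) u
  rw [hu'] at h2
  have h3 := h2.comp_hasDerivAt s h1
  refine h3.congr_deriv ?_
  rw [resolventSq, ← hu', Ring.inverse_unit]
  simp only [neg_apply, ContinuousLinearMap.mulLeftRight_apply]
  noncomm_ring

/-! ### Boundary terms of integration by parts on the half-line. -/

theorem integral_Ioi_mul_deriv {g g' : ℝ → ℝ} (hg : ∀ x, HasDerivAt g (g' x) x)
    (hi : Integrable (fun x => g x * g' x) halfLine)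
    (h0 : Filter.Tendsto g Filter.atTop (nhds 0)) :
    ∫ x, g x * g' x ∂halfLine = -(1 / 2) * g 0 ^ 2 := by
  have h := integral_Ioi_of_hasDerivAt_of_tendsto' (a := 0) (f := fun x => 1 / 2 * g x ^ 2)
    (f' := fun x => g x * g' x) (m := 1 / 2 * 0 ^ 2)
    (fun x _ => (((hg x).pow 2).const_mul (1 / 2)).congr_deriv (by simp; ring)) hi
    ((h0.pow 2).const_mul _)
  rw [h]; ring

theorem vec_ae (hr : Regular a a' a'') (s : ℝ) : vec a s =ᵐ[halfLine] fun y => a (y + s) :=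
  hr.decay.coeFn_vec hr.continuous.measurable s

theorem vec_ae' (hr : Regular a a' a'') (s : ℝ) : vec a' s =ᵐ[halfLine] fun y => a' (y + s) :=
  hr.decay'.coeFn_vec hr.continuous'.measurable s

theorem Regular.hasDerivAt_shift (hr : Regular a a' a'') (s x : ℝ) :
    HasDerivAt (fun y => a (y + s)) (a' (x + s)) x := (hr.hasDerivAt (x + s)).comp_add_const x s

theorem Regular.tendsto_shift (hr : Regular a a' a'') (s : ℝ) :
    Filter.Tendsto (fun y => a (y + s)) Filter.atTop (nhds 0) :=
  hr.decay.tendsto_zero.comp (Filter.tendsto_atTop_add_const_right _ s Filter.tendsto_id)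

theorem inner_vec_vec_deriv (hr : Regular a a' a'') (s : ℝ) :
    inner ℝ (vec a s) (vec a' s) = -(1 / 2) * a s ^ 2 := by
  rw [inner_eq_integral (vec_ae hr s) (vec_ae' hr s)]
  have := integral_Ioi_mul_deriv (hr.hasDerivAt_shift s)
    (integrable_mul_L2 (vec_ae hr s) (vec_ae' hr s)) (hr.tendsto_shift s)
  simpa using this

theorem expDecay_norm_vec (hr : Regular a a' a'') : ExpDecay fun t => ‖vec a t‖ := by
  simpa only [ExpDecay, abs_norm] using hr.decay.norm_vec_le hr.continuous.measurable

theorem expDecay_norm_op (hr : Regular a a' a'') : ExpDecay fun t => ‖op a t‖ := by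
  simpa only [ExpDecay, abs_norm] using norm_op_le hr

theorem tendsto_inner_vec (hr : Regular a a' a'') (s : ℝ) (f : L2) :
    Filter.Tendsto (fun x => inner ℝ (vec a (s + x)) f) Filter.atTop (nhds 0) := by
  have h1 := ((expDecay_norm_vec hr).tendsto_zero.comp
    (Filter.tendsto_atTop_add_const_left _ s Filter.tendsto_id)).mul_const ‖f‖
  rw [zero_mul] at h1
  exact squeeze_zero_norm (fun x => abs_real_inner_le_norm _ _) h1

/-- The kernel a'(x+y+s) is also the x-derivative of a(x+y+s). The integrand is therefore half the
derivative of a square, and only the value at x = 0 survives. -/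
theorem inner_op_op_deriv (hr : Regular a a' a'') (s : ℝ) (f : L2) :
    inner ℝ (op a s f) (op a' s f) = -(1 / 2) * inner ℝ (vec a s) f ^ 2 := by
  have hd : ∀ x, HasDerivAt (fun x => inner ℝ (vec a (s + x)) f)
      (inner ℝ (vec a' (s + x)) f) x := fun x => by
    have h := ((hasDerivAt_vec hr (s + x)).comp_const_add s x).inner ℝ (hasDerivAt_const x f)
    simpa using h
  rw [inner_eq_integral (hr.represents_op s f) (hr.represents_op' s f)]
  have := integral_Ioi_mul_deriv hd
    (integrable_mul_L2 (hr.represents_op s f) (hr.represents_op' s f)) (tendsto_inner_vec hr s f)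
  simpa using this

/-- The two terms are the halves of the derivative in y of a(y+s+x)a(y+s); the boundary value at y =
0 remains. -/
theorem op_vec_deriv_add (hr : Regular a a' a'') (s : ℝ) :
    op a s (vec a' s) + op a' s (vec a s) = -(a s) • vec a s := by
  refine Lp.ext ?_
  filter_upwards [Lp.coeFn_add (op a s (vec a' s)) (op a' s (vec a s)),
    Lp.coeFn_smul (-(a s)) (vec a s), hr.represents_op s (vec a' s), hr.represents_op' s (vec a s),
    vec_ae hr s] with x h1 h2 h3 h4 h5
  rw [h1, h2, Pi.add_apply, Pi.smul_apply, h3, h4, h5,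
    inner_eq_integral (vec_ae hr (s + x)) (vec_ae' hr s),
    inner_eq_integral (vec_ae' hr (s + x)) (vec_ae hr s)]
  have i1 := integrable_mul_L2 (vec_ae hr (s + x)) (vec_ae' hr s)
  have i2 := integrable_mul_L2 (vec_ae' hr (s + x)) (vec_ae hr s)
  have h := integral_Ioi_of_hasDerivAt_of_tendsto' (a := 0)
    (f := fun y => a (y + (s + x)) * a (y + s)) (m := 0 * 0)
    (fun y _ => (hr.hasDerivAt_shift (s + x) y).mul (hr.hasDerivAt_shift s y)) (i2.add i1)
    ((hr.tendsto_shift _).mul (hr.tendsto_shift _))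
  rw [← integral_add i1 i2]
  simp only [zero_add, mul_zero, zero_sub] at h
  simp only [smul_eq_mul]
  rw [add_comm x s, neg_mul, mul_comm (a s), ← h]
  congr 1
  ext y
  ring

/-- `(log Det(I - K_s))'' = -q₀²`. -/
theorem hasDerivAt_squareDensity (hr : Regular a a' a'') {s : ℝ}
    (hu : IsUnit (1 - op a s * op a s)) :
    HasDerivAt (squareDensity a) (-(potential a s) ^ 2) s := by
  have h1 : HasDerivAt (evenVec a) (resolventSq a s (op a' s (op a s (evenVec a s))
      + op a s (op a' s (evenVec a s))) + resolventSq a s (vec a' s)) s := by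
    refine ((hasDerivAt_resolventSq hr hu).clm_apply (hasDerivAt_vec hr s)).congr_deriv ?_
    simp [mul_apply_eq_comp, evenVec]
  have h2 := (hasDerivAt_vec hr s).inner ℝ h1
  refine h2.congr_deriv ?_
  rw [inner_add_right, ← inner_resolventSq hr hu, ← inner_resolventSq hr hu, inner_add_right]
  change inner ℝ (evenVec a s) (op a' s (oddVec a s)) + inner ℝ (evenVec a s) (op a s (op a' s (evenVec a s)))
    + inner ℝ (evenVec a s) (vec a' s) + inner ℝ (vec a' s) (evenVec a s) = _
  have e1 : inner ℝ (evenVec a s) (op a' s (oddVec a s))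
      = inner ℝ (op a' s (evenVec a s)) (oddVec a s) := (hr.inner_op' _ _ _).symm
  have e2 : inner ℝ (evenVec a s) (op a s (op a' s (evenVec a s)))
      = inner ℝ (op a' s (evenVec a s)) (oddVec a s) := by
    rw [← hr.inner_op, real_inner_comm]; rfl
  have e3 : inner ℝ (evenVec a s) (vec a' s) = inner ℝ (vec a' s) (evenVec a s) :=
    real_inner_comm _ _
  -- By symmetry the derivative is 2⟨v', e⟩ + 2⟨A'e, o⟩, with v' = `vec a' s` and A' = `op a' s`.
  -- Inserting e = v + A_s o and the boundary identities, ⟨v', e⟩ produces -⟨A'e, o⟩ and minus half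
  -- the square of a(s) + ⟨v, o⟩.
  have e4 : inner ℝ (vec a' s) (evenVec a s)
      = -(1 / 2) * a s ^ 2 + inner ℝ (op a s (vec a' s)) (oddVec a s) := by
    rw [evenVec_eq hu, inner_add_right, real_inner_comm, inner_vec_vec_deriv hr, hr.inner_op]
  have e5 : inner ℝ (op a s (vec a' s)) (oddVec a s) = -(a s) * inner ℝ (vec a s) (oddVec a s)
      - inner ℝ (op a' s (vec a s)) (oddVec a s) := by
    rw [eq_sub_of_add_eq (op_vec_deriv_add hr s), inner_sub_left, real_inner_smul_left]
  have e6 : inner ℝ (op a' s (vec a s)) (oddVec a s)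
      = inner ℝ (op a' s (evenVec a s)) (oddVec a s)
        - inner ℝ (op a' s (op a s (oddVec a s))) (oddVec a s) := by
    rw [← inner_sub_left, ← map_sub, eq_sub_of_add_eq (evenVec_eq hu).symm]
  have e7 : inner ℝ (op a' s (op a s (oddVec a s))) (oddVec a s)
      = -(1 / 2) * inner ℝ (vec a s) (oddVec a s) ^ 2 := by
    rw [hr.inner_op', inner_op_op_deriv hr]
  rw [e1, e2, e3, e4, e5, e6, e7, potential]
  ring

/-! ### Decay in `s` -/

theorem ExpDecay.of_abs_le {f g : ℝ → ℝ} (h : ExpDecay f) (hg : ∀ x, |g x| ≤ |f x|) :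
    ExpDecay g := by
  obtain ⟨κ, hκ, h⟩ := h
  refine ⟨κ, hκ, fun a => ?_⟩
  obtain ⟨C, hC, h⟩ := h a
  exact ⟨C, hC, fun x hx => (hg x).trans (h x hx)⟩

theorem ExpDecay.mul_bounded {f g : ℝ → ℝ} (h : ExpDecay f)
    (hg : ∀ a, ∃ M, ∀ x, a ≤ x → |g x| ≤ M) : ExpDecay fun x => f x * g x := by
  obtain ⟨κ, hκ, h⟩ := h
  refine ⟨κ, hκ, fun a => ?_⟩
  obtain ⟨C, hC, h⟩ := h a
  obtain ⟨M, hM⟩ := hg a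
  have hM0 : 0 ≤ M := (abs_nonneg _).trans (hM a le_rfl)
  refine ⟨C * M, by positivity, fun x hx => ?_⟩
  rw [abs_mul]
  refine (mul_le_mul (h x hx) (hM x hx) (abs_nonneg _) (by positivity)).trans_eq ?_
  ring

theorem ExpDecay.bounded {f : ℝ → ℝ} (h : ExpDecay f) (a : ℝ) :
    ∃ M, ∀ x, a ≤ x → |f x| ≤ M := by
  obtain ⟨κ, hκ, h⟩ := h
  obtain ⟨C, hC, h⟩ := h a
  refine ⟨C * Real.exp (-κ * a), fun x hx => (h x hx).trans ?_⟩
  exact mul_le_mul_of_nonneg_left (Real.exp_le_exp.2 (by nlinarith)) hC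

theorem ExpDecay.add {f g : ℝ → ℝ} (hf : ExpDecay f) (hg : ExpDecay g) :
    ExpDecay fun x => f x + g x := by
  obtain ⟨κ, hκ, hf⟩ := hf
  obtain ⟨κ', hκ', hg⟩ := hg
  refine ⟨min κ κ', by positivity, fun a => ?_⟩
  obtain ⟨C, hC, hf⟩ := hf a
  obtain ⟨C', hC', hg⟩ := hg a
  have key : ∀ (c : ℝ), min κ κ' ≤ c → ∀ x, a ≤ x → Real.exp (-c * x)
      ≤ Real.exp (-(c - min κ κ') * a) * Real.exp (-(min κ κ') * x) := fun c hc x hx => by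
    rw [← Real.exp_add]
    exact Real.exp_le_exp.2 (by nlinarith)
  refine ⟨C * Real.exp (-(κ - min κ κ') * a) + C' * Real.exp (-(κ' - min κ κ') * a),
    by positivity, fun x hx => (abs_add_le _ _).trans ?_⟩
  rw [add_mul, mul_assoc, mul_assoc]
  exact add_le_add
    ((hf x hx).trans (mul_le_mul_of_nonneg_left (key κ (min_le_left _ _) x hx) hC))
    ((hg x hx).trans (mul_le_mul_of_nonneg_left (key κ' (min_le_right _ _) x hx) hC'))

theorem continuous_resolventSq (hr : Regular a a' a'')
    (hu : ∀ s, IsUnit (1 - op a s * op a s)) : Continuous (resolventSq a) :=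
  continuous_iff_continuousAt.2 fun s => (hasDerivAt_resolventSq hr (hu s)).continuousAt

theorem tendsto_resolventSq (hr : Regular a a' a'') :
    Filter.Tendsto (resolventSq a) Filter.atTop (nhds 1) := by
  have h0 : Filter.Tendsto (op a) Filter.atTop (nhds 0) :=
    tendsto_zero_iff_norm_tendsto_zero.2 (expDecay_norm_op hr).tendsto_zero
  have h1 : Filter.Tendsto (fun s => 1 - op a s * op a s) Filter.atTop (nhds 1) := by
    simpa using (h0.mul h0).const_sub 1
  have h2 := NormedRing.inverse_continuousAt (1 : (L2 →L[ℝ] L2)ˣ)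
  have h3 : Filter.Tendsto (fun s => Ring.inverse (1 - op a s * op a s)) Filter.atTop
      (nhds (Ring.inverse ((1 : (L2 →L[ℝ] L2)ˣ) : L2 →L[ℝ] L2))) := h2.tendsto.comp h1
  simp only [Units.val_one, Ring.inverse_one] at h3
  exact h3

/-- The resolvent is continuous in s and tends to the identity at +∞, so a compact interval and a
tail cover everything. -/
theorem norm_resolventSq_bounded (hr : Regular a a' a'')
    (hu : ∀ s, IsUnit (1 - op a s * op a s)) (c : ℝ) :
    ∃ M, ∀ s, c ≤ s → |‖resolventSq a s‖| ≤ M := by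
  have h1 := (tendsto_resolventSq hr).norm.eventually (gt_mem_nhds (lt_add_one _))
  obtain ⟨N, hN⟩ := Filter.eventually_atTop.1 h1
  obtain ⟨B, hB⟩ := isCompact_Icc.exists_bound_of_continuousOn (s := Icc c N)
    (continuous_resolventSq hr hu).continuousOn
  refine ⟨max B (‖(1 : L2 →L[ℝ] L2)‖ + 1), fun s hs => ?_⟩
  rw [abs_norm]
  rcases le_total s N with h | h
  · exact (hB s ⟨hs, h⟩).trans (le_max_left _ _)
  · exact (hN s h).le.trans (le_max_right _ _)

theorem expDecay_squareDensity (hr : Regular a a' a'')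
    (hu : ∀ s, IsUnit (1 - op a s * op a s)) : ExpDecay (squareDensity a) := by
  refine ExpDecay.of_abs_le (((expDecay_norm_vec hr).mul_bounded
    (norm_resolventSq_bounded hr hu)).mul_bounded (expDecay_norm_vec hr).bounded) fun x => ?_
  refine (abs_real_inner_le_norm _ _).trans ?_
  rw [abs_of_nonneg (by positivity), mul_assoc]
  exact mul_le_mul_of_nonneg_left ((resolventSq a x).le_opNorm _) (norm_nonneg _)

theorem expDecay_potential (hr : Regular a a' a'')
    (hu : ∀ s, IsUnit (1 - op a s * op a s)) : ExpDecay (potential a) := by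
  refine hr.decay.add (ExpDecay.of_abs_le ((((expDecay_norm_vec hr).mul_bounded
    (norm_resolventSq_bounded hr hu)).mul_bounded
    (expDecay_norm_vec hr).bounded).mul_bounded (expDecay_norm_op hr).bounded) fun x => ?_)
  refine (abs_real_inner_le_norm _ _).trans ?_
  rw [abs_of_nonneg (by positivity)]
  have h1 : ‖oddVec a x‖ ≤ ‖op a x‖ * (‖resolventSq a x‖ * ‖vec a x‖) :=
    ((op a x).le_opNorm _).trans
      (mul_le_mul_of_nonneg_left ((resolventSq a x).le_opNorm _) (norm_nonneg _))
  refine (mul_le_mul_of_nonneg_left h1 (norm_nonneg _)).trans_eq ?_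
  ring

theorem continuous_potential (hr : Regular a a' a'')
    (hu : ∀ s, IsUnit (1 - op a s * op a s)) : Continuous (potential a) := by
  have h1 := continuous_vec hr.hasDerivAt hr.decay hr.decay'
  have h2 : Continuous (op a) :=
    continuous_iff_continuousAt.2 fun s => (hasDerivAt_op hr s).continuousAt
  have h3 := continuous_resolventSq hr hu
  have h4 := hr.continuous
  unfold potential oddVec evenVec
  fun_prop

theorem continuous_squareDensity (hr : Regular a a' a'')
    (hu : ∀ s, IsUnit (1 - op a s * op a s)) : Continuous (squareDensity a) :=
  continuous_iff_continuousAt.2 fun s => (hasDerivAt_squareDensity hr (hu s)).continuousAt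

end

/-! ### Fredholm determinants and resolvents -/

section

variable {k : ℝ → ℝ → ℝ} {u v w : ℝ → ℝ} {T : L2 →L[ℝ] L2}

theorem inverse_apply_eq {T : L2 →L[ℝ] L2} (hu : IsUnit T) {f g : L2} (h : T g = f) :
    Ring.inverse T f = g := by
  have := congrArg (fun S : L2 →L[ℝ] L2 => S g) (Ring.inverse_mul_cancel _ hu)
  simp only [mul_apply_eq_comp, one_apply_eq_self, h] at this
  exact this

theorem DominatedFun.memLp (hu : DominatedFun u w) (hw : MemLp w 2 halfLine) :
    MemLp u 2 halfLine :=
  hw.of_le_mul (c := 1) hu.measurable.aestronglyMeasurable (ae_halfLine_pos.mono fun x hx => by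
    rw [one_mul]
    exact (hu.bound x hx.le).trans (le_abs_self _))

/-- The Fredholm numerator is the resolvent times the determinant. -/
theorem fredholmNum_ae_eq (hk : Dominated k w) (hw : MemLp w 2 halfLine) (hu : DominatedFun u w)
    (hT : IsIntegralOperator k T) (hT1 : IsUnit (1 - T)) :
    fredholmNum k u =ᵐ[halfLine]
      fun x => fredholmDet k * Ring.inverse (1 - T) (toL2 u) x := by
  have hN : MemLp (fredholmNum k u) 2 halfLine :=
    hw.of_le_mul (c := numeratorBound w) (measurable_fredholmNum hk hu).aestronglyMeasurable
      (ae_halfLine_pos.mono fun x hx => (abs_fredholmNum_le hk hu hx.le).trans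
        (by rw [Real.norm_eq_abs, abs_of_nonneg (hk.nonneg hx.le)]))
  -- This is Fredholm's equation read in L²; inverting I - T identifies the numerator.
  have h1 : (1 - T) (hN.toLp _) = fredholmDet k • toL2 u := by
    refine Lp.ext ?_
    rw [sub_apply, one_apply_eq_self]
    filter_upwards [Lp.coeFn_sub (hN.toLp _) (T (hN.toLp _)), hN.coeFn_toLp, hT (hN.toLp _),
      Lp.coeFn_smul (fredholmDet k) (toL2 u), coeFn_toL2 (hu.memLp hw), ae_halfLine_pos]
      with x h1 h2 h3 h4 h5 hx
    rw [h1, Pi.sub_apply, h2, h3, h4, Pi.smul_apply, h5, fredholmNum_eq hk hu hx.le]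
    have : ∫ y in Ioi 0, k x y * (hN.toLp _) y = ∫ y, k x y * fredholmNum k u y ∂halfLine :=
      integral_congr_ae (hN.coeFn_toLp.mono fun y hy => by simp only [hy])
    rw [this, smul_eq_mul]
    ring
  have h2 : hN.toLp _ = fredholmDet k • Ring.inverse (1 - T) (toL2 u) := by
    rw [← map_smul, inverse_apply_eq hT1 h1]
  filter_upwards [hN.coeFn_toLp, Lp.coeFn_smul (fredholmDet k) (Ring.inverse (1 - T) (toL2 u))]
    with x h3 h4
  rw [← h3, h2, h4]
  rfl

theorem integral_mul_fredholmNum (hk : Dominated k w) (hw : MemLp w 2 halfLine)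
    (hu : DominatedFun u w) (hT : IsIntegralOperator k T) (hT1 : IsUnit (1 - T)) (v : ℝ → ℝ) :
    ∫ y, v y * fredholmNum k u y ∂halfLine
      = fredholmDet k * pair v (Ring.inverse (1 - T) (toL2 u)) := by
  rw [pair, ← integral_const_mul]
  refine integral_congr_ae ((fredholmNum_ae_eq hk hw hu hT hT1).mono fun y hy => ?_)
  simp only [hy]
  ring

/-- The Fredholm determinant of a rank-one perturbation, in terms of the resolvent. -/
theorem fredholmDet_rankOne (hk : Dominated k w) (hw : MemLp w 2 halfLine)
    (hu : DominatedFun u w) (hT : IsIntegralOperator k T) (hT1 : IsUnit (1 - T)) {B : ℝ}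
    (hv : Measurable v) (hB : ∀ z, 0 ≤ z → |v z| ≤ B) :
    fredholmDet (fun x y => k x y + u x * v y)
      = fredholmDet k * (1 - pair v (Ring.inverse (1 - T) (toL2 u))) := by
  rw [fredholmDet_add_rankOne hk hu hv hB, integral_mul_fredholmNum hk hw hu hT hT1]
  ring

/-- An L² class has no value at 0. Fredholm's equation holds at every point and so gives the corner
value of the resolvent kernel a meaning. -/
theorem fredholmNum_zero_eq (hk : Dominated k w) (hw : MemLp w 2 halfLine)
    (hu : DominatedFun u w) (hT : IsIntegralOperator k T) (hT1 : IsUnit (1 - T)) :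
    fredholmNum k u 0 = fredholmDet k *
      (u 0 + pair (k 0) (Ring.inverse (1 - T) (toL2 u))) := by
  rw [fredholmNum_eq hk hu le_rfl, integral_mul_fredholmNum hk hw hu hT hT1]
  ring

end

section

variable {a a' a'' : ℝ → ℝ}

/-! ### The kernels `a(x+y)` and `a(x+y)²` -/

theorem toL2_congr {f g : ℝ → ℝ} {h : L2} (hh : h =ᵐ[halfLine] g) (e : f = g) : toL2 f = h := by
  subst e
  have hm : MemLp f 2 halfLine := (memLp_congr_ae hh).1 (Lp.memLp h)
  exact Lp.ext ((coeFn_toL2 hm).trans hh.symm)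

theorem toL2_col_kerA (hr : Regular a a' a'') (s : ℝ) : toL2 (col (kerA a s)) = vec a s :=
  toL2_congr (vec_ae hr s) (by ext x; simp [col, kerA])

theorem toL2_col_kerK (hr : Regular a a' a'') (s : ℝ) :
    toL2 (col (kerK a s)) = op a s (vec a s) := by
  have h := hr.op_vec s 0
  rw [add_zero] at h
  exact toL2_congr h (by ext x; exact kerK_comm a s x 0)

theorem memLp_of_ae {f : ℝ → ℝ} {h : L2} (hh : h =ᵐ[halfLine] f) : MemLp f 2 halfLine :=
  (memLp_congr_ae hh).1 (Lp.memLp h)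

theorem kerK_eq_inner (hr : Regular a a' a'') (s x y : ℝ) :
    kerK a s x y = inner ℝ (vec a (x + s)) (vec a (y + s)) := by
  rw [inner_eq_integral (vec_ae hr _) (vec_ae hr _), kerK]
  congr 1
  ext r
  ring_nf

theorem decayKer_add (hr : Regular a a' a'') :
    ∃ κ, DecayKer (fun x y => a (x + y)) κ := by
  obtain ⟨κ, hκ, h⟩ := hr.decay
  refine ⟨κ, ⟨(hr.continuous.measurable.comp (by fun_prop : Measurable
    fun p : ℝ × ℝ => p.1 + p.2) :), hκ, fun c => ?_⟩⟩
  obtain ⟨C, hC, h⟩ := h (c + c)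
  refine ⟨C * Real.exp (-κ * c), by positivity, fun x y hx hy =>
    (h (x + y) (by linarith)).trans ?_⟩
  rw [mul_assoc, ← Real.exp_add]
  exact mul_le_mul_of_nonneg_left (Real.exp_le_exp.2 (by nlinarith)) hC

theorem decayKer_kerK (hr : Regular a a' a'') : ∃ κ, DecayKer (kerK a 0) κ := by
  obtain ⟨κ, hκ, h⟩ := expDecay_norm_vec hr
  have e : kerK a 0 = fun x y => inner ℝ (vec a x) (vec a y) := by
    ext x y
    rw [kerK_eq_inner hr, add_zero, add_zero]
  have hv := continuous_vec hr.hasDerivAt hr.decay hr.decay'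
  rw [e]
  refine ⟨κ, ⟨Continuous.measurable (f := fun p : ℝ × ℝ => inner ℝ (vec a p.1) (vec a p.2))
    (by fun_prop), hκ, fun c => ?_⟩⟩
  obtain ⟨C, hC, h⟩ := h c
  refine ⟨C * (C * Real.exp (-κ * c)), by positivity, fun x y hx hy =>
    (abs_real_inner_le_norm _ _).trans ?_⟩
  have h1 := h x hx
  have h2 := (h y hy).trans (mul_le_mul_of_nonneg_left
    (Real.exp_le_exp.2 (by nlinarith : -κ * y ≤ -κ * c)) hC)
  rw [abs_norm] at h1 h2
  exact (mul_le_mul h1 h2 (norm_nonneg _) (by positivity)).trans_eq (by ring)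

/-- Moving the end point by t moves the parameter by 2t, since both arguments are shifted. This is
the source of the factor 1/2 in the logarithmic derivative of Det(I ∓ A_s). -/
theorem shiftKer_add (a : ℝ → ℝ) (t : ℝ) : shiftKer (fun x y => a (x + y)) t = kerA a (2 * t) := by
  ext x y
  simp only [shiftKer, kerA]
  ring_nf

theorem shiftKer_kerK (a : ℝ → ℝ) (t : ℝ) : shiftKer (kerK a 0) t = kerK a t := by
  ext x y
  simp only [shiftKer, kerK]
  congr 1
  ext r
  ring_nf

theorem DecayKer.exists_dominated {k : ℝ → ℝ → ℝ} {κ : ℝ} (hk : DecayKer k κ) (t : ℝ) :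
    ∃ w, Dominated (shiftKer k t) w ∧ MemLp w 2 halfLine := by
  obtain ⟨C, hC, h⟩ := hk.dominated t
  exact ⟨_, h t le_rfl, ((memLp_exp hk.pos).const_mul C).const_mul _⟩

theorem exists_dominated_kerA (hr : Regular a a' a'') (s : ℝ) :
    ∃ w, Dominated (kerA a s) w ∧ MemLp w 2 halfLine := by
  obtain ⟨κ, hk⟩ := decayKer_add hr
  have := hk.exists_dominated (s / 2)
  rwa [shiftKer_add, mul_div_cancel₀ _ two_ne_zero] at this

theorem exists_dominated_kerK (hr : Regular a a' a'') (s : ℝ) :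
    ∃ w, Dominated (kerK a s) w ∧ MemLp w 2 halfLine := by
  obtain ⟨κ, hk⟩ := decayKer_kerK hr
  have := hk.exists_dominated s
  rwa [shiftKer_kerK] at this

/-! ### The resolvents applied to `A_s|δ⟩` -/

/-- (I - A_s)⁻¹ = (I + A_s)(I - A_s²)⁻¹: the two vectors are the even and odd parts, in A_s, of the
resolvent applied to A_s|δ⟩. -/
theorem inverse_one_sub_vec {s : ℝ} (h1 : IsUnit (1 - op a s))
    (hu : IsUnit (1 - op a s * op a s)) :
    Ring.inverse (1 - op a s) (vec a s) = evenVec a s + oddVec a s := by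
  refine inverse_apply_eq h1 ?_
  have h := evenVec_eq hu
  rw [sub_apply, one_apply_eq_self, map_add]
  change evenVec a s + oddVec a s - (oddVec a s + op a s (oddVec a s)) = vec a s
  rw [eq_sub_of_add_eq h.symm]
  abel

theorem resolventSq_op_vec {s : ℝ} (hu : IsUnit (1 - op a s * op a s)) :
    resolventSq a s (op a s (vec a s)) = oddVec a s := by
  refine inverse_apply_eq hu ?_
  rw [sub_apply, one_apply_eq_self, mul_apply_eq_comp]
  conv_rhs => rw [eq_sub_of_add_eq (evenVec_eq hu).symm, map_sub]
  rfl

theorem inner_vec_eq_pair (hr : Regular a a' a'') (s : ℝ) (f : L2) :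
    inner ℝ (vec a s) f = pair (fun y => a (y + s)) f :=
  inner_eq_integral (vec_ae hr s) (Filter.EventuallyEq.refl _ f)

/-! ### Differential equations for the Fredholm determinants -/

/-- The resolvent kernel at the corner is a(s) + ⟨v, e + o⟩, with v = `vec a s`, which is the sum of
the density and the potential; the substitution t = s/2 contributes 1/2. -/
theorem fredholmDet_kerA_ode (hr : Regular a a' a'') (h1 : ∀ s, IsUnit (1 - op a s))
    (hu : ∀ s, IsUnit (1 - op a s * op a s)) :
    (∀ s, HasDerivAt (fun s => fredholmDet (kerA a s))
      (1 / 2 * (squareDensity a s + potential a s) * fredholmDet (kerA a s)) s) ∧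
    Filter.Tendsto (fun s => fredholmDet (kerA a s)) Filter.atTop (nhds 1) ∧
    ∀ s, 0 < fredholmDet (kerA a s) := by
  obtain ⟨κ, hk⟩ := decayKer_add hr
  have hc : Continuous fun t => squareDensity a (2 * t) + potential a (2 * t) :=
    ((continuous_squareDensity hr hu).comp (by fun_prop)).add
      ((continuous_potential hr hu).comp (by fun_prop))
  have hb : ∀ t, boundaryDensity (fun x y => a (x + y)) t
      = fredholmDet (shiftKer (fun x y => a (x + y)) t)
        * (squareDensity a (2 * t) + potential a (2 * t)) := by
    intro t
    obtain ⟨w, hw, hw2⟩ := exists_dominated_kerA hr (2 * t)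
    rw [boundaryDensity, shiftKer_add, fredholmNum_zero_eq hw hw2 (col_dominatedFun hw)
      (hr.isIntegralOperator _) (h1 _), toL2_col_kerA hr, inverse_one_sub_vec (h1 _) (hu _)]
    have e : kerA a (2 * t) 0 = fun y => a (y + 2 * t) := by ext y; simp [kerA]
    rw [e, ← inner_vec_eq_pair hr, inner_add_right]
    simp only [squareDensity, potential, col, kerA, zero_add]
    ring
  obtain ⟨hd, ht⟩ := hasDerivAt_fredholmDet_shift hk hc hb
  have hpos := pos_of_hasDerivAt_of_tendsto hc hd ht
  simp only [shiftKer_add] at hd ht hpos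
  have e2 : ∀ s : ℝ, 2 * (s / 2) = s := fun s => by ring
  have e : (fun s => fredholmDet (kerA a s)) = fun s => fredholmDet (kerA a (2 * (s / 2))) := by
    simp only [e2]
  refine ⟨fun s => ?_, ?_, fun s => ?_⟩
  · rw [e]
    have h2 := (hd (s / 2)).comp s ((hasDerivAt_id s).div_const 2)
    refine h2.congr_deriv ?_
    simp only [e2]
    ring
  · rw [e]
    exact ht.comp (Filter.tendsto_id.atTop_div_const two_pos)
  · have := hpos (s / 2)
    rwa [e2] at this

/-- The corner value is ⟨v, v⟩ + ⟨A_s v, o⟩ = ⟨v, v + A_s o⟩ = ⟨v, e⟩, with v = `vec a s`. Here the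
parameter moves at unit speed, so no factor 1/2 appears. -/
theorem fredholmDet_kerK_ode (hr : Regular a a' a'') (hu : ∀ s, IsUnit (1 - op a s * op a s)) :
    (∀ s, HasDerivAt (fun s => fredholmDet (kerK a s))
      (squareDensity a s * fredholmDet (kerK a s)) s) ∧
    Filter.Tendsto (fun s => fredholmDet (kerK a s)) Filter.atTop (nhds 1) ∧
    ∀ s, 0 < fredholmDet (kerK a s) := by
  obtain ⟨κ, hk⟩ := decayKer_kerK hr
  have hc := continuous_squareDensity hr hu
  have hb : ∀ t, boundaryDensity (kerK a 0) t
      = fredholmDet (shiftKer (kerK a 0) t) * squareDensity a t := by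
    intro t
    obtain ⟨w, hw, hw2⟩ := exists_dominated_kerK hr t
    rw [boundaryDensity, shiftKer_kerK, fredholmNum_zero_eq hw hw2 (col_dominatedFun hw)
      (hr.isIntegralOperator_kerK _) (hu _), toL2_col_kerK hr]
    change _ * (_ + pair _ (resolventSq a t (op a t (vec a t)))) = _
    have e3 := hr.op_vec t 0
    rw [add_zero] at e3
    rw [resolventSq_op_vec (hu t), pair,
      ← inner_eq_integral e3 (Filter.EventuallyEq.refl _ (oddVec a t)), hr.inner_op, col,
      kerK_eq_inner hr, zero_add, ← inner_add_right, ← evenVec_eq (hu t), squareDensity]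
  obtain ⟨hd, ht⟩ := hasDerivAt_fredholmDet_shift hk hc hb
  have hpos := pos_of_hasDerivAt_of_tendsto hc hd ht
  simp only [shiftKer_kerK] at hd ht hpos
  exact ⟨hd, ht, hpos⟩

/-! ### Changing the sign of `a` -/

theorem kerA_neg (a : ℝ → ℝ) (s : ℝ) : kerA (fun x => -a x) s = kerNegA a s := rfl

theorem vec_neg (hr : Regular a a' a'') (s : ℝ) : vec (fun x => -a x) s = -vec a s := by
  refine Lp.ext ((vec_ae hr.neg s).trans ?_)
  filter_upwards [Lp.coeFn_neg (vec a s), vec_ae hr s] with x h1 h2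
  rw [h1, Pi.neg_apply, h2]

theorem op_neg (hr : Regular a a' a'') (s : ℝ) : op (fun x => -a x) s = -op a s :=
  integralOperator_eq (hr.integralOperator_kerNegA s)

/-- This vector contains an odd number of factors a, its image under A_s an even number. A change of
sign therefore flips e and q₀ and fixes o and p, so every statement about I - A_s yields one about I
+ A_s. -/
theorem evenVec_neg (hr : Regular a a' a'') (s : ℝ) :
    evenVec (fun x => -a x) s = -evenVec a s := by
  simp only [evenVec, resolventSq, op_neg hr, vec_neg hr, neg_mul_neg, map_neg]

theorem oddVec_neg (hr : Regular a a' a'') (s : ℝ) : oddVec (fun x => -a x) s = oddVec a s := by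
  simp only [oddVec, op_neg hr, evenVec_neg hr, neg_apply, map_neg, neg_neg]

theorem squareDensity_neg (hr : Regular a a' a'') (s : ℝ) :
    squareDensity (fun x => -a x) s = squareDensity a s := by
  simp only [squareDensity, evenVec_neg hr, vec_neg hr, inner_neg_neg]

theorem potential_neg (hr : Regular a a' a'') (s : ℝ) :
    potential (fun x => -a x) s = -potential a s := by
  simp only [potential, oddVec_neg hr, vec_neg hr, inner_neg_left]
  ring

end

/-! ### Functions for which all resolvents exist -/

/-- The function `a` is regular and `I ± A_s`, `I - A_s²` are invertible for all `s`. -/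
structure Solvable (a a' a'' : ℝ → ℝ) : Prop extends Regular a a' a'' where
  isUnit_one_sub : ∀ s, IsUnit (1 - op a s)
  isUnit_one_add : ∀ s, IsUnit (1 + op a s)
  isUnit_one_sub_sq : ∀ s, IsUnit (1 - op a s * op a s)

theorem Admissible.solvable {γ : ℝ} {A : ℝ → ℝ} (hA : Admissible γ A) (hγ : γ ∈ Icc (0 : ℝ) 1) :
    Solvable A (deriv A) (deriv (deriv A)) :=
  ⟨hA.regular, fun s => (hA.isUnit_one_sub_and_one_add hγ s).1,
    fun s => (hA.isUnit_one_sub_and_one_add hγ s).2, hA.isUnit_one_sub_sq hγ⟩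

section

variable {a a' a'' : ℝ → ℝ}

theorem Solvable.neg (h : Solvable a a' a'') :
    Solvable (fun x => -a x) (fun x => -a' x) fun x => -a'' x := by
  have e := op_neg h.toRegular
  refine ⟨h.toRegular.neg, fun s => ?_, fun s => ?_, fun s => ?_⟩
  · rw [e, sub_neg_eq_add]
    exact h.isUnit_one_add s
  · rw [e, ← sub_eq_add_neg]
    exact h.isUnit_one_sub s
  · rw [e, neg_mul_neg]
    exact h.isUnit_one_sub_sq s

/-! ### The resolvents -/

theorem resolvent_kerA (h : Solvable a a' a'') (s : ℝ) :
    resolvent (kerA a s) (col (kerA a s)) = ⇑(evenVec a s + oddVec a s) := by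
  rw [resolvent, toL2_col_kerA h.toRegular]
  exact congrArg (fun f : L2 => (f : ℝ → ℝ)) (inverse_one_sub_vec (h.isUnit_one_sub s) (h.isUnit_one_sub_sq s))

theorem resolvent_kerNegA (h : Solvable a a' a'') (s : ℝ) :
    resolvent (kerNegA a s) (col (kerNegA a s)) = ⇑(-evenVec a s + oddVec a s) := by
  have e := resolvent_kerA h.neg s
  rwa [evenVec_neg h.toRegular, oddVec_neg h.toRegular, kerA_neg] at e

theorem resolvent_kerK (h : Solvable a a' a'') (s : ℝ) :
    resolvent (kerK a s) (col (kerK a s)) = ⇑(oddVec a s) := by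
  rw [resolvent, toL2_col_kerK h.toRegular, h.integralOperator_kerK]
  exact congrArg (fun f : L2 => (f : ℝ → ℝ)) (resolventSq_op_vec (h.isUnit_one_sub_sq s))

theorem resolvent_kerK_col_kerA (h : Solvable a a' a'') (s : ℝ) :
    resolvent (kerK a s) (col (kerA a s)) = ⇑(evenVec a s) := by
  rw [resolvent, toL2_col_kerA h.toRegular, h.integralOperator_kerK]
  rfl

theorem memLp_col_kerA (hr : Regular a a' a'') (s : ℝ) : MemLp (col (kerA a s)) 2 halfLine :=
  memLp_of_ae ((vec_ae hr s).trans (.of_forall fun x => by simp [col, kerA]))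

theorem memLp_col_kerK (hr : Regular a a' a'') (s : ℝ) : MemLp (col (kerK a s)) 2 halfLine := by
  have e := hr.op_vec s 0
  exact memLp_of_ae (e.trans (.of_forall fun x => kerK_comm a s 0 x))

theorem Solvable.resolventApplies_kerA (h : Solvable a a' a'') (s : ℝ) :
    ResolventApplies (kerA a s) (col (kerA a s)) :=
  ⟨⟨_, h.isIntegralOperator s⟩, h.isUnit_one_sub s, memLp_col_kerA h.toRegular s⟩

theorem Solvable.resolventApplies_kerNegA (h : Solvable a a' a'') (s : ℝ) :
    ResolventApplies (kerNegA a s) (col (kerNegA a s)) := h.neg.resolventApplies_kerA s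

theorem Solvable.resolventApplies_kerK (h : Solvable a a' a'') (s : ℝ) {f : ℝ → ℝ}
    (hf : MemLp f 2 halfLine) : ResolventApplies (kerK a s) f := by
  refine ⟨⟨_, h.isIntegralOperator_kerK s⟩, ?_, hf⟩
  rw [h.integralOperator_kerK]
  exact h.isUnit_one_sub_sq s

/-! ### Convergence of the integrals -/

theorem integrable_of_ae_exp_bound {κ C : ℝ} (hκ : 0 < κ) {f : ℝ → ℝ}
    (hf : AEStronglyMeasurable f halfLine)
    (h : ∀ᵐ x ∂halfLine, |f x| ≤ C * Real.exp (-κ * x)) : Integrable f halfLine :=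
  ((integrable_exp_halfLine hκ).const_mul C).mono' hf h

theorem integrable_vec (hr : Regular a a' a'') (s : ℝ) : Integrable (vec a s) halfLine := by
  refine Integrable.congr ?_ (vec_ae hr s).symm
  exact integrableOn_Ioi_comp_add.2 (hr.decay.integrableOn hr.continuous.measurable _)

theorem integrable_op (hr : Regular a a' a'') (s : ℝ) (f : L2) :
    Integrable (op a s f) halfLine := by
  obtain ⟨κ, hκ, hb⟩ := expDecay_norm_vec hr
  obtain ⟨C, hC, hb⟩ := hb s
  refine integrable_of_ae_exp_bound (C := C * Real.exp (-κ * s) * ‖f‖) hκ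
    (Lp.aestronglyMeasurable _) ?_
  filter_upwards [hr.represents_op s f, ae_halfLine_pos] with x h1 hx
  rw [h1]
  refine (abs_real_inner_le_norm _ _).trans ?_
  have h2 := hb (s + x) (by linarith)
  rw [abs_norm, mul_add, Real.exp_add] at h2
  exact (mul_le_mul_of_nonneg_right h2 (norm_nonneg f)).trans_eq (by ring)

theorem integrable_oddVec (hr : Regular a a' a'') (s : ℝ) : Integrable (oddVec a s) halfLine :=
  integrable_op hr s _

theorem integrable_evenVec (h : Solvable a a' a'') (s : ℝ) :
    Integrable (evenVec a s) halfLine := by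
  rw [evenVec_eq (h.isUnit_one_sub_sq s)]
  exact ((integrable_vec h.toRegular s).add (integrable_op h.toRegular s _)).congr
    (Lp.coeFn_add _ _).symm

theorem integrable_even_add_odd (h : Solvable a a' a'') (s : ℝ) :
    Integrable (evenVec a s + oddVec a s : L2) halfLine :=
  ((integrable_evenVec h s).add (integrable_oddVec h.toRegular s)).congr (Lp.coeFn_add _ _).symm

theorem oneA_eq (a : ℝ → ℝ) (s y : ℝ) : oneA a s y = ∫ r in Ioi (s + y), a r := by
  have e := integral_Ioi_comp_add a 0 (s + y)
  rw [zero_add] at e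
  rw [← e, oneA]
  congr 1
  ext r
  ring_nf

theorem measurable_oneA (hr : Regular a a' a'') (s : ℝ) : Measurable (oneA a s) := by
  have h : StronglyMeasurable fun p : ℝ × ℝ => a (s + p.2 + p.1) :=
    (hr.continuous.comp (by fun_prop)).stronglyMeasurable
  exact (h.integral_prod_right (ν := halfLine)).measurable

theorem abs_oneA_le (hr : Regular a a' a'') (s : ℝ) {y : ℝ} (hy : 0 ≤ y) :
    |oneA a s y| ≤ ∫ r in Ioi s, |a r| := by
  rw [oneA_eq]
  refine (norm_integral_le_integral_norm a).trans ?_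
  exact setIntegral_mono_set (hr.decay.integrableOn hr.continuous.measurable s).norm
    (.of_forall fun _ => norm_nonneg _) (Ioi_subset_Ioi (by linarith)).eventuallyLE

theorem integrable_bounded_mul {f v : ℝ → ℝ} {B : ℝ} (hf : Integrable f halfLine)
    (hv : Measurable v) (hB : ∀ y, 0 ≤ y → |v y| ≤ B) :
    Integrable (fun y => v y * f y) halfLine :=
  hf.bdd_mul hv.aestronglyMeasurable (ae_halfLine_pos.mono fun y hy => hB y hy.le)

theorem integrable_oneA_mul_evenVec (h : Solvable a a' a'') (s : ℝ) :
    Integrable (fun y => oneA a s y * evenVec a s y) halfLine :=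
  integrable_bounded_mul (integrable_evenVec h s) (measurable_oneA h.toRegular s)
    fun _ hy => abs_oneA_le h.toRegular s hy

theorem integrable_shift_mul (hr : Regular a a' a'') (s : ℝ) (f : L2) :
    Integrable (fun y => a (s + y) * f y) halfLine := by
  have e := integrable_mul_L2 (vec_ae hr s) (Filter.EventuallyEq.refl _ f)
  simpa only [add_comm s] using e

/-- `⟨1|A_s|f⟩` computed in the two orders. -/
theorem pair_oneA (hr : Regular a a' a'') (s : ℝ) (f : L2) :
    pair (oneA a s) f = ∫ y, op a s f y ∂halfLine := by
  obtain ⟨κ, C, hκ, hC, hb⟩ := hr.decay.bound_add s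
  have hf : Integrable (fun y => Real.exp (-κ * y) * |f y|) halfLine := by
    have e := (integrable_mul_L2 (coeFn_toL2 (memLp_exp hκ)) (Filter.EventuallyEq.refl _ f)).norm
    simpa [abs_mul] using e
  have hi : Integrable (fun z : ℝ × ℝ => a (s + z.2 + z.1) * f z.1)
      (halfLine.prod halfLine) := by
    refine Integrable.mono' ((hf.mul_prod (integrable_exp_halfLine hκ)).const_mul C) ?_ ?_
    · exact (hr.continuous.comp (by fun_prop)).aestronglyMeasurable.mul
        (Lp.aestronglyMeasurable f).comp_fst
    · have h1 : ∀ᵐ z ∂halfLine.prod halfLine, 0 < z.1 :=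
        Measure.quasiMeasurePreserving_fst.ae ae_halfLine_pos
      have h2 : ∀ᵐ z ∂halfLine.prod halfLine, 0 < z.2 :=
        Measure.quasiMeasurePreserving_snd.ae ae_halfLine_pos
      filter_upwards [h1, h2] with z h1 h2
      rw [norm_mul, Real.norm_eq_abs, Real.norm_eq_abs]
      have e := hb z.1 z.2 h1.le h2.le
      rw [show z.1 + z.2 + s = s + z.2 + z.1 by ring] at e
      exact (mul_le_mul_of_nonneg_right e (abs_nonneg _)).trans_eq (by ring)
  have e := integral_integral_swap (f := fun y r => a (s + r + y) * f y) hi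
  simp only [integral_mul_const] at e
  refine e.trans (integral_congr_ae ?_)
  filter_upwards [hr.isIntegralOperator s f] with x hx
  rw [hx]
  congr 1
  ext y
  rw [kerA, show x + y + s = s + x + y by ring]

/-! ### The functions `q₀` and `b` -/

theorem q0_eq (h : Solvable a a' a'') (s : ℝ) : q0 a s = potential a s := by
  rw [q0, braResolventDelta, resolvent_kerK h, potential, inner_vec_eq_pair h.toRegular, add_zero]
  simp only [add_comm s]

theorem bMinus_eq (h : Solvable a a' a'') (s : ℝ) :
    bMinus a s = 1 + ((∫ y, evenVec a s y ∂halfLine) + ∫ y, oddVec a s y ∂halfLine) := by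
  rw [bMinus, braResolventDelta, resolvent_kerA h, pair,
    ← integral_add (integrable_evenVec h s) (integrable_oddVec h.toRegular s)]
  simp only [one_mul]
  congr 1
  exact integral_congr_ae (Lp.coeFn_add (evenVec a s) (oddVec a s))

theorem bMinus_neg (a : ℝ → ℝ) (s : ℝ) : bMinus (fun x => -a x) s = b a s := rfl

theorem integral_neg_evenVec (s : ℝ) :
    ∫ y, (-evenVec a s : L2) y ∂halfLine = -∫ y, evenVec a s y ∂halfLine := by
  rw [integral_congr_ae (Lp.coeFn_neg (evenVec a s)), ← integral_neg]
  rfl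

theorem b_eq (h : Solvable a a' a'') (s : ℝ) :
    b a s = 1 + (-(∫ y, evenVec a s y ∂halfLine) + ∫ y, oddVec a s y ∂halfLine) := by
  rw [← bMinus_neg, bMinus_eq h.neg, evenVec_neg h.toRegular, oddVec_neg h.toRegular,
    integral_neg_evenVec]

theorem integral_evenVec (h : Solvable a a' a'') (s : ℝ) :
    ∫ y, evenVec a s y ∂halfLine = 1 / 2 * (bMinus a s - b a s) := by
  rw [bMinus_eq h, b_eq h]
  ring

theorem integral_oddVec (h : Solvable a a' a'') (s : ℝ) :
    ∫ y, oddVec a s y ∂halfLine = 1 / 2 * (b a s + bMinus a s - 2) := by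
  rw [bMinus_eq h, b_eq h]
  ring

/-- `b = Det(I - A_s) / Det(I + A_s)`, before division. -/
theorem fredholmDet_kerNegA_mul_b (h : Solvable a a' a'') (s : ℝ) :
    fredholmDet (kerNegA a s) * b a s = fredholmDet (kerA a s) := by
  have hn := h.neg
  obtain ⟨w, hw, hw2⟩ := exists_dominated_kerA hn.toRegular s
  -- The row factor is -1 because the column of -A_s already carries a minus sign; the product is
  -- the term a(x+s) of the commuted kernel.
  have e := fredholmDet_rankOne hw hw2 (col_dominatedFun hw) (hn.isIntegralOperator s)
    (hn.isUnit_one_sub s) (v := fun _ => -1) measurable_const (B := 1) (by simp)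
  rw [toL2_col_kerA hn.toRegular, inverse_one_sub_vec (hn.isUnit_one_sub s)
    (hn.isUnit_one_sub_sq s), ← resolvent_kerA hn] at e
  rw [← fredholmDet_sub_delta_one h.hasDerivAt h.continuous' h.decay h.decay', ← bMinus_neg,
    bMinus, braResolventDelta]
  simp only [pair, neg_mul, integral_neg, sub_neg_eq_add] at e
  rw [kerA_neg] at e ⊢
  rw [pair, ← e]
  refine fredholmDet_congr fun x y _ _ => ?_
  simp only [kerNegA, col]
  rw [add_zero]
  ring

/-! ### Exponential formulas -/

theorem Solvable.fredholmDet_kerA_pos (h : Solvable a a' a'') (s : ℝ) :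
    0 < fredholmDet (kerA a s) :=
  (fredholmDet_kerA_ode h.toRegular h.isUnit_one_sub h.isUnit_one_sub_sq).2.2 s

theorem Solvable.fredholmDet_kerNegA_pos (h : Solvable a a' a'') (s : ℝ) :
    0 < fredholmDet (kerNegA a s) := h.neg.fredholmDet_kerA_pos s

theorem b_eq_div (h : Solvable a a' a'') (s : ℝ) :
    b a s = fredholmDet (kerA a s) / fredholmDet (kerNegA a s) := by
  rw [eq_div_iff (h.fredholmDet_kerNegA_pos s).ne', mul_comm, fredholmDet_kerNegA_mul_b h]

theorem fredholmDet_kerNegA_ode (h : Solvable a a' a'') :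
    (∀ s, HasDerivAt (fun s => fredholmDet (kerNegA a s))
      (1 / 2 * (squareDensity a s - potential a s) * fredholmDet (kerNegA a s)) s) ∧
    Filter.Tendsto (fun s => fredholmDet (kerNegA a s)) Filter.atTop (nhds 1) := by
  obtain ⟨hd, ht, -⟩ := fredholmDet_kerA_ode h.neg.toRegular h.neg.isUnit_one_sub
    h.neg.isUnit_one_sub_sq
  simp only [squareDensity_neg h.toRegular, potential_neg h.toRegular, ← sub_eq_add_neg] at hd
  exact ⟨hd, ht⟩

/-- The difference of the logarithmic derivatives (p+q)/2 and (p-q)/2 is q. -/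
theorem hasDerivAt_b (h : Solvable a a' a'') (s : ℝ) :
    HasDerivAt (b a) (potential a s * b a s) s := by
  obtain ⟨h1, -⟩ := fredholmDet_kerA_ode h.toRegular h.isUnit_one_sub h.isUnit_one_sub_sq
  have h2 := (h1 s).div ((fredholmDet_kerNegA_ode h).1 s) (h.fredholmDet_kerNegA_pos s).ne'
  refine (h2.congr_of_eventuallyEq (.of_forall fun t => b_eq_div h t)).congr_deriv ?_
  have := (h.fredholmDet_kerNegA_pos s).ne'
  rw [b_eq_div h]
  field_simp
  ring

theorem tendsto_b (h : Solvable a a' a'') : Filter.Tendsto (b a) Filter.atTop (nhds 1) := by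
  obtain ⟨-, h1, -⟩ := fredholmDet_kerA_ode h.toRegular h.isUnit_one_sub h.isUnit_one_sub_sq
  have h2 := h1.div (fredholmDet_kerNegA_ode h).2 one_ne_zero
  rw [div_one] at h2
  exact h2.congr fun t => (b_eq_div h t).symm

theorem b_pos (h : Solvable a a' a'') (s : ℝ) : 0 < b a s := by
  rw [b_eq_div h]
  exact div_pos (h.fredholmDet_kerA_pos s) (h.fredholmDet_kerNegA_pos s)

theorem Solvable.integrableOn_potential (h : Solvable a a' a'') (s : ℝ) :
    IntegrableOn (potential a) (Ioi s) :=
  (expDecay_potential h.toRegular h.isUnit_one_sub_sq).integrableOn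
    (continuous_potential h.toRegular h.isUnit_one_sub_sq).measurable s

theorem b_eq_exp (h : Solvable a a' a'') (s : ℝ) :
    b a s = Real.exp (-∫ r in Ioi s, potential a r) := by
  have hd : ∀ r ∈ Ici s, HasDerivAt (fun r => Real.log (b a r)) (potential a r) r := fun r _ => by
    refine ((hasDerivAt_b h r).log (b_pos h r).ne').congr_deriv ?_
    rw [mul_div_cancel_right₀ _ (b_pos h r).ne']
  have ht : Filter.Tendsto (fun r => Real.log (b a r)) Filter.atTop (nhds 0) := by
    have := (tendsto_b h).log one_ne_zero
    rwa [Real.log_one] at this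
  rw [integral_Ioi_of_hasDerivAt_of_tendsto' hd (h.integrableOn_potential s) ht, zero_sub,
    neg_neg, Real.exp_log (b_pos h s)]

theorem ExpDecay.id_mul {f : ℝ → ℝ} (h : ExpDecay f) (s : ℝ) :
    ExpDecay fun x => (x - s) * f x := by
  obtain ⟨κ, hκ, h⟩ := h
  refine ⟨κ / 2, by positivity, fun c => ?_⟩
  obtain ⟨C, hC, h⟩ := h c
  -- The first summand covers c ≤ x ≤ s. The second covers x ≥ s, where half of the decay rate
  -- absorbs the linear factor through t ≤ exp t.
  let M := |c - s| * Real.exp (-(κ / 2) * c) + 2 / κ * Real.exp (-(κ / 2) * s)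
  refine ⟨C * M, by positivity, fun x hx => ?_⟩
  have h1 : |x - s| * Real.exp (-(κ / 2) * x) ≤ M := by
    rcases le_total s x with hs | hs
    · have h2 := Real.add_one_le_exp (κ / 2 * (x - s))
      have h3 : x - s ≤ 2 / κ * Real.exp (κ / 2 * (x - s)) := by
        rw [div_mul_eq_mul_div, le_div_iff₀ hκ]
        linarith
      have h4 : (x - s) * Real.exp (-(κ / 2) * x) ≤ 2 / κ * Real.exp (-(κ / 2) * s) := by
        refine (mul_le_mul_of_nonneg_right h3 (Real.exp_pos _).le).trans_eq ?_
        rw [mul_assoc, ← Real.exp_add]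
        ring_nf
      rw [abs_of_nonneg (sub_nonneg.2 hs)]
      exact h4.trans (le_add_of_nonneg_left (by positivity))
    · refine le_trans (mul_le_mul ?_ (Real.exp_le_exp.2 (by nlinarith)) (Real.exp_pos _).le
        (abs_nonneg _)) (le_add_of_nonneg_right (by positivity))
      rw [abs_of_nonpos (by linarith), abs_of_nonpos (by linarith)]
      linarith
  rw [abs_mul]
  refine (mul_le_mul_of_nonneg_left (h x hx) (abs_nonneg _)).trans ?_
  have h5 : Real.exp (-κ * x) = Real.exp (-(κ / 2) * x) * Real.exp (-(κ / 2) * x) := by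
    rw [← Real.exp_add]
    ring_nf
  rw [h5]
  have h6 := mul_le_mul_of_nonneg_left h1 (mul_nonneg hC (Real.exp_pos (-(κ / 2) * x)).le)
  linarith

theorem Solvable.integrableOn_mul_potential_sq (h : Solvable a a' a'') (s t : ℝ) :
    IntegrableOn (fun r => (r - t) * potential a r ^ 2) (Ioi s) := by
  have hc := continuous_potential h.toRegular h.isUnit_one_sub_sq
  exact (((expDecay_potential h.toRegular h.isUnit_one_sub_sq).sq).id_mul t).integrableOn
    (by fun_prop : Continuous fun r => (r - t) * potential a r ^ 2).measurable s

/-- Two integrations in one: log Det - (r - s)p has derivative (r - s)q², since p is the logarithmic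
derivative and p' = -q². The correction vanishes at r = s and decays at +∞. -/
theorem fredholmDet_kerK_eq_exp (h : Solvable a a' a'') (s : ℝ) :
    fredholmDet (kerK a s) = Real.exp (-∫ r in Ioi s, (r - s) * potential a r ^ 2) := by
  obtain ⟨h1, h2, h3⟩ := fredholmDet_kerK_ode h.toRegular h.isUnit_one_sub_sq
  let F : ℝ → ℝ := fun r => Real.log (fredholmDet (kerK a r)) - (r - s) * squareDensity a r
  have hd : ∀ r ∈ Ici s, HasDerivAt F ((r - s) * potential a r ^ 2) r := fun r _ => by
    refine (((h1 r).log (h3 r).ne').sub (((hasDerivAt_id r).sub_const s).mul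
      (hasDerivAt_squareDensity h.toRegular (h.isUnit_one_sub_sq r)))).congr_deriv ?_
    rw [mul_div_cancel_right₀ _ (h3 r).ne']
    simp only [id]
    ring
  have ht : Filter.Tendsto F Filter.atTop (nhds 0) := by
    have := (h2.log one_ne_zero).sub
      ((expDecay_squareDensity h.toRegular h.isUnit_one_sub_sq).id_mul s).tendsto_zero
    rwa [Real.log_one, sub_zero] at this
  rw [integral_Ioi_of_hasDerivAt_of_tendsto' hd (h.integrableOn_mul_potential_sq s s) ht, zero_sub,
    neg_neg]
  simp only [F, sub_self, zero_mul, sub_zero]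
  rw [Real.exp_log (h3 s)]

/-- `Det(I - K_s) = Det(I - A_s) Det(I + A_s)`. -/
theorem fredholmDet_kerK_eq_mul (h : Solvable a a' a'') (s : ℝ) :
    fredholmDet (kerK a s) = fredholmDet (kerA a s) * fredholmDet (kerNegA a s) := by
  obtain ⟨h1, h2, h3⟩ := fredholmDet_kerK_ode h.toRegular h.isUnit_one_sub_sq
  obtain ⟨h4, h5, -⟩ := fredholmDet_kerA_ode h.toRegular h.isUnit_one_sub h.isUnit_one_sub_sq
  obtain ⟨h6, h7⟩ := fredholmDet_kerNegA_ode h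
  -- The logarithmic derivatives agree, so the quotient is constant, and its limit at +∞ is 1. The
  -- product formula thus needs no composition theorem for determinants.
  let G : ℝ → ℝ := fun s =>
    fredholmDet (kerA a s) * fredholmDet (kerNegA a s) / fredholmDet (kerK a s)
  have hd : ∀ t, HasDerivAt G 0 t := fun t => by
    refine (((h4 t).mul (h6 t)).div (h1 t) (h3 t).ne').congr_deriv ?_
    rw [div_eq_zero_iff]
    left
    simp only [Pi.mul_apply]
    ring
  have hG : ∀ x y, G x = G y :=
    is_const_of_deriv_eq_zero (fun t => (hd t).differentiableAt) fun t => (hd t).deriv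
  have ht : Filter.Tendsto G Filter.atTop (nhds (1 * 1 / 1)) := (h5.mul h7).div h2 one_ne_zero
  have h8 : G s = 1 * 1 / 1 :=
    tendsto_nhds_unique (tendsto_const_nhds.congr fun t => hG s t) ht
  have h9 : fredholmDet (kerA a s) * fredholmDet (kerNegA a s) / fredholmDet (kerK a s) = 1 := by
    simpa using h8
  exact ((div_eq_one_iff_eq (h3 s).ne').1 h9).symm

/-! ### The perturbed determinants -/

theorem fredholmConverges_kerK_add (hr : Regular a a' a'') (s : ℝ) {v : ℝ → ℝ} {B : ℝ}
    (hv : Measurable v) (hB : ∀ y, 0 ≤ y → |v y| ≤ B) :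
    FredholmConverges fun x y => kerK a s x y + a (s + x) * v y := by
  obtain ⟨w, hw, -⟩ := exists_dominated_kerK hr s
  obtain ⟨w', hw', -⟩ := exists_dominated_kerA hr s
  have ha : Measurable a := hr.continuous.measurable
  refine Dominated.fredholmConverges (w := fun x => w x + w' x * B)
    ⟨?_, fun x y hx hy => ?_, hw.integrable.add (hw'.integrable.mul_const B)⟩
  · exact hw.measurable.add ((ha.comp (by fun_prop : Measurable fun p : ℝ × ℝ => s + p.1)).mul
      (hv.comp measurable_snd))
  · refine (abs_add_le _ _).trans (add_le_add (hw.bound x y hx hy) ?_)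
    rw [abs_mul]
    have h1 := hw'.bound x 0 hx le_rfl
    rw [kerA, add_zero, add_comm] at h1
    exact mul_le_mul h1 (hB y hy) (abs_nonneg _) (hw'.nonneg hx)

/-- All the perturbed kernels share the column factor A_s|δ⟩, and (I - K_s)⁻¹ maps it to e; only the
row factor varies. -/
theorem fredholmDet_kerK_add (h : Solvable a a' a'') (s : ℝ) {v : ℝ → ℝ} {B : ℝ}
    (hv : Measurable v) (hB : ∀ y, 0 ≤ y → |v y| ≤ B) :
    fredholmDet (fun x y => kerK a s x y + a (s + x) * v y)
      = fredholmDet (kerK a s) * (1 - pair v (evenVec a s)) := by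
  have hr := h.toRegular
  obtain ⟨w, hw, hw2⟩ := exists_dominated_kerK hr s
  obtain ⟨w', hw', hw2'⟩ := exists_dominated_kerA hr s
  have hk : Dominated (kerK a s) fun x => w x + w' x :=
    ⟨hw.measurable, fun x y hx hy => (hw.bound x y hx hy).trans
      (le_add_of_nonneg_right (hw'.nonneg hx)), hw.integrable.add hw'.integrable⟩
  have hu : DominatedFun (fun x => a (s + x)) fun x => w x + w' x := by
    refine ⟨hr.continuous.measurable.comp (by fun_prop), fun x hx => ?_⟩
    have h1 := hw'.bound x 0 hx le_rfl
    rw [kerA, add_zero, add_comm] at h1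
    exact h1.trans (le_add_of_nonneg_left (hw.nonneg hx))
  rw [fredholmDet_rankOne hk (hw2.add hw2') hu (hr.isIntegralOperator_kerK s)
    (h.isUnit_one_sub_sq s) hv hB]
  have e : toL2 (fun x => a (s + x)) = vec a s := by
    simp only [add_comm s]
    rfl
  rw [e]
  rfl

/-- Since o = A_s e, Fubini gives ⟨1|A_s|e⟩ = ⟨1|o⟩, and both integrals are known from b and its
companion for -a. -/
theorem pair_const_sub_oneA (h : Solvable a a' a'') (s c : ℝ) :
    pair (fun y => c - oneA a s y) (evenVec a s)
      = c * (1 / 2 * (bMinus a s - b a s)) - 1 / 2 * (b a s + bMinus a s - 2) := by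
  rw [← integral_evenVec h, ← integral_oddVec h, oddVec, ← pair_oneA h.toRegular, pair, pair,
    ← integral_const_mul, ← integral_sub ((integrable_evenVec h s).const_mul c)
      (integrable_oneA_mul_evenVec h s)]
  simp only [sub_mul]

theorem measurable_const_sub_oneA (hr : Regular a a' a'') (s c : ℝ) :
    Measurable fun y => c - oneA a s y := (measurable_oneA hr s).const_sub c

theorem abs_const_sub_oneA_le (hr : Regular a a' a'') (s c : ℝ) (y : ℝ) (hy : 0 ≤ y) :
    |c - oneA a s y| ≤ |c| + ∫ r in Ioi s, |a r| :=
  (abs_sub _ _).trans (by linarith [abs_oneA_le hr s hy])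

theorem kerSympl_eq (a : ℝ → ℝ) (s : ℝ) :
    kerSympl a s = fun x y => kerK a s x y + a (s + x) * (-(1 / 2) * oneA a s y) := by
  ext x y
  rw [kerSympl]
  ring

theorem measurable_mul_oneA (hr : Regular a a' a'') (s : ℝ) :
    Measurable fun y => -(1 / 2) * oneA a s y := (measurable_oneA hr s).const_mul _

theorem abs_mul_oneA_le (hr : Regular a a' a'') (s : ℝ) (y : ℝ) (hy : 0 ≤ y) :
    |-(1 / 2) * oneA a s y| ≤ 1 / 2 * ∫ r in Ioi s, |a r| := by
  rw [abs_mul, abs_neg, abs_of_pos (by norm_num : (0 : ℝ) < 1 / 2)]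
  exact mul_le_mul_of_nonneg_left (abs_oneA_le hr s hy) (by norm_num)

end

section

variable {a a' a'' : ℝ → ℝ}

/-! ### Evaluation of the perturbed determinants -/

theorem fredholmDet_kerK_mul_b (h : Solvable a a' a'') (s : ℝ) :
    fredholmDet (kerK a s) * b a s = fredholmDet (kerA a s) ^ 2 := by
  rw [fredholmDet_kerK_eq_mul h, mul_assoc, fredholmDet_kerNegA_mul_b h, sq]

theorem kerNegA_neg (a : ℝ → ℝ) (s : ℝ) : kerNegA (fun x => -a x) s = kerA a s := by
  ext x y
  simp only [kerNegA, kerA, neg_neg]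

theorem b_neg (a : ℝ → ℝ) (s : ℝ) : b (fun x => -a x) s = bMinus a s := by
  rw [b, bMinus, kerNegA_neg]

theorem fredholmDet_kerK_mul_bMinus (h : Solvable a a' a'') (s : ℝ) :
    fredholmDet (kerK a s) * bMinus a s = fredholmDet (kerNegA a s) ^ 2 := by
  have e := fredholmDet_kerNegA_mul_b h.neg s
  rw [b_neg, kerNegA_neg, kerA_neg] at e
  rw [fredholmDet_kerK_eq_mul h, mul_right_comm, e, sq]

theorem bMinus_eq_exp (h : Solvable a a' a'') (s : ℝ) :
    bMinus a s = Real.exp (∫ r in Ioi s, potential a r) := by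
  rw [← b_neg, b_eq_exp h.neg, ← integral_neg]
  simp only [potential_neg h.toRegular, neg_neg]

theorem kerOrtho_eq_thinned (a : ℝ → ℝ) (s : ℝ) : kerOrtho a s = kerOrthoThinned a 1 s := by
  ext x y
  rw [kerOrtho, kerOrthoThinned, Real.sqrt_one]

theorem Solvable.fredholmConverges_thinned (h : Solvable a a' a'') (α s : ℝ) :
    FredholmConverges (kerOrthoThinned a α s) :=
  fredholmConverges_kerK_add h.toRegular s (measurable_const_sub_oneA h.toRegular s _)
    (abs_const_sub_oneA_le h.toRegular s _)

theorem fredholmDet_thinned_eq_pair (h : Solvable a a' a'') (α s : ℝ) :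
    fredholmDet (kerOrthoThinned a α s) = fredholmDet (kerK a s) *
      (1 - pair (fun y => Real.sqrt α - oneA a s y) (evenVec a s)) :=
  fredholmDet_kerK_add h s (measurable_const_sub_oneA h.toRegular s _)
    (abs_const_sub_oneA_le h.toRegular s _)

theorem fredholmDet_thinned (h : Solvable a a' a'') (α s : ℝ) :
    fredholmDet (kerOrthoThinned a α s) = fredholmDet (kerK a s) *
      ((Real.sqrt α + 1) / 2 * b a s - (Real.sqrt α - 1) / 2 * bMinus a s) := by
  rw [fredholmDet_thinned_eq_pair h, pair_const_sub_oneA h]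
  ring

theorem fredholmDet_thinned_eq_sq (h : Solvable a a' a'') (α s : ℝ) :
    fredholmDet (kerOrthoThinned a α s) = (Real.sqrt α + 1) / 2 * fredholmDet (kerA a s) ^ 2
      - (Real.sqrt α - 1) / 2 * fredholmDet (kerNegA a s) ^ 2 := by
  rw [fredholmDet_thinned h, ← fredholmDet_kerK_mul_b h, ← fredholmDet_kerK_mul_bMinus h]
  ring

theorem fredholmDet_thinned_eq_exp (h : Solvable a a' a'') (α s : ℝ) :
    fredholmDet (kerOrthoThinned a α s)
      = Real.exp (-∫ r in Ioi s, (r - s) * potential a r ^ 2) *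
        (Real.cosh (∫ r in Ioi s, potential a r)
          - Real.sqrt α * Real.sinh (∫ r in Ioi s, potential a r)) := by
  rw [fredholmDet_thinned h, fredholmDet_kerK_eq_exp h, b_eq_exp h, bMinus_eq_exp h,
    Real.cosh_eq, Real.sinh_eq]
  ring

theorem Solvable.fredholmConverges_kerSympl (h : Solvable a a' a'') (s : ℝ) :
    FredholmConverges (kerSympl a s) := by
  rw [kerSympl_eq]
  exact fredholmConverges_kerK_add h.toRegular s (measurable_mul_oneA h.toRegular s)
    (abs_mul_oneA_le h.toRegular s)

theorem fredholmDet_kerSympl_eq_integral (h : Solvable a a' a'') (s : ℝ) :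
    fredholmDet (kerSympl a s)
      = fredholmDet (kerK a s) * (1 + 1 / 2 * ∫ y, oddVec a s y ∂halfLine) := by
  rw [kerSympl_eq, fredholmDet_kerK_add h s (measurable_mul_oneA h.toRegular s)
    (abs_mul_oneA_le h.toRegular s), oddVec, ← pair_oneA h.toRegular, pair, pair]
  simp only [mul_assoc]
  rw [integral_const_mul]
  ring

theorem fredholmDet_kerSympl (h : Solvable a a' a'') (s : ℝ) :
    fredholmDet (kerSympl a s)
      = 1 / 4 * fredholmDet (kerK a s) * (2 + b a s + bMinus a s) := by
  rw [fredholmDet_kerSympl_eq_integral h, integral_oddVec h]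
  ring

theorem fredholmDet_kerSympl_eq_sq (h : Solvable a a' a'') (s : ℝ) :
    fredholmDet (kerSympl a s)
      = 1 / 4 * (fredholmDet (kerNegA a s) + fredholmDet (kerA a s)) ^ 2 := by
  -- The squares are Det(I - K_s) times b and times its companion; the cross term is twice Det(I -
  -- K_s) by the product formula.
  rw [fredholmDet_kerSympl h, add_sq, ← fredholmDet_kerK_mul_b h, ← fredholmDet_kerK_mul_bMinus h,
    mul_assoc 2, mul_comm (fredholmDet (kerNegA a s)), ← fredholmDet_kerK_eq_mul h]
  ring

theorem fredholmDet_kerSympl_eq_exp (h : Solvable a a' a'') (s : ℝ) :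
    fredholmDet (kerSympl a s) = Real.exp (-∫ r in Ioi s, (r - s) * potential a r ^ 2) *
      Real.cosh (1 / 2 * ∫ r in Ioi s, potential a r) ^ 2 := by
  rw [fredholmDet_kerSympl h, fredholmDet_kerK_eq_exp h, b_eq_exp h, bMinus_eq_exp h]
  set I := ∫ r in Ioi s, potential a r
  -- Since b and its companion are exp(∓I), the bracket is 2 + 2 cosh I = 4 cosh²(I/2).
  have e : Real.cosh I = 2 * Real.cosh (1 / 2 * I) ^ 2 - 1 := by
    rw [show I = 2 * (1 / 2 * I) by ring, Real.cosh_two_mul, Real.sinh_sq]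
    ring_nf
  rw [Real.cosh_eq] at e
  linear_combination Real.exp (-∫ r in Ioi s, (r - s) * potential a r ^ 2) / 2 * e

end

end TauRep

end

/-! ### Assembly of the statements. -/

theorem mainTheorem9 (γ : ℝ) (hγ : γ ∈ Set.Icc (0 : ℝ) 1) (A : ℝ → ℝ)
    (hA : TauRep.Admissible γ A) (α : ℝ) (hα : 0 ≤ α) (s : ℝ) :
    -- the resolvents exist
    (TauRep.ResolventApplies (TauRep.kerK A s) (TauRep.col (TauRep.kerK A s)) ∧
      TauRep.ResolventApplies (TauRep.kerK A s) (TauRep.col (TauRep.kerA A s)) ∧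
      TauRep.ResolventApplies (TauRep.kerA A s) (TauRep.col (TauRep.kerA A s)) ∧
      TauRep.ResolventApplies (TauRep.kerNegA A s) (TauRep.col (TauRep.kerNegA A s))) ∧
    -- the inner products below are given by convergent integrals
    (MeasureTheory.Integrable
        (TauRep.resolvent (TauRep.kerK A s) (TauRep.col (TauRep.kerK A s))) TauRep.halfLine ∧
      MeasureTheory.Integrable
        (TauRep.resolvent (TauRep.kerK A s) (TauRep.col (TauRep.kerA A s))) TauRep.halfLine ∧
      MeasureTheory.Integrable
        (TauRep.resolvent (TauRep.kerA A s) (TauRep.col (TauRep.kerA A s))) TauRep.halfLine ∧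
      MeasureTheory.Integrable
        (TauRep.resolvent (TauRep.kerNegA A s) (TauRep.col (TauRep.kerNegA A s)))
        TauRep.halfLine ∧
      MeasureTheory.Integrable (fun y => A (s + y) *
        TauRep.resolvent (TauRep.kerK A s) (TauRep.col (TauRep.kerK A s)) y) TauRep.halfLine ∧
      MeasureTheory.Integrable (fun y => TauRep.oneA A s y *
        TauRep.resolvent (TauRep.kerK A s) (TauRep.col (TauRep.kerA A s)) y) TauRep.halfLine) ∧
    -- the Fredholm series converge
    (TauRep.FredholmConverges (TauRep.kerK A s) ∧
      TauRep.FredholmConverges (TauRep.kerA A s) ∧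
      TauRep.FredholmConverges (TauRep.kerNegA A s) ∧
      TauRep.FredholmConverges (TauRep.kerOrtho A s) ∧
      TauRep.FredholmConverges (TauRep.kerSympl A s) ∧
      TauRep.FredholmConverges (TauRep.kerOrthoThinned A α s)) ∧
    -- the integrals of `q₀` and of `(r - s) q₀(r)²` converge
    (MeasureTheory.IntegrableOn (TauRep.q0 A) (Set.Ioi s) ∧
      MeasureTheory.IntegrableOn (fun r => (r - s) * TauRep.q0 A r ^ 2) (Set.Ioi s)) ∧
    -- the function `b`
    (TauRep.fredholmDet (TauRep.kerNegA A s) ≠ 0 ∧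
      TauRep.b A s
        = TauRep.fredholmDet (TauRep.kerA A s) / TauRep.fredholmDet (TauRep.kerNegA A s) ∧
      HasDerivAt (TauRep.b A) (TauRep.q0 A s * TauRep.b A s) s ∧
      TauRep.b A s = Real.exp (-∫ r in Set.Ioi s, TauRep.q0 A r)) ∧
    -- the orthogonal-like determinant
    (TauRep.fredholmDet (TauRep.kerOrtho A s)
        = TauRep.fredholmDet (TauRep.kerK A s) *
          (1 - TauRep.pair (fun y => 1 - TauRep.oneA A s y)
            (TauRep.resolvent (TauRep.kerK A s) (TauRep.col (TauRep.kerA A s)))) ∧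
      TauRep.fredholmDet (TauRep.kerOrtho A s)
        = TauRep.fredholmDet (TauRep.kerK A s) * TauRep.b A s ∧
      TauRep.fredholmDet (TauRep.kerOrtho A s) = TauRep.fredholmDet (TauRep.kerA A s) ^ 2 ∧
      TauRep.fredholmDet (TauRep.kerOrtho A s)
        = Real.exp (-∫ r in Set.Ioi s, ((r - s) * TauRep.q0 A r ^ 2 + TauRep.q0 A r))) ∧
    -- the symplectic-like determinant
    (TauRep.fredholmDet (TauRep.kerSympl A s)
        = TauRep.fredholmDet (TauRep.kerK A s) *
          (1 + 1 / 2 * TauRep.pair (fun _ => 1)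
            (TauRep.resolvent (TauRep.kerK A s) (TauRep.col (TauRep.kerK A s)))) ∧
      TauRep.fredholmDet (TauRep.kerSympl A s)
        = 1 / 4 * TauRep.fredholmDet (TauRep.kerK A s) *
          (2 + TauRep.b A s + TauRep.bMinus A s) ∧
      TauRep.fredholmDet (TauRep.kerSympl A s)
        = 1 / 4 * (TauRep.fredholmDet (TauRep.kerNegA A s)
            + TauRep.fredholmDet (TauRep.kerA A s)) ^ 2 ∧
      TauRep.fredholmDet (TauRep.kerSympl A s)
        = Real.exp (-∫ r in Set.Ioi s, (r - s) * TauRep.q0 A r ^ 2) *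
          Real.cosh (1 / 2 * ∫ r in Set.Ioi s, TauRep.q0 A r) ^ 2) ∧
    -- the orthogonal-thinned-like determinant
    (TauRep.fredholmDet (TauRep.kerOrthoThinned A α s)
        = TauRep.fredholmDet (TauRep.kerK A s) *
          (1 - TauRep.pair (fun y => Real.sqrt α - TauRep.oneA A s y)
            (TauRep.resolvent (TauRep.kerK A s) (TauRep.col (TauRep.kerA A s)))) ∧
      TauRep.fredholmDet (TauRep.kerOrthoThinned A α s)
        = TauRep.fredholmDet (TauRep.kerK A s) *
          ((Real.sqrt α + 1) / 2 * TauRep.b A s - (Real.sqrt α - 1) / 2 * TauRep.bMinus A s) ∧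
      TauRep.fredholmDet (TauRep.kerOrthoThinned A α s)
        = (Real.sqrt α + 1) / 2 * TauRep.fredholmDet (TauRep.kerA A s) ^ 2
          - (Real.sqrt α - 1) / 2 * TauRep.fredholmDet (TauRep.kerNegA A s) ^ 2 ∧
      TauRep.fredholmDet (TauRep.kerOrthoThinned A α s)
        = Real.exp (-∫ r in Set.Ioi s, (r - s) * TauRep.q0 A r ^ 2) *
          (Real.cosh (∫ r in Set.Ioi s, TauRep.q0 A r)
            - Real.sqrt α * Real.sinh (∫ r in Set.Ioi s, TauRep.q0 A r))) := by
  have h := hA.solvable hγ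
  have hr := h.toRegular
  have hq : TauRep.q0 A = TauRep.potential A := funext (TauRep.q0_eq h)
  -- The orthogonal-like case is α = 1, where cosh - sinh is a single exponential that merges with
  -- the first one.
  have hthin := TauRep.fredholmDet_thinned_eq_exp h 1 s
  rw [Real.sqrt_one, one_mul, Real.cosh_sub_sinh, ← Real.exp_add, ← neg_add,
    ← MeasureTheory.integral_add (h.integrableOn_mul_potential_sq s s)
      (h.integrableOn_potential s)] at hthin
  simp only [TauRep.kerOrtho_eq_thinned, TauRep.resolvent_kerA h, TauRep.resolvent_kerNegA h,
    TauRep.resolvent_kerK h, TauRep.resolvent_kerK_col_kerA h, hq]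
  refine ⟨⟨h.resolventApplies_kerK s (TauRep.memLp_col_kerK hr s),
      h.resolventApplies_kerK s (TauRep.memLp_col_kerA hr s), h.resolventApplies_kerA s,
      h.resolventApplies_kerNegA s⟩,
    ⟨TauRep.integrable_oddVec hr s, TauRep.integrable_evenVec h s, ?_, ?_,
      TauRep.integrable_shift_mul hr s _, TauRep.integrable_oneA_mul_evenVec h s⟩,
    ⟨?_, ?_, ?_, h.fredholmConverges_thinned 1 s, h.fredholmConverges_kerSympl s,
      h.fredholmConverges_thinned α s⟩,
    ⟨h.integrableOn_potential s, h.integrableOn_mul_potential_sq s s⟩,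
    ⟨(h.fredholmDet_kerNegA_pos s).ne', TauRep.b_eq_div h s, TauRep.hasDerivAt_b h s,
      TauRep.b_eq_exp h s⟩,
    ⟨?_, ?_, ?_, hthin⟩,
    ⟨?_, TauRep.fredholmDet_kerSympl h s, TauRep.fredholmDet_kerSympl_eq_sq h s,
      TauRep.fredholmDet_kerSympl_eq_exp h s⟩,
    ⟨TauRep.fredholmDet_thinned_eq_pair h α s, TauRep.fredholmDet_thinned h α s,
      TauRep.fredholmDet_thinned_eq_sq h α s, TauRep.fredholmDet_thinned_eq_exp h α s⟩⟩
  · exact TauRep.integrable_even_add_odd h s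
  · rw [← TauRep.evenVec_neg hr, ← TauRep.oddVec_neg hr]
    exact TauRep.integrable_even_add_odd h.neg s
  · exact (TauRep.exists_dominated_kerK hr s).choose_spec.1.fredholmConverges
  · exact (TauRep.exists_dominated_kerA hr s).choose_spec.1.fredholmConverges
  · exact (TauRep.exists_dominated_kerA hr.neg s).choose_spec.1.fredholmConverges
  · simpa only [Real.sqrt_one] using TauRep.fredholmDet_thinned_eq_pair h 1 s
  · rw [TauRep.fredholmDet_thinned h, Real.sqrt_one]
    ring
  · rw [TauRep.fredholmDet_thinned_eq_sq h, Real.sqrt_one]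
    ring
  · simpa only [TauRep.pair, one_mul] using TauRep.fredholmDet_kerSympl_eq_integral h s
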